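/- Let $n\ge 1$, let $\Omega\subset\mathbb R^n$ be open and bounded (for instance a bounded Lipschitz domain), $T>0$, $Q=\Omega\times(0,T)$, $s\in(0,1)$ and $\mu>0$. Notation. $H^s(\mathbb R^n)=\{v\in L^2(\mathbb R^n):(1+|\xi|^2)^{s/2}\mathcal F(v)\in L^2(\mathbb R^n)\}$ with norm $\|(1+|\xi|^2)^{s/2}\mathcal F(v)\|_{L^2}$; $\tilde H^s(\Omega)$ is the closure of $C_0^\infty(\Omega)$ in $H^s(\mathbb R^n)$, and $H^{-s}(\Omega)$ is its dual, into which $L^2(\Omega)$ is embedded through $\langle w,\phi\rangle=(w,\phi)_{L^2(\Omega)}$. On $\tilde H^s(\Omega)$ put $$\mathcal A(v,w)=\frac{C(n,s)}2\iint_{\mathbb R^n\times\mathbb R^n}\frac{(v(x)-v(y))(w(x)-w(y))}{|x-y|^{n+2s}}\,dx\,dy,\qquad C(n,s)=\frac{2^{2s}s\,\Gamma(s+\frac n2)}{\pi^{n/2}\Gamma(1-s)} .$$ Let $\mathbb V=\{v\in L^2(0,T;\tilde H^s(\Omega))\cap L^\infty(0,T;L^2(\Omega)):\partial_t v\in L^2(0,T;H^{-s}(\Omega))\}$.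 Identify $L^2(Q)$ with $L^2(0,T;L^2(\Omega))$; time derivatives are weak derivatives on $(0,T)$, values at $t=0$ and $t=T$ are those of the representative in $C([0,T];L^2(\Omega))$, and $\|v\|_{H^1(0,T;L^2(\Omega))}^2=\|v\|_{L^2(Q)}^2+\|\partial_t v\|_{L^2(Q)}^2$. Put $\Sigma(v,g)^2=\|v\|_{L^2(\Omega)}^2+\|g\|_{L^2(0,T;H^{-s}(\Omega))}^2$. The control problem. Given $f\in L^2(0,T;H^{-s}(\Omega))$, $u_0\in L^2(\Omega)$, $u_d\in L^2(Q)$ and $a,b\in L^2(Q)$ with $a\le b$ a.e. in $Q$, let $Z_{ad}=\{z\in L^2(Q):a\le z\le b\text{ a.e. in }Q\}$. The state of a control $z$ is $u=u(z)\in\mathbb V$ with $u(0)=u_0$ and, for a.e. $t\in(0,T)$, $$\langle\partial_t u,\phi\rangle+\mathcal A(u,\phi)=\langle f+z,\phi\rangle\qquad\forall\phi\in\tilde H^s(\Omega).$$ A pair $(\bar u,\bar z)$ with $\bar z\in Z_{ad}$ and $\bar u=u(\bar z)$ is optimal if it minimizes $$J(u,z)=\frac12\int_0^T\left(\|u-u_d\|_{L^2(\Omega)}^2+\mu\|z\|_{L^2(\Omega)}^2\right)dt$$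 among all pairs $(u(z),z)$ with $z\in Z_{ad}$. Its adjoint state is $\bar p\in\mathbb V$ with $\bar p(T)=0$ and, for a.e. $t\in(0,T)$, $$-\langle\partial_t\bar p,\phi\rangle+\mathcal A(\bar p,\phi)=(\bar u-u_d,\phi)_{L^2(\Omega)}\qquad\forall\phi\in\tilde H^s(\Omega).$$ **Theorem (time regularity estimates).** There is a constant $C>0$, depending only on $n,\Omega,T,s$ and $\mu$, such that for all data $f,u_0,u_d,a,b$ as above with $a,b\in H^1(0,T;L^2(\Omega))$, and for every optimal pair $(\bar u,\bar z)$ with adjoint state $\bar p$, the derivatives $\partial_t\bar z$ and $\partial_t\bar p$ belong to $L^2(Q)$ and $$\|\partial_t\bar z\|_{L^2(Q)}+\|\partial_t\bar p\|_{L^2(Q)}\le C\left(\Sigma(u_0,f)+\|u_d\|_{L^2(Q)}+\|a\|_{H^1(0,T;L^2(\Omega))}+\|b\|_{H^1(0,T;L^2(\Omega))}\right).$$ -/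

import Mathlib

open MeasureTheory Set Filter Topology
open scoped NNReal ENNReal FourierTransform ContDiff

noncomputable section

namespace FracHeat

/-- `ℝⁿ` with the Euclidean norm and Lebesgue measure. -/
abbrev E (n : ℕ) : Type := EuclideanSpace ℝ (Fin n)

/-! ### Sobolev spaces -/

/-- The Fourier (Plancherel) transform of a real function `v ∈ L²(ℝⁿ)`. -/
def fourierL2 (n : ℕ) : Lp ℝ 2 (volume : Measure (E n)) →ₗ[ℝ] Lp ℂ 2 (volume : Measure (E n)) :=
  (Lp.fourierTransformₗᵢ (E n) ℂ).toLinearEquiv.toLinearMap.restrictScalars ℝ ∘ₗ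
    (Complex.ofRealCLM.compLpL 2 (volume : Measure (E n))).toLinearMap

/-- `ξ ↦ (1 + |ξ|²)^{s/2} 𝓕(v)(ξ)`. -/
def weightedFourier (n : ℕ) (s : ℝ≥0) (v : Lp ℝ 2 (volume : Measure (E n))) : E n → ℂ :=
  fun ξ => ((1 + ‖ξ‖ ^ 2) ^ ((s : ℝ) / 2) : ℝ) • fourierL2 n v ξ

theorem weightedFourier_add (n : ℕ) (s : ℝ≥0) (v w : Lp ℝ 2 (volume : Measure (E n))) :
    weightedFourier n s (v + w) =ᵐ[volume] weightedFourier n s v + weightedFourier n s w := by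
  have h := Lp.coeFn_add (fourierL2 n v) (fourierL2 n w)
  rw [← map_add] at h
  filter_upwards [h] with ξ hξ
  simp only [weightedFourier, Pi.add_apply, hξ, smul_add]

theorem weightedFourier_smul (n : ℕ) (s : ℝ≥0) (c : ℝ) (v : Lp ℝ 2 (volume : Measure (E n))) :
    weightedFourier n s (c • v) =ᵐ[volume] c • weightedFourier n s v := by
  have h := Lp.coeFn_smul c (fourierL2 n v)
  rw [← map_smul] at h
  filter_upwards [h] with ξ hξ
  simp only [weightedFourier, Pi.smul_apply, hξ]
  exact smul_comm _ _ _

/-- `{v ∈ L²(ℝⁿ) : (1 + |ξ|²)^{s/2} 𝓕(v) ∈ L²(ℝⁿ)}` as a vector subspace of `L²(ℝⁿ)`. -/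
def sobolevSubmodule (n : ℕ) (s : ℝ≥0) : Submodule ℝ (Lp ℝ 2 (volume : Measure (E n))) where
  carrier := {v | MemLp (weightedFourier n s v) 2 volume}
  add_mem' := fun {v w} hv hw =>
    (memLp_congr_ae (weightedFourier_add n s v w)).2 (MemLp.add hv hw)
  zero_mem' := by
    have h := weightedFourier_smul n s 0 0
    rw [zero_smul, zero_smul] at h
    exact (memLp_congr_ae h).2 MemLp.zero
  smul_mem' := fun c v hv =>
    (memLp_congr_ae (weightedFourier_smul n s c v)).2 (MemLp.const_smul hv c)

/-- The Sobolev space `H^s(ℝⁿ)`, a type of its own because its norm is not the `L²` norm. -/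
def Hs (n : ℕ) (s : ℝ≥0) : Type := sobolevSubmodule n s

instance (n : ℕ) (s : ℝ≥0) : AddCommGroup (Hs n s) :=
  inferInstanceAs (AddCommGroup (sobolevSubmodule n s))

instance (n : ℕ) (s : ℝ≥0) : Module ℝ (Hs n s) :=
  inferInstanceAs (Module ℝ (sobolevSubmodule n s))

/-- The inclusion `H^s(ℝⁿ) ⊆ L²(ℝⁿ)` as a linear map. -/
def Hs.incl (n : ℕ) (s : ℝ≥0) : Hs n s →ₗ[ℝ] Lp ℝ 2 (volume : Measure (E n)) :=
  (sobolevSubmodule n s).subtype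

theorem Hs.memLp (n : ℕ) (s : ℝ≥0) (v : Hs n s) :
    MemLp (weightedFourier n s (Hs.incl n s v)) 2 volume :=
  Subtype.property (p := fun v => v ∈ sobolevSubmodule n s) v

/-- `v ↦ (1 + |ξ|²)^{s/2} 𝓕(v)`, from `H^s(ℝⁿ)` to `L²(ℝⁿ; ℂ)`. -/
def Hs.bessel (n : ℕ) (s : ℝ≥0) : Hs n s →ₗ[ℝ] Lp ℂ 2 (volume : Measure (E n)) where
  toFun v := MemLp.toLp (weightedFourier n s (Hs.incl n s v)) (Hs.memLp n s v)
  map_add' v w :=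
    (MemLp.toLp_congr _ ((Hs.memLp n s v).add (Hs.memLp n s w))
      (weightedFourier_add n s _ _)).trans (MemLp.toLp_add _ _)
  map_smul' c v :=
    (MemLp.toLp_congr _ ((Hs.memLp n s v).const_smul c)
      (weightedFourier_smul n s c _)).trans (MemLp.toLp_const_smul _ _)

theorem Hs.norm_incl_le_bessel (n : ℕ) (s : ℝ≥0) (v : Hs n s) :
    ‖Hs.incl n s v‖ ≤ ‖Hs.bessel n s v‖ := by
  have h1 : ‖Hs.incl n s v‖ = ‖fourierL2 n (Hs.incl n s v)‖ := by
    simp only [fourierL2, LinearMap.comp_apply]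
    refine Eq.trans ?_ ((Lp.fourierTransformₗᵢ (E n) ℂ).norm_map _).symm
    refine le_antisymm (Lp.norm_le_norm_of_ae_le ?_) (Lp.norm_le_norm_of_ae_le ?_) <;>
    · have h := Complex.ofRealCLM.coeFn_compLp (Hs.incl n s v)
      filter_upwards [h] with x hx
      simp only [ContinuousLinearMap.coe_coe, ContinuousLinearMap.compLpL] at *
      erw [hx]
      simp
  rw [h1]
  refine Lp.norm_le_norm_of_ae_le ?_
  filter_upwards [MemLp.coeFn_toLp (f := weightedFourier n s (Hs.incl n s v))
    (Hs.memLp n s v)] with ξ hξ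
  have h2 : (Hs.bessel n s v) ξ = weightedFourier n s (Hs.incl n s v) ξ := hξ
  rw [h2, weightedFourier, norm_smul, Real.norm_eq_abs]
  have h3 : (1 : ℝ) ≤ (1 + ‖ξ‖ ^ 2) ^ ((s : ℝ) / 2) :=
    Real.one_le_rpow (by nlinarith [sq_nonneg ‖ξ‖]) (by positivity)
  exact le_mul_of_one_le_left (norm_nonneg _) (h3.trans (le_abs_self _))

theorem Hs.bessel_injective (n : ℕ) (s : ℝ≥0) : Function.Injective (Hs.bessel n s) := by
  rw [injective_iff_map_eq_zero]
  intro v hv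
  have h := Hs.norm_incl_le_bessel n s v
  rw [hv, norm_zero] at h
  exact Subtype.ext (norm_le_zero_iff.1 h)

/-- The norm `‖v‖_{H^s(ℝⁿ)} = ‖(1 + |ξ|²)^{s/2} 𝓕(v)‖_{L²(ℝⁿ)}`. -/
instance (n : ℕ) (s : ℝ≥0) : NormedAddCommGroup (Hs n s) :=
  NormedAddCommGroup.induced (Hs n s) (Lp ℂ 2 (volume : Measure (E n))) (Hs.bessel n s)
    (Hs.bessel_injective n s)

instance (n : ℕ) (s : ℝ≥0) : NormedSpace ℝ (Hs n s) :=
  NormedSpace.induced ℝ (Hs n s) (Lp ℂ 2 (volume : Measure (E n))) (Hs.bessel n s)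

theorem Hs.norm_def (n : ℕ) (s : ℝ≥0) (v : Hs n s) : ‖v‖ = ‖Hs.bessel n s v‖ := rfl

/-- The functions `C₀^∞(Ω)`, extended by zero, as elements of `H^s(ℝⁿ)`. -/
def testFunctions {n : ℕ} (s : ℝ≥0) (Ω : Set (E n)) : Submodule ℝ (Hs n s) where
  carrier := {v | ∃ g : E n → ℝ, ContDiff ℝ ∞ g ∧ HasCompactSupport g ∧ tsupport g ⊆ Ω ∧
    Hs.incl n s v =ᵐ[volume] g}
  add_mem' := by
    rintro v w ⟨g, hg, hgc, hgΩ, hvg⟩ ⟨h, hh, hhc, hhΩ, hwh⟩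
    refine ⟨g + h, hg.add hh, hgc.add hhc,
      (tsupport_add g h).trans (union_subset hgΩ hhΩ), ?_⟩
    rw [map_add]
    exact (Lp.coeFn_add _ _).trans (hvg.add hwh)
  zero_mem' := by
    refine ⟨0, contDiff_const, HasCompactSupport.zero, by simp [tsupport], ?_⟩
    rw [map_zero]
    exact Lp.coeFn_zero _ _ _
  smul_mem' := by
    rintro c v ⟨g, hg, hgc, hgΩ, hvg⟩
    refine ⟨c • g, hg.const_smul c, hgc.smul_left (f := fun _ => c),
      (tsupport_smul_subset_right (fun _ => c) g).trans hgΩ, ?_⟩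
    rw [map_smul]
    exact (Lp.coeFn_smul _ _).trans (hvg.const_smul c)

/-- `H̃^s(Ω)`: the closure of `C₀^∞(Ω)` in `H^s(ℝⁿ)`, with the norm of `H^s(ℝⁿ)`. -/
abbrev Htilde {n : ℕ} (s : ℝ≥0) (Ω : Set (E n)) : Type :=
  (testFunctions s Ω).topologicalClosure

/-- `H^{-s}(Ω)`: the dual of `H̃^s(Ω)`, with the dual norm. -/
abbrev Hneg {n : ℕ} (s : ℝ≥0) (Ω : Set (E n)) : Type := Htilde s Ω →L[ℝ] ℝ

/-- `L²(Ω)`. -/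
abbrev L2 {n : ℕ} (Ω : Set (E n)) : Type := Lp ℝ 2 (volume.restrict Ω)

/-- The function on `ℝⁿ` given by an element of `H̃^s(Ω)`. -/
def Htilde.toFun {n : ℕ} {s : ℝ≥0} {Ω : Set (E n)} (v : Htilde s Ω) : E n → ℝ :=
  Hs.incl n s (v : Hs n s)

theorem Htilde.memLp {n : ℕ} {s : ℝ≥0} {Ω : Set (E n)} (v : Htilde s Ω) :
    MemLp v.toFun 2 (volume.restrict Ω) :=
  (Lp.memLp (Hs.incl n s (v : Hs n s))).restrict Ω

/-- Restriction to `Ω` as a linear map. -/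
def restrLin {n : ℕ} (s : ℝ≥0) (Ω : Set (E n)) : Htilde s Ω →ₗ[ℝ] L2 Ω where
  toFun v := MemLp.toLp v.toFun v.memLp
  map_add' v w :=
    (MemLp.toLp_congr _ (v.memLp.add w.memLp) (ae_restrict_of_ae
      (Lp.coeFn_add (Hs.incl n s (v : Hs n s)) (Hs.incl n s (w : Hs n s))))).trans
      (MemLp.toLp_add _ _)
  map_smul' c v :=
    (MemLp.toLp_congr _ (v.memLp.const_smul c) (ae_restrict_of_ae
      (Lp.coeFn_smul c (Hs.incl n s (v : Hs n s))))).trans (MemLp.toLp_const_smul _ _)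

theorem norm_restrLin_le {n : ℕ} (s : ℝ≥0) (Ω : Set (E n)) (v : Htilde s Ω) :
    ‖restrLin s Ω v‖ ≤ 1 * ‖v‖ := by
  rw [one_mul]
  refine le_trans ?_ (Hs.norm_incl_le_bessel n s (v : Hs n s))
  rw [Lp.norm_def, Lp.norm_def]
  refine ENNReal.toReal_mono (Lp.eLpNorm_ne_top _) ?_
  refine (eLpNorm_congr_ae (MemLp.coeFn_toLp v.memLp)).trans_le ?_
  exact eLpNorm_mono_measure _ Measure.restrict_le_self

/-- Restriction to `Ω`, i.e. the embedding `H̃^s(Ω) ↪ L²(Ω)`. -/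
def restr {n : ℕ} (s : ℝ≥0) (Ω : Set (E n)) : Htilde s Ω →L[ℝ] L2 Ω :=
  (restrLin s Ω).mkContinuous 1 (norm_restrLin_le s Ω)

/-- The embedding `L²(Ω) ↪ H^{-s}(Ω)`, `⟨w, φ⟩ = (w, φ)_{L²(Ω)}`. -/
def toHneg {n : ℕ} (s : ℝ≥0) (Ω : Set (E n)) : L2 Ω →L[ℝ] Hneg s Ω :=
  ((innerSL ℝ : L2 Ω →L[ℝ] L2 Ω →L[ℝ] ℝ).flip.comp (restr s Ω)).flip

theorem toHneg_apply {n : ℕ} (s : ℝ≥0) (Ω : Set (E n)) (w : L2 Ω) (φ : Htilde s Ω) :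
    toHneg s Ω w φ = inner ℝ w (restr s Ω φ) := rfl

/-! ### The integral fractional Laplacian -/

/-- The normalization constant of the fractional Laplacian. -/
def fracConst (n : ℕ) (s : ℝ≥0) : ℝ :=
  (2 : ℝ) ^ (2 * (s : ℝ)) * s * Real.Gamma (s + n / 2) /
    (Real.pi ^ ((n : ℝ) / 2) * Real.Gamma (1 - s))

/-- The bilinear form of the integral fractional Laplacian. The integrand is absolutely
integrable for `v, w ∈ H̃^s(Ω)`, `0 < s < 1`. -/
def bilin {n : ℕ} {s : ℝ≥0} {Ω : Set (E n)} (v w : Htilde s Ω) : ℝ :=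
  fracConst n s / 2 *
    ∫ q : E n × E n, (v.toFun q.1 - v.toFun q.2) * (w.toFun q.1 - w.toFun q.2) /
      ‖q.1 - q.2‖ ^ ((n : ℝ) + 2 * (s : ℝ))

/-! ### Bochner spaces on `(0, T)` -/

/-- `L²(0, T; X)`. In particular `L²(Q) = L²(0, T; L²(Ω))` for `Q = Ω × (0, T)`. -/
abbrev L2T (T : ℝ) (X : Type) [NormedAddCommGroup X] : Type :=
  Lp X 2 (volume.restrict (Ioo 0 T))

/-- `v'` is the weak (distributional) time derivative on `(0, T)` of the `X`-valued function `v`. -/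
def HasWeakTimeDeriv {T : ℝ} {X : Type} [NormedAddCommGroup X] [NormedSpace ℝ X] [CompleteSpace X]
    (v v' : L2T T X) : Prop :=
  ∀ η : ℝ → ℝ, ContDiff ℝ ∞ η → HasCompactSupport η → tsupport η ⊆ Ioo 0 T →
    ∫ t in Ioo 0 T, deriv η t • v t = -∫ t in Ioo 0 T, η t • v' t

/-- `(‖v‖²_{L²(0,T;X)} + ‖v'‖²_{L²(0,T;X)})^{1/2}`: the norm of `v` in `H¹(0, T; X)`, where
`v'` is the weak time derivative of `v`. -/
def h1Norm {T : ℝ} {X : Type} [NormedAddCommGroup X] (v v' : L2T T X) : ℝ :=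
  √(‖v‖ ^ 2 + ‖v'‖ ^ 2)

/-- `v(t₀) = v₀`: the representative of `v` in `C([0, T]; L²(Ω))` has the value `v₀` at `t₀`. -/
def HasTraceAt {n : ℕ} {s : ℝ≥0} {Ω : Set (E n)} {T : ℝ} (v : L2T T (Htilde s Ω)) (t₀ : ℝ)
    (v₀ : L2 Ω) : Prop :=
  ∃ V : ℝ → L2 Ω, ContinuousOn V (Icc 0 T) ∧
    (∀ᵐ t ∂(volume.restrict (Ioo 0 T)), V t = restr s Ω (v t)) ∧ V t₀ = v₀

/-- `v ∈ 𝕍`, with time derivative `v' ∈ L²(0, T; H^{-s}(Ω))`: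
`v ∈ L²(0, T; H̃^s(Ω)) ∩ L^∞(0, T; L²(Ω))`. -/
def MemV {n : ℕ} {s : ℝ≥0} {Ω : Set (E n)} {T : ℝ} (v : L2T T (Htilde s Ω))
    (v' : L2T T (Hneg s Ω)) : Prop :=
  MemLp (fun t => restr s Ω (v t)) ∞ (volume.restrict (Ioo 0 T)) ∧
    HasWeakTimeDeriv (ContinuousLinearMap.compLp (𝕜 := ℝ) (𝕜' := ℝ) (E := L2 Ω)
      (F := Hneg s Ω) (toHneg s Ω) ((restr s Ω).compLp v)) v'

/-! ### State equation, control problem, adjoint equation -/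

/-- `u ∈ 𝕍` is the weak solution of `∂ₜu + (-Δ)^s u = f + z` in `Ω × (0, T)`, `u = 0` in
`Ωᶜ × (0, T)`, `u(0) = u₀` in `Ω`. -/
def IsState {n : ℕ} {s : ℝ≥0} {Ω : Set (E n)} {T : ℝ} (f : L2T T (Hneg s Ω)) (u₀ : L2 Ω)
    (z : L2T T (L2 Ω)) (u : L2T T (Htilde s Ω)) : Prop :=
  ∃ u' : L2T T (Hneg s Ω), MemV u u' ∧ HasTraceAt u 0 u₀ ∧
    ∀ᵐ t ∂(volume.restrict (Ioo 0 T)), ∀ φ : Htilde s Ω,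
      u' t φ + bilin (u t) φ = f t φ + toHneg s Ω (z t) φ

/-- `p ∈ 𝕍` is the weak solution of `-∂ₜp + (-Δ)^s p = u - u_d` in `Ω × (0, T)`, `p = 0` in
`Ωᶜ × (0, T)`, `p(T) = 0` in `Ω`. -/
def IsAdjointState {n : ℕ} {s : ℝ≥0} {Ω : Set (E n)} {T : ℝ} (ud : L2T T (L2 Ω))
    (u p : L2T T (Htilde s Ω)) : Prop :=
  ∃ p' : L2T T (Hneg s Ω), MemV p p' ∧ HasTraceAt p T 0 ∧
    ∀ᵐ t ∂(volume.restrict (Ioo 0 T)), ∀ φ : Htilde s Ω,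
      -(p' t φ) + bilin (p t) φ = toHneg s Ω (restr s Ω (u t) - ud t) φ

/-- The admissible controls: `a ≤ z ≤ b` a.e. in `Q` (`≤` on `L²(Ω)` is a.e. inequality). -/
def admissible {n : ℕ} {Ω : Set (E n)} {T : ℝ} (a b : L2T T (L2 Ω)) : Set (L2T T (L2 Ω)) :=
  {z | ∀ᵐ t ∂(volume.restrict (Ioo 0 T)), a t ≤ z t ∧ z t ≤ b t}

/-- The cost functional. -/
def cost {n : ℕ} {s : ℝ≥0} {Ω : Set (E n)} {T : ℝ} (μ : ℝ) (ud : L2T T (L2 Ω))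
    (u : L2T T (Htilde s Ω)) (z : L2T T (L2 Ω)) : ℝ :=
  1 / 2 * ∫ t in Ioo 0 T, (‖restr s Ω (u t) - ud t‖ ^ 2 + μ * ‖z t‖ ^ 2)

/-- `(u, z)` is an optimal state-control pair. -/
def IsOptimalPair {n : ℕ} {s : ℝ≥0} {Ω : Set (E n)} {T : ℝ} (μ : ℝ) (f : L2T T (Hneg s Ω))
    (u₀ : L2 Ω) (ud a b : L2T T (L2 Ω)) (u : L2T T (Htilde s Ω)) (z : L2T T (L2 Ω)) : Prop :=
  z ∈ admissible a b ∧ IsState f u₀ z u ∧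
    ∀ (w : L2T T (L2 Ω)) (v : L2T T (Htilde s Ω)), w ∈ admissible a b → IsState f u₀ w v →
      cost μ ud u z ≤ cost μ ud v w

/-- `Σ(v, g) = (‖v‖²_{L²(Ω)} + ‖g‖²_{L²(0,T;H^{-s}(Ω))})^{1/2}`. -/
def Sig {n : ℕ} {s : ℝ≥0} {Ω : Set (E n)} {T : ℝ} (v : L2 Ω) (g : L2T T (Hneg s Ω)) : ℝ :=
  √(‖v‖ ^ 2 + ‖g‖ ^ 2)

end FracHeat

end

noncomputable section

namespace FracHeat

/-! ### Abstract evolution equations in Hilbert spaces -/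

section Abstract

open scoped InnerProductSpace

/-! The adjoint equation runs backward from zero with right-hand side `ū - u_d` in `L²(Q)`, so
maximal regularity gives `‖∂ₜp̄‖ ≤ ‖ū - u_d‖`. The optimality condition says that `z̄` is the
pointwise projection of `-p̄/μ` onto `[a, b]`. Lattice operations do not increase increments, so the
increments of `z̄` are dominated by those of `a`, `b` and `p̄/μ`, hence by integrals of `‖∂ₜa‖ +
‖∂ₜp̄‖/μ + ‖∂ₜb‖`; bounded difference quotients then produce `∂ₜz̄`. It remains to bound `ū` in
`L²(Q)` by the data, where `a ≤ z̄ ≤ b` controls `z̄`.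

The parabolic part is abstract. The form is written as `⟪G v, G w⟫` with `G` bounded and bounded
below, and `∂ₜ` is replaced by its inverse: the primitive `K` from `0`, or from `T` for backward
problems. Both primitives have nonnegative quadratic form and commute with operators acting
pointwise in time. In `exists_strong_solution` the unknown is the time derivative `y`, with `v = (ε
+ K) y` and `y + G†G v = g`. Lax–Milgram solves this for `ε > 0`. Testing with `y` gives the
`ε`-independent bound `‖y‖ ≤ ‖g‖`, because the cross term `⟪G K y, G y⟫` is nonnegative, and weak
limits as `ε → 0` yield the strong solution. The same lemma pairs strong solutions with weak
solutions of the time-reversed problem. This duality gives the a priori bound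
(`exists_norm_lift_le`), the uniqueness behind maximal regularity (`exists_eq_primR`) and the
adjoint representation of the derivative of the cost (`exists_linearized_state`), without an energy
identity for functions in `𝕍`.

The operator `G` is the Gagliardo difference quotient (`exists_gagliardo_operator`). By Plancherel
its squared norm has the Fourier symbol `κ |ξ|^{2s}`, with `κ` found by rotation and scaling. This
bounds `G` above, and together with a Poincaré inequality on the bounded set `Ω` it bounds `G`
below. Of the constant `C(n,s)` only positivity is used. -/

/-- A bounded family in a real Hilbert space converges weakly along every ultrafilter. -/
theorem exists_weak_limit {ι X : Type*} [NormedAddCommGroup X] [InnerProductSpace ℝ X]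
    [CompleteSpace X] (U : Ultrafilter ι) (x : ι → X) (C : ℝ) (hx : ∀ i, ‖x i‖ ≤ C) :
    ∃ y : X, ‖y‖ ≤ C ∧ ∀ w, Tendsto (fun i => ⟪x i, w⟫_ℝ) U (𝓝 ⟪y, w⟫_ℝ) := by
  have hb : ∀ w i, |⟪x i, w⟫_ℝ| ≤ C * ‖w‖ := fun w i =>
    (abs_real_inner_le_norm _ _).trans (mul_le_mul_of_nonneg_right (hx i) (norm_nonneg _))
  have hlim : ∀ w, ∃ l : ℝ, Tendsto (fun i => ⟪x i, w⟫_ℝ) U (𝓝 l) := by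
    intro w
    obtain ⟨l, -, hl⟩ := (isCompact_Icc (a := -(C * ‖w‖)) (b := C * ‖w‖)).ultrafilter_le_nhds'
      (U.map (fun i => ⟪x i, w⟫_ℝ))
      (Filter.mem_map.2 (Filter.univ_mem' fun i => abs_le.1 (hb w i)))
    exact ⟨l, hl⟩
  choose l hl using hlim
  have hC : 0 ≤ C := by
    obtain ⟨i, -⟩ := U.nonempty_of_mem (Filter.univ_mem (f := (U : Filter ι)))
    exact (norm_nonneg _).trans (hx i)
  let L : X →ₗ[ℝ] ℝ :=
    { toFun := l
      map_add' := fun v w => tendsto_nhds_unique (hl (v + w))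
        (((hl v).add (hl w)).congr fun i => (inner_add_right _ _ _).symm)
      map_smul' := fun c v => tendsto_nhds_unique (hl (c • v))
        (((hl v).const_mul c).congr fun i => (real_inner_smul_right _ _ _).symm) }
  have hL : ∀ w, ‖L w‖ ≤ C * ‖w‖ := fun w =>
    le_of_tendsto (hl w).abs (Eventually.of_forall fun i => hb w i)
  refine ⟨(InnerProductSpace.toDual ℝ X).symm (L.mkContinuous C hL), ?_, fun w => ?_⟩
  · rw [LinearIsometryEquiv.norm_map]
    exact LinearMap.mkContinuous_norm_le _ hC _
  · rw [InnerProductSpace.toDual_symm_apply]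
    exact hl w

variable {V H W : Type*}
  [NormedAddCommGroup V] [InnerProductSpace ℝ V] [CompleteSpace V]
  [NormedAddCommGroup H] [InnerProductSpace ℝ H]
  [NormedAddCommGroup W] [InnerProductSpace ℝ W]

/-- Solvability of `y + G†G (ε + K) y = g`, the equation in which `∂ₜ = K⁻¹` is replaced by
`(ε + K)⁻¹`. -/
theorem exists_regularized (j : V →L[ℝ] H) (G : V →L[ℝ] W) (KV : V →L[ℝ] V) (KW : W →L[ℝ] W)
    {c : ℝ} (hc : 0 < c) (hG : ∀ v, c * ‖v‖ ≤ ‖G v‖) (hGK : ∀ v, G (KV v) = KW (G v))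
    (hKW : ∀ w, 0 ≤ ⟪KW w, w⟫_ℝ) {ε : ℝ} (hε : 0 < ε) (g : H) :
    ∃ y : V, ∀ w, ⟪j y, j w⟫_ℝ + ⟪G (ε • y + KV y), G w⟫_ℝ = ⟪g, j w⟫_ℝ := by
  let B : V →L[ℝ] V →L[ℝ] ℝ := (innerSL ℝ : H →L[ℝ] H →L[ℝ] ℝ).bilinearComp j j +
    (innerSL ℝ : W →L[ℝ] W →L[ℝ] ℝ).bilinearComp
      (G ∘L (ε • ContinuousLinearMap.id ℝ V + KV)) G
  have hB : ∀ v w, B v w = ⟪j v, j w⟫_ℝ + ⟪G (ε • v + KV v), G w⟫_ℝ := fun v w => rfl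
  -- Coercivity comes from `ε ‖G v‖²` alone, the other two terms being nonnegative. The constant
  -- degenerates as `ε → 0`, so later bounds must not use it.
  have hco : IsCoercive B := by
    refine ⟨ε * c ^ 2, by positivity, fun v => ?_⟩
    rw [hB, map_add, map_smul, inner_add_left, real_inner_smul_left, hGK]
    have h1 := hKW (G v)
    have h2 : 0 ≤ ⟪j v, j v⟫_ℝ := real_inner_self_nonneg
    have h3 : (c * ‖v‖) ^ 2 ≤ ‖G v‖ ^ 2 := pow_le_pow_left₀ (by positivity) (hG v) 2
    rw [real_inner_self_eq_norm_sq (G v)]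
    nlinarith
  let ℓ : V →L[ℝ] ℝ := (innerSL ℝ g).comp j
  obtain ⟨y, hy⟩ := hco.continuousLinearEquivOfBilin.surjective
    ((InnerProductSpace.toDual ℝ V).symm ℓ)
  refine ⟨y, fun w => ?_⟩
  rw [← hB, ← hco.continuousLinearEquivOfBilin_apply, hy, InnerProductSpace.toDual_symm_apply]
  rfl

/-- Strong solvability of `ψ + G†G v = g`, `v = K ψ`, i.e. of `∂ₜv + A v = g` with zero initial
value, and the duality with weak solutions of the reversed problem. -/
theorem exists_strong_solution [CompleteSpace H] [CompleteSpace W] (j : V →L[ℝ] H)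
    (G : V →L[ℝ] W) (KV : V →L[ℝ] V) (KH : H →L[ℝ] H) (KW : W →L[ℝ] W) {c : ℝ} (hc : 0 < c) (hG : ∀ v, c * ‖v‖ ≤ ‖G v‖)
    (hjK : ∀ v, j (KV v) = KH (j v)) (hGK : ∀ v, G (KV v) = KW (G v))
    (hKH : ∀ h, 0 ≤ ⟪KH h, h⟫_ℝ) (hKW : ∀ w, 0 ≤ ⟪KW w, w⟫_ℝ) (g : H) :
    ∃ (v : V) (ψ : H), j v = KH ψ ∧ (∀ w, ⟪ψ, j w⟫_ℝ + ⟪G v, G w⟫_ℝ = ⟪g, j w⟫_ℝ) ∧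
      ‖ψ‖ ≤ ‖g‖ ∧ ‖v‖ ≤ ‖j‖ / c ^ 2 * ‖g‖ ∧
      ∀ (U : V →L[ℝ] ℝ) (u : V) (u₀ : H), (∀ y, U (KV y) = ⟪j u - u₀, j y⟫_ℝ) →
        ⟪g, j u⟫_ℝ = U v + ⟪u₀, ψ⟫_ℝ + ⟪G u, G v⟫_ℝ := by
  obtain ⟨ε, hε, hε0⟩ : ∃ ε : ℕ → ℝ, (∀ k, 0 < ε k) ∧ Tendsto ε atTop (𝓝 0) :=
    ⟨fun k => 1 / ((k : ℝ) + 1), fun k => by positivity, tendsto_one_div_add_atTop_nhds_zero_nat⟩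
  choose y hy using fun k => exists_regularized j G KV KW hc hG hGK hKW (hε k) g
  set v : ℕ → V := fun k => ε k • y k + KV (y k) with hv
  have hjy : ∀ k, ‖j (y k)‖ ≤ ‖g‖ ∧ ε k * ‖G (y k)‖ ^ 2 ≤ ‖g‖ ^ 2 := by
    intro k
    -- Testing with `y`, the approximate time derivative, and dropping the nonnegative term `⟪KW (G
    -- y), G y⟫`.
    have h := hy k (y k)
    rw [map_add, map_smul, inner_add_left, real_inner_smul_left, hGK,
      real_inner_self_eq_norm_sq, real_inner_self_eq_norm_sq] at h
    have h1 := hKW (G (y k))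
    have h2 := real_inner_le_norm g (j (y k))
    have h3 : 0 ≤ ε k * ‖G (y k)‖ ^ 2 := mul_nonneg (hε k).le (sq_nonneg _)
    have h4 : ‖j (y k)‖ ≤ ‖g‖ := by
      by_contra hlt
      rw [not_le] at hlt
      nlinarith [norm_nonneg g]
    exact ⟨h4, by nlinarith [norm_nonneg g, sq_nonneg ‖j (y k)‖]⟩
  have hvb : ∀ k, ‖v k‖ ≤ ‖j‖ / c ^ 2 * ‖g‖ := by
    intro k
    -- Testing with `v`: the term `⟪j y, j v⟫` is nonnegative, so `‖G v‖² ≤ ⟪g, j v⟫`.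
    have h := hy k (v k)
    rw [real_inner_self_eq_norm_sq (G (v k))] at h
    have h1 : 0 ≤ ⟪j (y k), j (v k)⟫_ℝ := by
      rw [hv, map_add, map_smul, hjK, inner_add_right, real_inner_smul_right,
        real_inner_comm (KH (j (y k)))]
      exact add_nonneg (mul_nonneg (hε k).le real_inner_self_nonneg) (hKH _)
    have h2 := real_inner_le_norm g (j (v k))
    have h3 : ‖j (v k)‖ ≤ ‖j‖ * ‖v k‖ := j.le_opNorm _
    have h4 : (c * ‖v k‖) ^ 2 ≤ ‖G (v k)‖ ^ 2 := pow_le_pow_left₀ (by positivity) (hG _) 2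
    have h5 : c ^ 2 * ‖v k‖ * ‖v k‖ ≤ ‖j‖ * ‖g‖ * ‖v k‖ := by
      nlinarith [mul_le_mul_of_nonneg_left h3 (norm_nonneg g)]
    rw [div_mul_eq_mul_div, le_div_iff₀ (by positivity)]
    rcases (norm_nonneg (v k)).eq_or_lt with h0 | h0
    · rw [← h0]; simp; positivity
    · linarith [le_of_mul_le_mul_right h5 h0]
  -- The bound `ε ‖G y‖² ≤ ‖g‖²` gives `‖ε y‖ ≤ √ε ‖g‖ / c`. Thus `ε y` vanishes strongly, although
  -- `y` itself need not stay bounded in `V`.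
  have hεy : Tendsto (fun k => ε k • y k) atTop (𝓝 0) := by
    rw [tendsto_zero_iff_norm_tendsto_zero]
    have h0 : Tendsto (fun k => √(ε k) * (‖g‖ / c)) atTop (𝓝 0) := by
      have h := (Real.continuous_sqrt.tendsto 0).comp hε0
      rw [Real.sqrt_zero] at h
      have h' := h.mul_const (‖g‖ / c)
      rwa [zero_mul] at h'
    refine squeeze_zero (fun k => norm_nonneg _) (fun k => ?_) h0
    have h1 := (hjy k).2
    have h4 : (c * ‖y k‖) ^ 2 ≤ ‖G (y k)‖ ^ 2 := pow_le_pow_left₀ (by positivity) (hG _) 2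
    rw [norm_smul, Real.norm_of_nonneg (hε k).le]
    rw [← pow_le_pow_iff_left₀ (by have := hε k; positivity) (by positivity) two_ne_zero,
      mul_pow, mul_pow, Real.sq_sqrt (hε k).le, div_pow, ← mul_div_assoc,
      le_div_iff₀ (by positivity)]
    calc ε k ^ 2 * ‖y k‖ ^ 2 * c ^ 2 = ε k * (ε k * (c * ‖y k‖) ^ 2) := by ring
      _ ≤ ε k * ‖g‖ ^ 2 := mul_le_mul_of_nonneg_left
        ((mul_le_mul_of_nonneg_left h4 (hε k).le).trans h1) (hε k).le
  have hU : ((hyperfilter ℕ : Ultrafilter ℕ) : Filter ℕ) ≤ atTop :=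
    Nat.hyperfilter_le_atTop
  obtain ⟨vl, hvl, hvlim⟩ := exists_weak_limit (hyperfilter ℕ) v _ hvb
  obtain ⟨ψ, hψ, hψlim⟩ := exists_weak_limit (hyperfilter ℕ) (fun k => j (y k)) _
    (fun k => (hjy k).1)
  have hεy' := hεy.mono_left hU
  have hGlim : ∀ w, Tendsto (fun k => ⟪G (v k), G w⟫_ℝ) (hyperfilter ℕ) (𝓝 ⟪G vl, G w⟫_ℝ) := by
    intro w
    have h := hvlim (G.adjoint (G w))
    simpa only [ContinuousLinearMap.adjoint_inner_right] using h
  refine ⟨vl, ψ, ?_, fun w => ?_, hψ, hvl, fun U u u₀ hUu => ?_⟩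
  · refine ext_inner_right ℝ fun h => ?_
    have h1 := hvlim (j.adjoint h)
    have h2 := hψlim (KH.adjoint h)
    have h3 : Tendsto (fun k => ⟪j (ε k • y k), h⟫_ℝ) (hyperfilter ℕ) (𝓝 ⟪j 0, h⟫_ℝ) :=
      ((j.continuous.tendsto 0).comp hεy').inner tendsto_const_nhds
    simp only [ContinuousLinearMap.adjoint_inner_right] at h1 h2
    refine tendsto_nhds_unique h1 ?_
    have h4 := h3.add h2
    rw [map_zero, inner_zero_left, zero_add] at h4
    refine h4.congr fun k => ?_
    rw [← inner_add_left, ← hjK, ← map_add]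
  · refine tendsto_nhds_unique ((hψlim (j w)).add (hGlim w)) ?_
    refine Tendsto.congr (fun k => (hy k w).symm) tendsto_const_nhds
  -- The hypothesis on `U` concerns `K y` with `y` in `V`, whereas `ψ` is only in `H`. The identity
  -- is therefore derived for `y k`, with `u` as test function, and then passed to the limit.
  · have h1 : Tendsto (fun k => U (v k)) (hyperfilter ℕ) (𝓝 (U vl)) := by
      have h := hvlim ((InnerProductSpace.toDual ℝ V).symm U)
      have e : ∀ x, ⟪x, (InnerProductSpace.toDual ℝ V).symm U⟫_ℝ = U x := fun x => by
        rw [real_inner_comm, InnerProductSpace.toDual_symm_apply]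
      simpa only [e] using h
    have h2 : Tendsto (fun k => U (ε k • y k)) (hyperfilter ℕ) (𝓝 (U 0)) :=
      (U.continuous.tendsto 0).comp hεy'
    have h3 := (((h1.sub h2).add (hψlim u₀)).add (hGlim u))
    rw [map_zero, sub_zero, real_inner_comm u₀, real_inner_comm (G u)] at h3
    refine tendsto_nhds_unique ?_ h3
    refine Tendsto.congr (fun k => ?_) (tendsto_const_nhds (x := ⟪g, j u⟫_ℝ))
    have h4 := hy k u
    have h5 : U (v k) = U (ε k • y k) + ⟪j u - u₀, j (y k)⟫_ℝ := by
      rw [hv, map_add, hUu]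
    rw [← h4, h5, inner_sub_left, real_inner_comm (j (y k)) (j u), real_inner_comm (j (y k)) u₀]
    ring

end Abstract

/-! ### Calculus in `L²(0, T; X)` -/

section TimeCalculus

variable {T : ℝ} {X : Type} [NormedAddCommGroup X]

theorem L2T.integrable (f : L2T T X) : Integrable f (volume.restrict (Ioo 0 T)) :=
  (Lp.memLp f).integrable one_le_two

theorem intervalIntegrable_of_integrable {f : ℝ → X}
    (hf : Integrable f (volume.restrict (Ioo 0 T))) (a b : ℝ) :
    IntervalIntegrable f (volume.restrict (Ioo 0 T)) a b :=
  hf.intervalIntegrable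

/-- The embedding constant of `L²(0, T)` into `L¹(0, T)`. -/
def embConst (T : ℝ) : ℝ := ((volume.restrict (Ioo 0 T)) univ ^ (1 / 2 : ℝ)).toReal

theorem embConst_nonneg (T : ℝ) : 0 ≤ embConst T := ENNReal.toReal_nonneg

theorem integral_norm_le (f : L2T T X) : ∫ t in Ioo 0 T, ‖f t‖ ≤ ‖f‖ * embConst T := by
  have h := eLpNorm_le_eLpNorm_mul_rpow_measure_univ (μ := volume.restrict (Ioo 0 T))
    (p := 1) (q := 2) one_le_two (Lp.aestronglyMeasurable f)
  rw [eLpNorm_one_eq_lintegral_enorm] at h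
  rw [integral_norm_eq_lintegral_enorm (Lp.aestronglyMeasurable f), Lp.norm_def, embConst,
    ← ENNReal.toReal_mul]
  have e : (1 / (1 : ℝ≥0∞).toReal - 1 / (2 : ℝ≥0∞).toReal) = (1 / 2 : ℝ) := by norm_num
  rw [e] at h
  refine ENNReal.toReal_mono ?_ h
  exact ENNReal.mul_ne_top (Lp.eLpNorm_ne_top f)
    (ENNReal.rpow_ne_top_of_nonneg (by norm_num) (measure_ne_top _ _))

end TimeCalculus

section TimeCalculus

variable {T : ℝ} {X Y Z : Type} [NormedAddCommGroup X] [NormedSpace ℝ X]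
  [NormedAddCommGroup Y] [NormedSpace ℝ Y] [NormedAddCommGroup Z] [NormedSpace ℝ Z]

/-- The primitive `t ↦ ∫₀ᵗ f` of a function on `(0, T)`; it is constant outside `(0, T)`. -/
def prim (T : ℝ) (f : ℝ → X) (t : ℝ) : X := ∫ τ in (0 : ℝ)..t, f τ ∂(volume.restrict (Ioo 0 T))

theorem continuous_prim {f : ℝ → X} (hf : Integrable f (volume.restrict (Ioo 0 T))) :
    Continuous (prim T f) :=
  intervalIntegral.continuous_primitive (intervalIntegrable_of_integrable hf) 0

theorem prim_congr {f g : ℝ → X} (h : f =ᵐ[volume.restrict (Ioo 0 T)] g) (t : ℝ) :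
    prim T f t = prim T g t :=
  intervalIntegral.integral_congr_ae_restrict (ae_restrict_of_ae h)

theorem prim_sub_prim {f : ℝ → X} (hf : Integrable f (volume.restrict (Ioo 0 T))) (s t : ℝ) :
    prim T f t - prim T f s = ∫ τ in s..t, f τ ∂(volume.restrict (Ioo 0 T)) :=
  intervalIntegral.integral_interval_sub_left (intervalIntegrable_of_integrable hf _ _)
    (intervalIntegrable_of_integrable hf _ _)

theorem Ioc_ae_eq_Iic (t : ℝ) : Ioc 0 t =ᵐ[volume.restrict (Ioo 0 T)] Iic t := by
  filter_upwards [ae_restrict_mem measurableSet_Ioo] with τ hτ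
  exact propext ⟨fun h => h.2, fun h => ⟨hτ.1, h⟩⟩

theorem Ioc_ae_eq_Ici (t : ℝ) : Ioc t T =ᵐ[volume.restrict (Ioo 0 T)] Ici t := by
  have h : Ioc t T =ᵐ[volume.restrict (Ioo 0 T)] Ioi t := by
    filter_upwards [ae_restrict_mem measurableSet_Ioo] with τ hτ
    exact propext ⟨fun h => h.1, fun h => ⟨h, hτ.2.le⟩⟩
  exact h.trans Ioi_ae_eq_Ici

theorem prim_eq_Iic (f : ℝ → X) {t : ℝ} (ht : 0 ≤ t) :
    prim T f t = ∫ τ in Iic t, f τ ∂(volume.restrict (Ioo 0 T)) := by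
  rw [prim, intervalIntegral.integral_of_le ht, setIntegral_congr_set (Ioc_ae_eq_Iic t)]

theorem integral_to_end_eq_Ici (f : ℝ → X) {t : ℝ} (ht : t ≤ T) :
    ∫ τ in t..T, f τ ∂(volume.restrict (Ioo 0 T)) =
      ∫ τ in Ici t, f τ ∂(volume.restrict (Ioo 0 T)) := by
  rw [intervalIntegral.integral_of_le ht, setIntegral_congr_set (Ioc_ae_eq_Ici t)]

theorem prim_end (hT : 0 ≤ T) (f : ℝ → X) :
    prim T f T = ∫ τ in Ioo 0 T, f τ := by
  rw [prim, intervalIntegral.integral_of_le hT, Measure.restrict_restrict measurableSet_Ioc,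
    inter_eq_self_of_subset_right Ioo_subset_Ioc_self]

theorem prim_zero (f : ℝ → X) : prim T f 0 = 0 := intervalIntegral.integral_same

/-- Fubini's theorem for the primitive and its transpose. -/
theorem integral_bilin_prim [CompleteSpace X] [CompleteSpace Y] [CompleteSpace Z]
    (L : X →L[ℝ] Y →L[ℝ] Z) {f : ℝ → X} {g : ℝ → Y}
    (hf : Integrable f (volume.restrict (Ioo 0 T)))
    (hg : Integrable g (volume.restrict (Ioo 0 T))) :
    ∫ t in Ioo 0 T, L (prim T f t) (g t) =
      ∫ τ in Ioo 0 T, L (f τ) (∫ t in τ..T, g t ∂(volume.restrict (Ioo 0 T))) := by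
  set ν : Measure ℝ := volume.restrict (Ioo 0 T)
  let F : ℝ → ℝ → Z := fun t τ => {q : ℝ × ℝ | q.2 ≤ q.1}.indicator
    (fun q => L (f q.2) (g q.1)) (t, τ)
  have hF : Integrable (Function.uncurry F) (ν.prod ν) := by
    have h1 : Integrable (fun q : ℝ × ℝ => L (f q.2) (g q.1)) (ν.prod ν) :=
      Integrable.op_fst_snd (op := fun y x => L x y) (by fun_prop)
        ⟨‖L‖, fun y x => (L.le_opNorm₂ x y).trans (le_of_eq (by ring))⟩ hg hf
    exact h1.indicator (measurableSet_le measurable_snd measurable_fst)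
  have h1 : ∫ t in Ioo 0 T, L (prim T f t) (g t) = ∫ t, ∫ τ, F t τ ∂ν ∂ν := by
    refine setIntegral_congr_fun measurableSet_Ioo fun t ht => ?_
    have e : ∀ τ, F t τ = (Iic t).indicator (fun τ => L.flip (g t) (f τ)) τ := fun τ => rfl
    simp only [e]
    rw [integral_indicator measurableSet_Iic, ContinuousLinearMap.integral_comp_comm _
      hf.integrableOn, prim_eq_Iic f ht.1.le]
    rfl
  have h2 : ∫ τ in Ioo 0 T, L (f τ) (∫ t in τ..T, g t ∂ν) = ∫ τ, ∫ t, F t τ ∂ν ∂ν := by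
    refine setIntegral_congr_fun measurableSet_Ioo fun τ hτ => ?_
    have e : ∀ t, F t τ = (Ici τ).indicator (fun t => L (f τ) (g t)) t := fun t => rfl
    simp only [e]
    rw [integral_indicator measurableSet_Ici, ContinuousLinearMap.integral_comp_comm _
      hg.integrableOn, integral_to_end_eq_Ici g hτ.2.le]
  rw [h1, h2, integral_integral_swap hF]

theorem norm_prim_le (f : L2T T X) (t : ℝ) : ‖prim T f t‖ ≤ ‖f‖ * embConst T := by
  refine le_trans ?_ (integral_norm_le f)
  refine intervalIntegral.norm_integral_le_integral_norm_uIoc.trans ?_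
  exact setIntegral_le_integral (L2T.integrable f).norm (Eventually.of_forall fun _ => norm_nonneg _)

theorem memLp_prim (f : L2T T X) : MemLp (prim T f) ∞ (volume.restrict (Ioo 0 T)) :=
  memLp_top_of_bound (continuous_prim (L2T.integrable f)).aestronglyMeasurable _
    (Eventually.of_forall (norm_prim_le f))

/-- `f ↦ ∫₀ᵀ f` on `L²(0, T; X)`. -/
def integralL (T : ℝ) (X : Type) [NormedAddCommGroup X] [NormedSpace ℝ X] : L2T T X →L[ℝ] X :=
  LinearMap.mkContinuous
    { toFun := fun f => ∫ t in Ioo 0 T, f t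
      map_add' := fun f g => by
        rw [integral_congr_ae (Lp.coeFn_add f g)]
        exact integral_add (L2T.integrable f) (L2T.integrable g)
      map_smul' := fun c f => by
        rw [integral_congr_ae (Lp.coeFn_smul c f)]
        exact integral_smul c _ }
    (embConst T) fun f => by
      rw [mul_comm]
      exact (norm_integral_le_integral_norm _).trans (integral_norm_le f)

theorem integralL_apply (f : L2T T X) : integralL T X f = ∫ t in Ioo 0 T, f t := rfl

/-- The primitive as an operator on `L²(0, T; X)`. -/
def primL (T : ℝ) (X : Type) [NormedAddCommGroup X] [NormedSpace ℝ X] :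
    L2T T X →L[ℝ] L2T T X :=
  LinearMap.mkContinuous
    { toFun := fun f => ((memLp_prim f).mono_exponent le_top).toLp (prim T f)
      map_add' := fun f g => by
        rw [← MemLp.toLp_add]
        refine MemLp.toLp_congr _ _ (Eventually.of_forall fun t => ?_)
        rw [prim_congr (Lp.coeFn_add f g)]
        exact intervalIntegral.integral_add
          (intervalIntegrable_of_integrable (L2T.integrable f) _ _)
          (intervalIntegrable_of_integrable (L2T.integrable g) _ _)
      map_smul' := fun c f => by
        rw [← MemLp.toLp_const_smul]
        refine MemLp.toLp_congr _ _ (Eventually.of_forall fun t => ?_)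
        rw [prim_congr (Lp.coeFn_smul c f)]
        exact intervalIntegral.integral_smul c _ }
    (embConst T * embConst T) fun f => by
      have h := Lp.norm_le_of_ae_bound (f := ((memLp_prim f).mono_exponent le_top).toLp (prim T f))
        (p := 2) (C := ‖f‖ * embConst T) (mul_nonneg (norm_nonneg _) (embConst_nonneg T)) (by
          filter_upwards [MemLp.coeFn_toLp ((memLp_prim f).mono_exponent le_top)] with t ht
          rw [ht]
          exact norm_prim_le f t)
      have e : (measureUnivNNReal (volume.restrict (Ioo 0 T)) : ℝ) ^ (ENNReal.toReal 2)⁻¹ =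
          embConst T := by
        rw [embConst, ← ENNReal.toReal_rpow, measureUnivNNReal, ENNReal.toReal_ofNat, one_div]
        rfl
      rw [e] at h
      exact h.trans (le_of_eq (by ring))

theorem coeFn_primL (f : L2T T X) : primL T X f =ᵐ[volume.restrict (Ioo 0 T)] prim T f :=
  MemLp.coeFn_toLp ((memLp_prim f).mono_exponent le_top)

/-- `f ↦ ∫ₜᵀ f` as an operator on `L²(0, T; X)`. -/
def primR (T : ℝ) (X : Type) [NormedAddCommGroup X] [NormedSpace ℝ X] :
    L2T T X →L[ℝ] L2T T X :=
  (Lp.constL 2 (volume.restrict (Ioo 0 T)) ℝ).comp (integralL T X) - primL T X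

theorem coeFn_primR (f : L2T T X) : primR T X f =ᵐ[volume.restrict (Ioo 0 T)]
    fun t => (∫ τ in Ioo 0 T, f τ) - prim T f t := by
  have e : primR T X f = Lp.const 2 (volume.restrict (Ioo 0 T)) (integralL T X f) -
    primL T X f := rfl
  rw [e]
  filter_upwards [Lp.coeFn_sub (Lp.const 2 (volume.restrict (Ioo 0 T)) (integralL T X f))
    (primL T X f), coeFn_primL f, Lp.coeFn_const (p := 2) (μ := volume.restrict (Ioo 0 T))
    (integralL T X f)] with t h0 h1 h2
  rw [h0, Pi.sub_apply, h1, h2]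
  rfl

theorem coeFn_primR' (f : L2T T X) : primR T X f =ᵐ[volume.restrict (Ioo 0 T)]
    fun t => ∫ τ in t..T, f τ ∂(volume.restrict (Ioo 0 T)) := by
  filter_upwards [coeFn_primR f, ae_restrict_mem measurableSet_Ioo] with t h1 ht
  rw [h1, ← prim_end (ht.1.trans ht.2).le, prim_sub_prim (L2T.integrable f)]

theorem prim_compLp [CompleteSpace X] [CompleteSpace Y] (A : X →L[ℝ] Y) (f : L2T T X) (t : ℝ) :
    prim T (A.compLp f) t = A (prim T f t) := by
  rw [prim_congr (A.coeFn_compLp f)]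
  exact A.intervalIntegral_comp_comm (intervalIntegrable_of_integrable (L2T.integrable f) _ _)

theorem compLp_primL [CompleteSpace X] [CompleteSpace Y] (A : X →L[ℝ] Y) (f : L2T T X) :
    A.compLp (primL T X f) = primL T Y (A.compLp f) := by
  refine Lp.ext ?_
  filter_upwards [A.coeFn_compLp (primL T X f), coeFn_primL f, coeFn_primL (A.compLp f)]
    with t h1 h2 h3
  rw [h1, h2, h3, prim_compLp]

theorem compLp_primR [CompleteSpace X] [CompleteSpace Y] (A : X →L[ℝ] Y) (f : L2T T X) :
    A.compLp (primR T X f) = primR T Y (A.compLp f) := by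
  refine Lp.ext ?_
  filter_upwards [A.coeFn_compLp (primR T X f), coeFn_primR f, coeFn_primR (A.compLp f)]
    with t h1 h2 h3
  rw [h1, h2, h3, prim_compLp, map_sub, integral_congr_ae (A.coeFn_compLp f),
    ← A.integral_comp_comm (L2T.integrable f)]

theorem integral_bilin_primL [CompleteSpace X] [CompleteSpace Y] [CompleteSpace Z]
    (L : X →L[ℝ] Y →L[ℝ] Z) (f : L2T T X) (g : L2T T Y) :
    ∫ t in Ioo 0 T, L (primL T X f t) (g t) = ∫ t in Ioo 0 T, L (f t) (primR T Y g t) := by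
  have h := integral_bilin_prim L (L2T.integrable f) (L2T.integrable g)
  refine Eq.trans (integral_congr_ae ?_) (h.trans (integral_congr_ae ?_))
  · filter_upwards [coeFn_primL f] with t ht
    rw [ht]
  · filter_upwards [coeFn_primR' g] with t ht
    rw [ht]

end TimeCalculus

/-! ### Adjointness and positivity of the two primitives -/

section TimeHilbert

open scoped InnerProductSpace

variable {T : ℝ} {X : Type} [NormedAddCommGroup X] [InnerProductSpace ℝ X] [CompleteSpace X]

theorem inner_primL (f g : L2T T X) : ⟪primL T X f, g⟫_ℝ = ⟪f, primR T X g⟫_ℝ := by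
  rw [L2.inner_def, L2.inner_def]
  exact integral_bilin_primL (innerSL ℝ) f g

theorem inner_const (x : X) (f : L2T T X) :
    ⟪Lp.constL 2 (volume.restrict (Ioo 0 T)) ℝ x, f⟫_ℝ = ⟪x, ∫ t in Ioo 0 T, f t⟫_ℝ := by
  rw [L2.inner_def, ← integral_inner (L2T.integrable f)]
  refine integral_congr_ae ?_
  filter_upwards [Lp.coeFn_const (p := 2) (μ := volume.restrict (Ioo 0 T)) x] with t ht
  erw [ht]
  rfl

/-- The two primitives add up to the constant function with value `∫₀ᵀ f`. -/
theorem inner_primL_add_primR (f : L2T T X) :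
    ⟪primL T X f, f⟫_ℝ + ⟪primR T X f, f⟫_ℝ = ‖∫ t in Ioo 0 T, f t‖ ^ 2 := by
  rw [← inner_add_left, primR, sub_apply, add_sub_cancel,
    ContinuousLinearMap.comp_apply, inner_const, integralL_apply, real_inner_self_eq_norm_sq]

/-- The primitives are adjoint to each other and hence have the same quadratic form, which equals
`‖∫₀ᵀ f‖² / 2`. This positivity replaces the identity `∫ ⟪∂ₜv, v⟫ = ‖v(T)‖² / 2` for `v(0) = 0`. -/
theorem inner_primL_self_nonneg (f : L2T T X) : 0 ≤ ⟪primL T X f, f⟫_ℝ := by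
  have h := inner_primL_add_primR f
  rw [real_inner_comm f (primR T X f), ← inner_primL] at h
  nlinarith [sq_nonneg ‖∫ t in Ioo 0 T, f t‖]

theorem inner_primR_self_nonneg (f : L2T T X) : 0 ≤ ⟪primR T X f, f⟫_ℝ := by
  rw [real_inner_comm, ← inner_primL]
  exact inner_primL_self_nonneg f

end TimeHilbert

/-! ### Weak time derivatives and primitives -/

section WeakDerivative

variable {T : ℝ} {X : Type} [NormedAddCommGroup X] [NormedSpace ℝ X]

theorem exists_Icc_of_isCompact {K : Set ℝ} (hK : IsCompact K) (hne : K.Nonempty)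
    (hKT : K ⊆ Ioo 0 T) : ∃ α β, 0 < α ∧ β < T ∧ K ⊆ Icc α β := by
  obtain ⟨α, hα⟩ := hK.exists_isLeast hne
  obtain ⟨β, hβ⟩ := hK.exists_isGreatest hne
  exact ⟨α, β, (hKT hα.1).1, (hKT hβ.1).2, fun x hx => ⟨hα.2 hx, hβ.2 hx⟩⟩

/-- A test function on `(0, T)` with vanishing mean has a test function as primitive. -/
theorem exists_primitive_test {ζ : ℝ → ℝ} (hζ : ContDiff ℝ ∞ ζ) (hζc : HasCompactSupport ζ)
    (hζT : tsupport ζ ⊆ Ioo 0 T) (h0 : ∫ t, ζ t = 0) :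
    ∃ η : ℝ → ℝ, ContDiff ℝ ∞ η ∧ HasCompactSupport η ∧ tsupport η ⊆ Ioo 0 T ∧ deriv η = ζ := by
  rcases (tsupport ζ).eq_empty_or_nonempty with he | hne
  · rw [tsupport_eq_empty_iff] at he
    refine ⟨0, contDiff_const, HasCompactSupport.zero, by simp [tsupport], ?_⟩
    rw [he]
    ext t
    simp [Pi.zero_def]
  obtain ⟨α, β, hα, hβ, hK⟩ := exists_Icc_of_isCompact hζc hne hζT
  have hζ0 : ∀ t, t ∉ Icc α β → ζ t = 0 := fun t ht =>
    image_eq_zero_of_notMem_tsupport fun h => ht (hK h)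
  set η : ℝ → ℝ := fun t => ∫ τ in (0 : ℝ)..t, ζ τ with hη
  have hder : ∀ t, HasDerivAt η (ζ t) t := fun t =>
    intervalIntegral.integral_hasDerivAt_right (hζ.continuous.intervalIntegrable _ _)
      hζ.continuous.stronglyMeasurable.stronglyMeasurableAtFilter hζ.continuous.continuousAt
  have hd : deriv η = ζ := funext fun t => (hder t).deriv
  have hηs : Function.support η ⊆ Icc α β := by
    intro t ht
    by_contra hn
    refine ht ?_
    -- To the left of the support the integrand vanishes; to the right the integral is the full mean
    -- of `ζ`, which is zero.
    rcases lt_or_ge t α with h | h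
    · have : ∀ τ ∈ uIcc 0 t, ζ τ = 0 := fun τ hτ => hζ0 τ fun hτ' => by
        have h1 := hτ.2
        rcases le_max_iff.1 h1 with h2 | h2 <;> linarith [hτ'.1]
      rw [hη]
      simp only
      rw [intervalIntegral.integral_congr (g := fun _ => (0 : ℝ)) this]
      simp
    · have h2 : β < t := by
        by_contra h3
        exact hn ⟨h, not_lt.1 h3⟩
      rw [hη]
      simp only
      rw [intervalIntegral.integral_eq_integral_of_support_subset, h0]
      intro τ hτ
      have h3 : τ ∈ Icc α β := by
        by_contra h4
        exact hτ (hζ0 τ h4)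
      exact ⟨hα.trans_le h3.1, h3.2.trans h2.le⟩
  refine ⟨η, ?_, HasCompactSupport.intro isCompact_Icc (K := Icc α β) fun x hx => ?_, ?_, hd⟩
  · rw [contDiff_infty_iff_deriv, hd]
    exact ⟨fun t => (hder t).differentiableAt, hζ⟩
  · by_contra h
    exact hx (hηs h)
  · exact (closure_minimal hηs isClosed_Icc).trans fun t ht =>
      ⟨hα.trans_le ht.1, ht.2.trans_lt hβ⟩

theorem integrable_test_smul {η : ℝ → ℝ} (hη : Continuous η) (hηc : HasCompactSupport η)
    {f : ℝ → X} (hf : Integrable f (volume.restrict (Ioo 0 T))) :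
    Integrable (fun t => η t • f t) (volume.restrict (Ioo 0 T)) := by
  obtain ⟨C, hC⟩ := hη.bounded_above_of_compact_support hηc
  exact hf.bdd_smul C hη.aestronglyMeasurable (Eventually.of_forall hC)

/-- The du Bois-Reymond lemma. -/
theorem exists_ae_eq_const [CompleteSpace X] (hT : 0 < T) {g : ℝ → X}
    (hg : Integrable g (volume.restrict (Ioo 0 T)))
    (h : ∀ η : ℝ → ℝ, ContDiff ℝ ∞ η → HasCompactSupport η → tsupport η ⊆ Ioo 0 T →
      ∫ t in Ioo 0 T, deriv η t • g t = 0) :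
    ∃ c : X, ∀ᵐ t ∂(volume.restrict (Ioo 0 T)), g t = c := by
  -- The outer radius `T / 4` around `T / 2` keeps the support of the bump inside `(0, T)`.
  let b : ContDiffBump (T / 2) := ⟨T / 8, T / 4, by linarith, by linarith⟩
  set η₀ : ℝ → ℝ := b.normed volume with hη₀
  have h1 : ContDiff ℝ ∞ η₀ := b.contDiff_normed
  have h2 : HasCompactSupport η₀ := b.hasCompactSupport_normed
  have h3 : tsupport η₀ ⊆ Ioo 0 T := by
    rw [hη₀, b.tsupport_normed_eq, Real.closedBall_eq_Icc]
    intro t ht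
    have h4 : b.rOut = T / 4 := rfl
    rw [h4] at ht
    exact ⟨by linarith [ht.1], by linarith [ht.2]⟩
  have h4 : ∫ t, η₀ t = 1 := b.integral_normed
  set c : X := ∫ t in Ioo 0 T, η₀ t • g t
  refine ⟨c, ?_⟩
  have hgc : Integrable (fun t => g t - c) (volume.restrict (Ioo 0 T)) :=
    hg.sub (integrable_const c)
  have key := isOpen_Ioo.ae_eq_zero_of_integral_contDiff_smul_eq_zero (U := Ioo 0 T)
    (μ := (volume : Measure ℝ)) (f := fun t => g t - c)
    (IntegrableOn.locallyIntegrableOn hgc) (fun φ hφ hφc hφT => by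
      set m : ℝ := ∫ t, φ t
      -- Subtracting `m` copies of the unit-mass bump makes `φ` mean-free, hence the derivative of a
      -- test function, to which `h` applies.
      set ζ : ℝ → ℝ := fun t => φ t - m * η₀ t with hζdef
      have hm : ContDiff ℝ ∞ (fun t => m * η₀ t) := contDiff_const.mul h1
      have hmc : HasCompactSupport (fun t => m * η₀ t) := h2.mul_left
      obtain ⟨η, e1, e2, e3, e4⟩ := exists_primitive_test (T := T) (ζ := ζ) (hφ.sub hm)
        (hφc.sub hmc) ((tsupport_sub _ _).trans (union_subset hφT
          ((tsupport_mul_subset_right (f := fun _ => m) (g := η₀)).trans h3))) (by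
          rw [hζdef, integral_sub (hφ.continuous.integrable_of_hasCompactSupport hφc)
            (hm.continuous.integrable_of_hasCompactSupport hmc), integral_const_mul, h4, mul_one,
            sub_self])
      have e5 := h η e1 e2 e3
      rw [e4] at e5
      have hs : ∀ t, t ∉ Ioo 0 T → φ t • (g t - c) = 0 := fun t ht => by
        rw [image_eq_zero_of_notMem_tsupport fun h' => ht (hφT h'), zero_smul]
      have hφi : ∫ t in Ioo 0 T, φ t = m :=
        setIntegral_eq_integral_of_forall_compl_eq_zero fun t ht =>
          image_eq_zero_of_notMem_tsupport fun h' => ht (hφT h')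
      rw [← setIntegral_eq_integral_of_forall_compl_eq_zero hs]
      have i1 := integrable_test_smul hφ.continuous hφc hg
      have i2 := integrable_test_smul h1.continuous h2 hg
      have i3 : Integrable φ (volume.restrict (Ioo 0 T)) :=
        (hφ.continuous.integrable_of_hasCompactSupport hφc).restrict
      simp only [hζdef, sub_smul, mul_smul] at e5
      have i2' : Integrable (fun t => m • η₀ t • g t) (volume.restrict (Ioo 0 T)) := i2.smul m
      rw [integral_sub i1 i2', integral_smul, sub_eq_zero] at e5
      simp only [smul_sub]
      rw [integral_sub i1 (i3.smul_const c), e5, integral_smul_const, hφi, sub_self])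
  rw [ae_restrict_iff' measurableSet_Ioo]
  filter_upwards [key] with t ht hmem
  exact sub_eq_zero.1 (ht hmem)

theorem deriv_test {η : ℝ → ℝ} (hη : ContDiff ℝ ∞ η) (hηc : HasCompactSupport η) :
    Continuous (deriv η) ∧ HasCompactSupport (deriv η) :=
  ⟨hη.continuous_deriv (by norm_num), hηc.deriv⟩

theorem integral_deriv_test_to_end {η : ℝ → ℝ} (hη : ContDiff ℝ ∞ η)
    (hηT : tsupport η ⊆ Ioo 0 T) {τ : ℝ} (hτ : τ ∈ Ico 0 T) :
    ∫ t in τ..T, deriv η t ∂(volume.restrict (Ioo 0 T)) = -η τ := by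
  have h1 : η T = 0 := image_eq_zero_of_notMem_tsupport fun h => lt_irrefl _ (hηT h).2
  rw [intervalIntegral.integral_of_le hτ.2.le, Measure.restrict_restrict measurableSet_Ioc]
  have h2 : (Ioc τ T ∩ Ioo 0 T : Set ℝ) =ᵐ[volume] Ioc τ T := by
    have h3 : Ioc τ T ∩ Ioo 0 T = Ioo τ T := by
      ext t
      simp only [mem_inter_iff, mem_Ioc, mem_Ioo]
      constructor
      · rintro ⟨⟨a, b⟩, c, d⟩
        exact ⟨a, d⟩
      · rintro ⟨a, b⟩
        exact ⟨⟨a, b.le⟩, hτ.1.trans_lt a, b⟩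
    rw [h3]
    exact Ioo_ae_eq_Ioc
  rw [setIntegral_congr_set h2, ← intervalIntegral.integral_of_le hτ.2.le,
    intervalIntegral.integral_deriv_eq_sub
      (fun t _ => (hη.differentiable (by norm_num)).differentiableAt)
      ((hη.continuous_deriv (by norm_num)).intervalIntegrable _ _), h1, zero_sub]

theorem integral_deriv_test {η : ℝ → ℝ} (hη : ContDiff ℝ ∞ η) (hηT : tsupport η ⊆ Ioo 0 T) :
    ∫ t in Ioo 0 T, deriv η t = 0 := by
  rcases le_or_gt T 0 with hT | hT
  · rw [Ioo_eq_empty (not_lt.2 hT), setIntegral_empty]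
  have h0 : η 0 = 0 := image_eq_zero_of_notMem_tsupport fun h => lt_irrefl _ (hηT h).1
  have h := integral_deriv_test_to_end hη hηT (left_mem_Ico.2 hT)
  rw [h0, neg_zero] at h
  rw [← prim_end hT.le]
  exact h

/-- By Fubini the primitive is moved onto `η'`, where it becomes `∫_τ^T η' = -η(τ)`. -/
theorem integral_deriv_smul_prim [CompleteSpace X] {η : ℝ → ℝ} (hη : ContDiff ℝ ∞ η)
    (hηc : HasCompactSupport η) (hηT : tsupport η ⊆ Ioo 0 T) {f : ℝ → X}
    (hf : Integrable f (volume.restrict (Ioo 0 T))) :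
    ∫ t in Ioo 0 T, deriv η t • prim T f t = -∫ t in Ioo 0 T, η t • f t := by
  have h := integral_bilin_prim (ContinuousLinearMap.lsmul ℝ ℝ : ℝ →L[ℝ] X →L[ℝ] X).flip hf
    (g := deriv η) ((deriv_test hη hηc).1.integrable_of_hasCompactSupport
      (deriv_test hη hηc).2).restrict
  refine Eq.trans h ?_
  rw [← integral_neg]
  refine setIntegral_congr_fun measurableSet_Ioo fun τ hτ => ?_
  simp only [integral_deriv_test_to_end hη hηT (Ioo_subset_Ico_self hτ)]
  simp

theorem hasWeakTimeDeriv_of_prim [CompleteSpace X] {v v' : L2T T X} (c : X)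
    (h : ∀ᵐ t ∂(volume.restrict (Ioo 0 T)), v t = c + prim T v' t) : HasWeakTimeDeriv v v' := by
  intro η hη hηc hηT
  rw [← integral_deriv_smul_prim hη hηc hηT (L2T.integrable v')]
  have hd := deriv_test hη hηc
  have i1 : Integrable (deriv η) (volume.restrict (Ioo 0 T)) :=
    (hd.1.integrable_of_hasCompactSupport hd.2).restrict
  have i2 := integrable_test_smul (T := T) hd.1 hd.2
    ((memLp_prim v').integrable le_top)
  have e : ∫ t in Ioo 0 T, deriv η t • v t =
      ∫ t in Ioo 0 T, (deriv η t • c + deriv η t • prim T v' t) := by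
    refine integral_congr_ae ?_
    filter_upwards [h] with t ht
    rw [ht, smul_add]
  rw [e, integral_add (i1.smul_const c) i2, integral_smul_const, integral_deriv_test hη hηT,
    zero_smul, zero_add]

/-- The difference of `v` and the primitive of `v'` has zero weak derivative, so du Bois-Reymond
makes it constant. -/
theorem HasWeakTimeDeriv.exists_eq_prim [CompleteSpace X] (hT : 0 < T) {v v' : L2T T X}
    (h : HasWeakTimeDeriv v v') :
    ∃ c : X, ∀ᵐ t ∂(volume.restrict (Ioo 0 T)), v t = c + prim T v' t := by
  have i2 : Integrable (prim T v') (volume.restrict (Ioo 0 T)) :=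
    (memLp_prim v').integrable le_top
  obtain ⟨c, hc⟩ := exists_ae_eq_const hT ((L2T.integrable v).sub i2)
    fun η hη hηc hηT => by
      have hd := deriv_test hη hηc
      simp only [Pi.sub_apply, smul_sub]
      rw [integral_sub (integrable_test_smul hd.1 hd.2 (L2T.integrable v))
        (integrable_test_smul hd.1 hd.2 i2), h η hη hηc hηT,
        integral_deriv_smul_prim hη hηc hηT (L2T.integrable v'), sub_self]
  refine ⟨c, ?_⟩
  filter_upwards [hc] with t ht
  rw [← ht, Pi.sub_apply, sub_add_cancel]

end WeakDerivative

/-! ### Weak derivatives from bounded difference quotients -/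

section DifferenceQuotient

open scoped InnerProductSpace Convolution

variable {T : ℝ}

theorem sq_lintegral_Ioc_le (ν : Measure ℝ) (hν : ν ≤ volume) {m : ℝ → ℝ}
    (hm : AEStronglyMeasurable m ν) (h t : ℝ) :
    (∫⁻ τ in Ioc t (t + h), ‖m τ‖ₑ ∂ν) ^ 2 ≤
      ENNReal.ofReal h * ∫⁻ τ in Ioc t (t + h), ‖m τ‖ₑ ^ 2 ∂ν := by
  have h1 := eLpNorm_le_eLpNorm_mul_rpow_measure_univ (μ := ν.restrict (Ioc t (t + h)))
    (p := 1) (q := 2) one_le_two hm.restrict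
  rw [eLpNorm_one_eq_lintegral_enorm] at h1
  have e : (1 / (1 : ℝ≥0∞).toReal - 1 / (2 : ℝ≥0∞).toReal) = (1 / 2 : ℝ) := by norm_num
  have e2 : eLpNorm m 2 (ν.restrict (Ioc t (t + h))) ^ 2 =
      ∫⁻ τ in Ioc t (t + h), ‖m τ‖ₑ ^ 2 ∂ν := by
    have := eLpNorm_nnreal_pow_eq_lintegral (f := m) (p := 2) (μ := ν.restrict (Ioc t (t + h)))
      two_ne_zero
    simpa using this
  have e3 : (ν.restrict (Ioc t (t + h)) univ) ≤ ENNReal.ofReal h := by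
    rw [Measure.restrict_apply_univ]
    refine (hν _).trans ?_
    rw [Real.volume_Ioc, add_sub_cancel_left]
  rw [e] at h1
  calc (∫⁻ τ in Ioc t (t + h), ‖m τ‖ₑ ∂ν) ^ 2
      ≤ (eLpNorm m 2 (ν.restrict (Ioc t (t + h))) *
        ν.restrict (Ioc t (t + h)) univ ^ (1 / 2 : ℝ)) ^ 2 := by gcongr
    _ = (∫⁻ τ in Ioc t (t + h), ‖m τ‖ₑ ^ 2 ∂ν) * ν.restrict (Ioc t (t + h)) univ := by
        rw [mul_pow, e2, ← ENNReal.rpow_natCast (_ ^ (1 / 2 : ℝ)), ← ENNReal.rpow_mul]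
        norm_num
    _ ≤ _ := by
        rw [mul_comm]
        gcongr

/-- Cauchy–Schwarz on each window gives one factor `h`. After Tonelli, a fixed `τ` lies in the
window `(t, t + h]` only for `t ∈ [τ - h, τ)`, which gives the other. -/
theorem lintegral_sq_lintegral_Ioc_le (ν : Measure ℝ) [SFinite ν] (hν : ν ≤ volume) {m : ℝ → ℝ}
    (hm : AEStronglyMeasurable m ν) (h : ℝ) :
    ∫⁻ t, (∫⁻ τ in Ioc t (t + h), ‖m τ‖ₑ ∂ν) ^ 2 ∂ν ≤
      ENNReal.ofReal h ^ 2 * ∫⁻ τ, ‖m τ‖ₑ ^ 2 ∂ν := by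
  let S : Set (ℝ × ℝ) := {q | q.1 < q.2 ∧ q.2 ≤ q.1 + h}
  have hS : MeasurableSet S := (measurableSet_lt measurable_fst measurable_snd).inter
    (measurableSet_le measurable_snd (measurable_fst.add_const h))
  have hF : AEMeasurable (fun q : ℝ × ℝ => S.indicator (fun q => ‖m q.2‖ₑ ^ 2) q)
      (ν.prod ν) :=
    ((hm.enorm.pow_const 2).comp_snd).indicator hS
  calc ∫⁻ t, (∫⁻ τ in Ioc t (t + h), ‖m τ‖ₑ ∂ν) ^ 2 ∂ν
      ≤ ∫⁻ t, ENNReal.ofReal h * ∫⁻ τ in Ioc t (t + h), ‖m τ‖ₑ ^ 2 ∂ν ∂ν :=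
        lintegral_mono fun t => sq_lintegral_Ioc_le ν hν hm h t
    _ = ENNReal.ofReal h * ∫⁻ t, ∫⁻ τ in Ioc t (t + h), ‖m τ‖ₑ ^ 2 ∂ν ∂ν :=
        lintegral_const_mul' _ _ ENNReal.ofReal_ne_top
    _ = ENNReal.ofReal h * ∫⁻ t, ∫⁻ τ, S.indicator (fun q => ‖m q.2‖ₑ ^ 2) (t, τ) ∂ν ∂ν := by
        congr 2 with t
        rw [← lintegral_indicator measurableSet_Ioc]
        rfl
    _ = ENNReal.ofReal h * ∫⁻ τ, ∫⁻ t, S.indicator (fun q => ‖m q.2‖ₑ ^ 2) (t, τ) ∂ν ∂ν := by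
        rw [lintegral_lintegral_swap hF]
    _ ≤ ENNReal.ofReal h * ∫⁻ τ, ‖m τ‖ₑ ^ 2 * ENNReal.ofReal h ∂ν := by
        gcongr with τ
        have e : ∀ t, S.indicator (fun q => ‖m q.2‖ₑ ^ 2) (t, τ) =
            (Ico (τ - h) τ).indicator (fun _ => ‖m τ‖ₑ ^ 2) t := by
          intro t
          simp only [indicator, S, mem_ofPred_eq, mem_Ico]
          congr 1
          rw [sub_le_iff_le_add, and_comm]
        simp only [e]
        rw [lintegral_indicator_const measurableSet_Ico]
        gcongr
        refine (hν _).trans ?_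
        rw [Real.volume_Ico, sub_sub_cancel]
    _ = _ := by
        rw [lintegral_mul_const' _ _ ENNReal.ofReal_ne_top, sq]
        ring

variable {X : Type} [NormedAddCommGroup X] [InnerProductSpace ℝ X]

/-- The two factors `h` of the window estimate cancel `h⁻²`, so the bound is uniform in `h`. Windows
reaching beyond `T` are harmless since the measure lives on `(0, T)`. -/
theorem eLpNorm_difference_quotient_le {Z : ℝ → X} {m : L2T T ℝ}
    (hZm : ∀ s t, s ≤ t → ‖Z t - Z s‖ ≤ ∫ τ in s..t, m τ ∂(volume.restrict (Ioo 0 T)))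
    {h : ℝ} (hh : 0 < h) :
    eLpNorm (fun t => h⁻¹ • (Z (t + h) - Z t)) 2 (volume.restrict (Ioo 0 T)) ≤ ‖m‖ₑ := by
  set ν : Measure ℝ := volume.restrict (Ioo 0 T)
  have h0 : ENNReal.ofReal h ≠ 0 := by simpa using hh
  have h1 : ∀ t, ‖h⁻¹ • (Z (t + h) - Z t)‖ₑ ≤
      (ENNReal.ofReal h)⁻¹ * ∫⁻ τ in Ioc t (t + h), ‖m τ‖ₑ ∂ν := by
    intro t
    rw [enorm_smul, enorm_inv hh.ne', Real.enorm_of_nonneg hh.le]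
    gcongr
    have h2 := hZm t (t + h) (by linarith)
    rw [intervalIntegral.integral_of_le (by linarith)] at h2
    calc ‖Z (t + h) - Z t‖ₑ = ENNReal.ofReal ‖Z (t + h) - Z t‖ := (ofReal_norm _).symm
      _ ≤ ENNReal.ofReal ‖∫ τ in Ioc t (t + h), m τ ∂ν‖ :=
        ENNReal.ofReal_le_ofReal (h2.trans (le_abs_self _))
      _ = ‖∫ τ in Ioc t (t + h), m τ ∂ν‖ₑ := ofReal_norm _
      _ ≤ _ := enorm_integral_le_lintegral_enorm _
  have e2 : ∀ {Y : Type} [NormedAddCommGroup Y] (f : ℝ → Y),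
      eLpNorm f 2 ν ^ 2 = ∫⁻ τ, ‖f τ‖ₑ ^ 2 ∂ν := by
    intro Y _ f
    have := eLpNorm_nnreal_pow_eq_lintegral (f := f) (p := 2) (μ := ν) two_ne_zero
    simpa using this
  rw [← ENNReal.pow_le_pow_left_iff two_ne_zero, e2, Lp.enorm_def, e2]
  calc ∫⁻ t, ‖h⁻¹ • (Z (t + h) - Z t)‖ₑ ^ 2 ∂ν
      ≤ ∫⁻ t, ((ENNReal.ofReal h)⁻¹) ^ 2 * (∫⁻ τ in Ioc t (t + h), ‖m τ‖ₑ ∂ν) ^ 2 ∂ν := by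
        refine lintegral_mono fun t => ?_
        rw [← mul_pow]
        gcongr
        exact h1 t
    _ = ((ENNReal.ofReal h)⁻¹) ^ 2 * ∫⁻ t, (∫⁻ τ in Ioc t (t + h), ‖m τ‖ₑ ∂ν) ^ 2 ∂ν :=
        lintegral_const_mul' _ _ (ENNReal.pow_ne_top (ENNReal.inv_ne_top.2 h0))
    _ ≤ ((ENNReal.ofReal h)⁻¹) ^ 2 * (ENNReal.ofReal h ^ 2 * ∫⁻ τ, ‖m τ‖ₑ ^ 2 ∂ν) := by
        gcongr
        exact lintegral_sq_lintegral_Ioc_le ν Measure.restrict_le_self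
          (Lp.aestronglyMeasurable m) h
    _ = _ := by
        rw [← mul_assoc, ← mul_pow, ENNReal.inv_mul_cancel h0 ENNReal.ofReal_ne_top, one_pow,
          one_mul]

/-- As a function of `h`, `∫ η(t) Z(t + h) dt` is a convolution of `η` with the reflection of `Z`,
evaluated at `-h`; its derivative therefore falls on the smooth factor `η`, and `Z` need only be
continuous. -/
theorem tendsto_integral_smul_difference_quotient [CompleteSpace X] {Z : ℝ → X}
    (hZ : Continuous Z) {η : ℝ → ℝ} (hη : ContDiff ℝ ∞ η) (hηc : HasCompactSupport η) :
    Tendsto (fun h => ∫ t, η t • (h⁻¹ • (Z (t + h) - Z t))) (𝓝[≠] 0)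
      (𝓝 (-∫ t, deriv η t • Z t)) := by
  let L : ℝ →L[ℝ] X →L[ℝ] X := ContinuousLinearMap.lsmul ℝ ℝ
  have hd := hηc.hasDerivAt_convolution_left (μ := volume) L (hη.of_le (by norm_num))
    (g₀ := fun r => Z (-r)) (hZ.comp continuous_neg).locallyIntegrable 0
  have e : ∀ (f : ℝ → ℝ) (x : ℝ), (f ⋆[L, volume] fun r => Z (-r)) x =
      ∫ t, f t • Z (t - x) := by
    intro f x
    rw [convolution_def]
    simp [L]
  have hd' : HasDerivAt (fun h => ∫ t, η t • Z (t + h)) (-∫ t, deriv η t • Z t) 0 := by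
    have h1 : HasDerivAt (fun h : ℝ => -h) (-1) 0 := by simpa using hasDerivAt_neg (0 : ℝ)
    have h2 := HasDerivAt.scomp (0 : ℝ) (by simpa using hd) h1
    have h3 : (η ⋆[L, volume] fun r => Z (-r)) ∘ (fun h : ℝ => -h) =
        fun h => ∫ t, η t • Z (t + h) := by
      funext h
      simp only [Function.comp_apply, e, sub_neg_eq_add]
    rw [h3, e] at h2
    simpa using h2
  have i : ∀ h, Integrable (fun t => η t • Z (t + h)) := fun h =>
    Continuous.integrable_of_hasCompactSupport
      (hη.continuous.smul (hZ.comp (continuous_id.add continuous_const))) hηc.smul_right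
  refine (hasDerivAt_iff_tendsto_slope.1 hd').congr fun h => ?_
  have i0 := i 0
  simp only [add_zero] at i0
  rw [slope_def_module, sub_zero]
  simp only [add_zero]
  rw [← integral_sub (i h) i0, ← integral_smul]
  congr 1 with t
  rw [← smul_sub, smul_comm]

/-- A curve with values in a Hilbert space whose increments are controlled by those of the
primitive of a function in `L²(0, T)` has a weak derivative in `L²(0, T)`. -/
theorem exists_weakTimeDeriv_of_norm_sub_le [CompleteSpace X] {Z : ℝ → X} (hZ : Continuous Z)
    {z : L2T T X} (hz : ∀ᵐ t ∂(volume.restrict (Ioo 0 T)), z t = Z t) {m : L2T T ℝ}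
    (hZm : ∀ s t, s ≤ t → ‖Z t - Z s‖ ≤ ∫ τ in s..t, m τ ∂(volume.restrict (Ioo 0 T))) :
    ∃ z' : L2T T X, HasWeakTimeDeriv z z' ∧ ‖z'‖ ≤ ‖m‖ := by
  obtain ⟨ε, hε, hε0⟩ : ∃ ε : ℕ → ℝ, (∀ k, 0 < ε k) ∧ Tendsto ε atTop (𝓝 0) :=
    ⟨fun k => 1 / ((k : ℝ) + 1), fun k => by positivity, tendsto_one_div_add_atTop_nhds_zero_nat⟩
  have hmem : ∀ k, MemLp (fun t => (ε k)⁻¹ • (Z (t + ε k) - Z t)) 2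
      (volume.restrict (Ioo 0 T)) := fun k =>
    ⟨(by fun_prop : Continuous fun t => (ε k)⁻¹ • (Z (t + ε k) - Z t)).aestronglyMeasurable,
      (eLpNorm_difference_quotient_le hZm (hε k)).trans_lt enorm_lt_top⟩
  -- The derivative is a weak limit of the difference quotients, all of norm at most `‖m‖`.
  obtain ⟨z', hz', hlim⟩ := exists_weak_limit (hyperfilter ℕ) (fun k => (hmem k).toLp _) ‖m‖
    fun k => by
      rw [Lp.norm_toLp, ← toReal_enorm]
      exact ENNReal.toReal_mono enorm_ne_top (eLpNorm_difference_quotient_le hZm (hε k))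
  refine ⟨z', fun η hη hηc hηT => ?_, hz'⟩
  have hz0 : ∫ t in Ioo 0 T, deriv η t • z t = ∫ t, deriv η t • Z t := by
    refine Eq.trans ?_ (setIntegral_eq_integral_of_forall_compl_eq_zero (s := Ioo 0 T)
      fun t ht => by
        rw [image_eq_zero_of_notMem_tsupport fun h' => ht (hηT (tsupport_deriv_subset h')),
          zero_smul])
    refine integral_congr_ae ?_
    filter_upwards [hz] with t ht
    rw [ht]
  rw [hz0, ← neg_eq_iff_eq_neg]
  refine ext_inner_right ℝ fun w => ?_
  have hηw : MemLp (fun t => η t • w) 2 (volume.restrict (Ioo 0 T)) :=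
    ((hη.continuous.smul (continuous_const (y := w))).memLp_of_hasCompactSupport (hηc.smul_right (f' := fun _ => w))).restrict _
  -- Pairing with the function `t ↦ η(t) w` turns weak convergence in `L²(0, T; X)` into convergence
  -- of the `w`-components of `∫ η f`.
  have e : ∀ f : L2T T X, ⟪f, hηw.toLp _⟫_ℝ = ⟪∫ t in Ioo 0 T, η t • f t, w⟫_ℝ := by
    intro f
    rw [L2.inner_def, real_inner_comm, ← integral_inner
      (integrable_test_smul hη.continuous hηc (L2T.integrable f))]
    refine integral_congr_ae ?_
    filter_upwards [hηw.coeFn_toLp] with t ht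
    rw [ht, real_inner_smul_right, real_inner_smul_right, real_inner_comm]
  have h1 := hlim (hηw.toLp _)
  simp only [e] at h1
  have hU : Tendsto ε (hyperfilter ℕ : Ultrafilter ℕ) (𝓝[≠] 0) :=
    tendsto_nhdsWithin_iff.2 ⟨hε0.mono_left Nat.hyperfilter_le_atTop,
      Eventually.of_forall fun k => (hε k).ne'⟩
  have h2 := Tendsto.inner (𝕜 := ℝ) ((tendsto_integral_smul_difference_quotient hZ hη hηc).comp hU)
    (tendsto_const_nhds (x := w))
  refine tendsto_nhds_unique h2 (h1.congr fun k => ?_)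
  have e2 : ∫ t in Ioo 0 T, η t • ((hmem k).toLp _ : L2T T X) t =
      ∫ t, η t • ((ε k)⁻¹ • (Z (t + ε k) - Z t)) := by
    refine Eq.trans ?_ (setIntegral_eq_integral_of_forall_compl_eq_zero (s := Ioo 0 T)
      fun t ht => by rw [image_eq_zero_of_notMem_tsupport fun h' => ht (hηT h'), zero_smul])
    refine integral_congr_ae ?_
    filter_upwards [(hmem k).coeFn_toLp] with t ht
    rw [ht]
  rw [e2]
  rfl

end DifferenceQuotient

/-! ### The Gagliardo seminorm on the Fourier side -/

section Gagliardo

open scoped InnerProductSpace SchwartzMap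

variable {n : ℕ}

/-- The Fourier multiplier of the translation by `h`. -/
def translationSymbol (h ξ : E n) : ℂ := (Real.fourierChar (-⟪h, ξ⟫_ℝ) : ℂ)

theorem continuous_translationSymbol :
    Continuous fun q : E n × E n => translationSymbol q.1 q.2 := by
  unfold translationSymbol
  fun_prop

theorem norm_translationSymbol (h ξ : E n) : ‖translationSymbol h ξ‖ = 1 := Circle.norm_coe _

theorem memLp_translationSymbol (h : E n) : MemLp (translationSymbol h) ∞ volume :=
  memLp_top_of_bound ((continuous_translationSymbol.comp
    (Continuous.prodMk_right h)).aestronglyMeasurable) 1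
    (Eventually.of_forall fun ξ => (norm_translationSymbol h ξ).le)

theorem fourier_compSubConst (f : 𝓢(E n, ℂ)) (h ξ : E n) :
    𝓕 (f.compSubConstCLM ℂ h) ξ = translationSymbol h ξ * 𝓕 f ξ := by
  have h1 := congrFun (VectorFourier.fourierIntegral_comp_add_right Real.fourierChar
    (volume : Measure (E n)) (innerₗ (E n)) f (-h)) ξ
  have h2 : (f.compSubConstCLM ℂ h : E n → ℂ) = f ∘ fun v => v + -h := by
    ext v
    simp [sub_eq_add_neg]
  rw [SchwartzMap.fourier_coe, SchwartzMap.fourier_coe, h2]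
  refine h1.trans ?_
  rw [translationSymbol, Circle.smul_def, smul_eq_mul]
  simp
  rfl

/-- The translation by `h` on `L²(ℝⁿ)`. -/
def translationL (h : E n) :
    Lp ℂ 2 (volume : Measure (E n)) →L[ℂ] Lp ℂ 2 (volume : Measure (E n)) :=
  (Lp.compMeasurePreservingₗᵢ ℂ (fun x => x - h)
    (measurePreserving_sub_right volume h)).toContinuousLinearMap

theorem coeFn_translationL (h : E n) (F : Lp ℂ 2 (volume : Measure (E n))) :
    translationL h F =ᵐ[volume] fun x => F (x - h) :=
  Lp.coeFn_compMeasurePreserving F (measurePreserving_sub_right volume h)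

/-- The symbol is bounded, so multiplication by it is continuous on `L²`. Both sides are continuous
in `F` and agree on the dense set of Schwartz functions. -/
theorem fourier_translationL (h : E n) (F : Lp ℂ 2 (volume : Measure (E n))) :
    (𝓕 (translationL h F) : Lp ℂ 2 (volume : Measure (E n))) =ᵐ[volume]
      fun ξ => translationSymbol h ξ * (𝓕 F : Lp ℂ 2 (volume : Measure (E n))) ξ := by
  let M := (ContinuousLinearMap.mul ℂ ℂ).holderL (volume : Measure (E n)) ∞ 2 2
    ((memLp_translationSymbol h).toLp _)
  have hM : ∀ G : Lp ℂ 2 (volume : Measure (E n)),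
      M G =ᵐ[volume] fun ξ => translationSymbol h ξ * G ξ := by
    intro G
    refine ((ContinuousLinearMap.mul ℂ ℂ).coeFn_holder _ G).trans ?_
    filter_upwards [(memLp_translationSymbol h).coeFn_toLp] with ξ hξ
    rw [hξ]
    rfl
  have key : 𝓕 (translationL h F) = M (𝓕 F) := by
    refine DenseRange.induction_on
      (p := fun F : Lp ℂ 2 (volume : Measure (E n)) => 𝓕 (translationL h F) = M (𝓕 F))
      (SchwartzMap.denseRange_toLpCLM (F := ℂ) (p := 2) (μ := (volume : Measure (E n)))
        ENNReal.ofNat_ne_top) F ?_ ?_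
    · exact isClosed_eq ((Lp.fourierTransformₗᵢ (E n) ℂ).continuous.comp (translationL h).continuous)
        (M.continuous.comp (Lp.fourierTransformₗᵢ (E n) ℂ).continuous)
    · intro f
      have h1 : translationL h (f.toLp 2) = (f.compSubConstCLM ℂ h).toLp 2 := by
        refine Lp.ext ?_
        filter_upwards [coeFn_translationL h (f.toLp 2),
          SchwartzMap.coeFn_toLp (f.compSubConstCLM ℂ h) 2 (volume : Measure (E n)),
          (measurePreserving_sub_right volume h).quasiMeasurePreserving.ae
            (SchwartzMap.coeFn_toLp f 2 (volume : Measure (E n)))] with x a b c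
        rw [a, b, c, SchwartzMap.compSubConstCLM_apply]
      change 𝓕 (translationL h (f.toLp 2)) = M (𝓕 (f.toLp 2))
      rw [h1, SchwartzMap.toLp_fourier_eq, SchwartzMap.toLp_fourier_eq]
      refine Lp.ext ?_
      filter_upwards [hM ((𝓕 f).toLp 2), SchwartzMap.coeFn_toLp (𝓕 f) 2 (volume : Measure (E n)),
        SchwartzMap.coeFn_toLp (𝓕 (f.compSubConstCLM ℂ h)) 2 (volume : Measure (E n))] with ξ a b c
      rw [a, b, c, fourier_compSubConst]
  rw [key]
  exact hM _

theorem eLpNorm_two_sq {α Y : Type*} [MeasurableSpace α] [NormedAddCommGroup Y] (ν : Measure α)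
    (f : α → Y) : eLpNorm f 2 ν ^ 2 = ∫⁻ x, ‖f x‖ₑ ^ 2 ∂ν := by
  have h := eLpNorm_nnreal_pow_eq_lintegral (f := f) (p := 2) (μ := ν) two_ne_zero
  simpa using h

theorem enorm_sq_Lp {α Y : Type*} [MeasurableSpace α] [NormedAddCommGroup Y] {ν : Measure α}
    (f : Lp Y 2 ν) : ‖f‖ₑ ^ 2 = ∫⁻ x, ‖f x‖ₑ ^ 2 ∂ν := by
  rw [Lp.enorm_def, eLpNorm_two_sq]

theorem coeFn_ofReal (v : Lp ℝ 2 (volume : Measure (E n))) :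
    (Complex.ofRealCLM.compLp v : Lp ℂ 2 (volume : Measure (E n))) =ᵐ[volume]
      fun x => ((v x : ℝ) : ℂ) := by
  filter_upwards [Complex.ofRealCLM.coeFn_compLp v] with x hx
  rw [hx]
  rfl

/-- Plancherel applied to `v - v(· - h)`. -/
theorem lintegral_translation_sub (v : Lp ℝ 2 (volume : Measure (E n))) (h : E n) :
    ∫⁻ x, ‖v x - v (x - h)‖ₑ ^ 2 =
      ∫⁻ ξ, ‖1 - translationSymbol h ξ‖ₑ ^ 2 * ‖fourierL2 n v ξ‖ₑ ^ 2 := by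
  set F : Lp ℂ 2 (volume : Measure (E n)) := Complex.ofRealCLM.compLp v with hF
  have h1 : ∫⁻ x, ‖v x - v (x - h)‖ₑ ^ 2 = ‖F - translationL h F‖ₑ ^ 2 := by
    rw [enorm_sq_Lp]
    refine lintegral_congr_ae ?_
    filter_upwards [Lp.coeFn_sub F (translationL h F), coeFn_translationL h F, coeFn_ofReal v,
      (measurePreserving_sub_right volume h).quasiMeasurePreserving.ae (coeFn_ofReal v)]
      with x a b c d
    rw [a, Pi.sub_apply, b, hF, c, d, ← Complex.ofReal_sub]
    congr 1
    rw [← ofReal_norm, ← ofReal_norm, Complex.norm_real]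
  have h2 : ‖F - translationL h F‖ₑ = ‖𝓕 F - 𝓕 (translationL h F)‖ₑ := by
    rw [← ofReal_norm, ← ofReal_norm]
    congr 1
    have := (Lp.fourierTransformₗᵢ (E n) ℂ).norm_map (F - translationL h F)
    rw [map_sub] at this
    exact this.symm
  have h3 : fourierL2 n v = 𝓕 F := rfl
  rw [h1, h2, enorm_sq_Lp, h3]
  refine lintegral_congr_ae ?_
  filter_upwards [Lp.coeFn_sub (𝓕 F) (𝓕 (translationL h F)), fourier_translationL h F] with ξ a b
  rw [a, Pi.sub_apply, b, ← mul_pow, ← enorm_mul, sub_mul, one_mul]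

/-- Substituting `y = x - h` and exchanging integrals leaves, for fixed `h`, an `L²` norm of a
translation difference, to which Plancherel applies; a second exchange collects the symbol. -/
theorem lintegral_gagliardo (v : Lp ℝ 2 (volume : Measure (E n))) {R : E n → ℝ≥0∞}
    (hR : Measurable R) :
    ∫⁻ q : E n × E n, ‖v q.1 - v q.2‖ₑ ^ 2 * R (q.1 - q.2) =
      ∫⁻ ξ, (∫⁻ h, ‖1 - translationSymbol h ξ‖ₑ ^ 2 * R h) * ‖fourierL2 n v ξ‖ₑ ^ 2 := by
  have hv : Measurable v := (Lp.stronglyMeasurable v).measurable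
  have hw : Measurable (fourierL2 n v) := (Lp.stronglyMeasurable (fourierL2 n v)).measurable
  have hs : Measurable fun q : E n × E n => translationSymbol q.1 q.2 :=
    continuous_translationSymbol.measurable
  have m1 : Measurable fun q : E n × E n => ‖v q.1 - v q.2‖ₑ ^ 2 * R (q.1 - q.2) := by fun_prop
  have m2 : Measurable fun q : E n × E n => ‖v q.1 - v (q.1 - q.2)‖ₑ ^ 2 * R q.2 := by fun_prop
  have m3 : Measurable fun q : E n × E n =>
      ‖1 - translationSymbol q.1 q.2‖ₑ ^ 2 * ‖fourierL2 n v q.2‖ₑ ^ 2 * R q.1 := by fun_prop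
  calc ∫⁻ q : E n × E n, ‖v q.1 - v q.2‖ₑ ^ 2 * R (q.1 - q.2)
      = ∫⁻ x, ∫⁻ y, ‖v x - v y‖ₑ ^ 2 * R (x - y) := by
        rw [Measure.volume_eq_prod, lintegral_prod _ m1.aemeasurable]
    _ = ∫⁻ x, ∫⁻ h, ‖v x - v (x - h)‖ₑ ^ 2 * R h := by
        congr 1 with x
        rw [← lintegral_sub_left_eq_self _ x]
        simp only [sub_sub_cancel]
    _ = ∫⁻ h, ∫⁻ x, ‖v x - v (x - h)‖ₑ ^ 2 * R h := lintegral_lintegral_swap m2.aemeasurable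
    _ = ∫⁻ h, ∫⁻ ξ, ‖1 - translationSymbol h ξ‖ₑ ^ 2 * ‖fourierL2 n v ξ‖ₑ ^ 2 * R h := by
        congr 1 with h
        rw [lintegral_mul_const _ (by fun_prop), lintegral_translation_sub,
          lintegral_mul_const _ (by fun_prop)]
    _ = ∫⁻ ξ, ∫⁻ h, ‖1 - translationSymbol h ξ‖ₑ ^ 2 * ‖fourierL2 n v ξ‖ₑ ^ 2 * R h :=
        lintegral_lintegral_swap m3.aemeasurable
    _ = _ := by
        congr 1 with ξ
        rw [← lintegral_mul_const _ (by fun_prop)]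
        congr 1 with h
        ring

end Gagliardo

/-! ### Rotation, scaling and finiteness of the Gagliardo symbol -/

section GagliardoConstant

open scoped InnerProductSpace

variable {n : ℕ}

/-- The weight `|h|^{-(n/2+s)}`. -/
def gagWeight (n : ℕ) (s : ℝ≥0) (h : E n) : ℝ := (‖h‖ ^ (((n : ℝ) + 2 * s) / 2))⁻¹

theorem gagWeight_nonneg (s : ℝ≥0) (h : E n) : 0 ≤ gagWeight n s h := by
  unfold gagWeight
  positivity

theorem gagWeight_sq (s : ℝ≥0) (h : E n) :
    gagWeight n s h ^ 2 = (‖h‖ ^ ((n : ℝ) + 2 * s))⁻¹ := by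
  rw [gagWeight, inv_pow, ← Real.rpow_natCast (‖h‖ ^ _), ← Real.rpow_mul (norm_nonneg _)]
  norm_num

theorem measurable_gagWeight (s : ℝ≥0) : Measurable (gagWeight n s) := by
  unfold gagWeight
  fun_prop

theorem enorm_gagWeight_sq (s : ℝ≥0) (h : E n) :
    ‖gagWeight n s h‖ₑ ^ 2 = ENNReal.ofReal ((‖h‖ ^ ((n : ℝ) + 2 * s))⁻¹) := by
  rw [← gagWeight_sq, ENNReal.ofReal_pow (gagWeight_nonneg s h),
    Real.enorm_of_nonneg (gagWeight_nonneg s h)]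

/-- The Fourier symbol `ξ ↦ ∫ |1 - e^{-2πi h·ξ}|² |h|^{-(n+2s)} dh` of the Gagliardo seminorm. -/
def gagSymbol (n : ℕ) (s : ℝ≥0) (ξ : E n) : ℝ≥0∞ :=
  ∫⁻ h, ‖1 - translationSymbol h ξ‖ₑ ^ 2 * ‖gagWeight n s h‖ₑ ^ 2

/-- The reflection exchanging two vectors of equal norm preserves both Lebesgue measure and the
weight. -/
theorem gagSymbol_eq_of_norm_eq (s : ℝ≥0) {ξ w : E n} (h : ‖ξ‖ = ‖w‖) :
    gagSymbol n s ξ = gagSymbol n s w := by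
  set R : E n ≃ₗᵢ[ℝ] E n := (Submodule.span ℝ {ξ - w})ᗮ.reflection
  have hR : R ξ = w := Submodule.reflection_sub h
  have hmp : MeasurePreserving R volume volume := R.measurePreserving
  refine Eq.trans ?_ (hmp.lintegral_comp_emb R.toHomeomorph.measurableEmbedding
    fun h => ‖1 - translationSymbol h w‖ₑ ^ 2 * ‖gagWeight n s h‖ₑ ^ 2)
  rw [gagSymbol]
  congr 1 with x
  have h1 : translationSymbol (R x) w = translationSymbol x ξ := by
    rw [translationSymbol, translationSymbol, ← hR, R.inner_map_map]
  have h2 : gagWeight n s (R x) = gagWeight n s x := by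
    rw [gagWeight, gagWeight, R.norm_map]
  rw [h1, h2]

theorem lintegral_comp_smul (f : E n → ℝ≥0∞) {r : ℝ} (hr : 0 < r) :
    ∫⁻ x, f (r • x) = ENNReal.ofReal ((r ^ n)⁻¹) * ∫⁻ x, f x := by
  have hemb : MeasurableEmbedding fun x : E n => r • x :=
    (Homeomorph.smulOfNeZero r hr.ne').measurableEmbedding
  rw [← hemb.lintegral_map, Measure.map_addHaar_smul _ hr.ne', lintegral_smul_measure,
    finrank_euclideanSpace_fin, abs_of_pos (by positivity), smul_eq_mul]

/-- Substituting `h ↦ r h` gives `r^{n+2s}` from the weight and `r^{-n}` from the Jacobian. -/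
theorem gagSymbol_smul (s : ℝ≥0) (ξ : E n) {r : ℝ} (hr : 0 < r) :
    gagSymbol n s (r • ξ) = ENNReal.ofReal (r ^ (2 * (s : ℝ))) * gagSymbol n s ξ := by
  have h1 : ∀ h : E n, ‖1 - translationSymbol h (r • ξ)‖ₑ ^ 2 * ‖gagWeight n s h‖ₑ ^ 2 =
      ENNReal.ofReal (r ^ ((n : ℝ) + 2 * s)) *
        (‖1 - translationSymbol (r • h) ξ‖ₑ ^ 2 * ‖gagWeight n s (r • h)‖ₑ ^ 2) := by
    intro h
    have e1 : translationSymbol h (r • ξ) = translationSymbol (r • h) ξ := by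
      rw [translationSymbol, translationSymbol, inner_smul_left, inner_smul_right]
      rfl
    have e2 : (‖h‖ ^ ((n : ℝ) + 2 * s))⁻¹ =
        r ^ ((n : ℝ) + 2 * s) * (‖r • h‖ ^ ((n : ℝ) + 2 * s))⁻¹ := by
      rw [norm_smul, Real.norm_of_nonneg hr.le, Real.mul_rpow hr.le (norm_nonneg _), mul_inv,
        mul_inv_cancel_left₀ (Real.rpow_pos_of_pos hr _).ne']
    rw [e1, enorm_gagWeight_sq, enorm_gagWeight_sq, e2, ENNReal.ofReal_mul (by positivity)]
    ring
  simp only [gagSymbol, h1]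
  rw [lintegral_const_mul' _ _ ENNReal.ofReal_ne_top, lintegral_comp_smul
    (fun h => ‖1 - translationSymbol h ξ‖ₑ ^ 2 * ‖gagWeight n s h‖ₑ ^ 2) hr, ← mul_assoc,
    ← ENNReal.ofReal_mul (by positivity)]
  congr 2
  rw [Real.rpow_add hr, Real.rpow_natCast]
  field_simp

theorem norm_one_sub_translationSymbol_le (h ξ : E n) :
    ‖1 - translationSymbol h ξ‖ ≤ 2 ∧ ‖1 - translationSymbol h ξ‖ ≤ 2 * Real.pi * ‖h‖ * ‖ξ‖ := by
  constructor
  · refine (norm_sub_le _ _).trans ?_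
    rw [norm_translationSymbol, norm_one]
    norm_num
  · have h1 : translationSymbol h ξ = Complex.exp (Complex.I * ((2 * Real.pi * -⟪h, ξ⟫_ℝ : ℝ))) := by
      rw [translationSymbol, Real.fourierChar_apply, mul_comm Complex.I]
    rw [norm_sub_rev, h1]
    refine Real.norm_exp_I_mul_ofReal_sub_one_le.trans ?_
    rw [norm_mul, norm_neg, Real.norm_of_nonneg (by positivity), mul_assoc (2 * Real.pi)]
    gcongr
    exact norm_inner_le_norm h ξ

/-- Near the origin the Lipschitz bound on the exponential leaves `|h|^{2-n-2s}`, integrable because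
`s < 1`. Away from it the bound `4 |h|^{-n-2s}` is integrable because `s > 0`. -/
theorem gagSymbol_lt_top (hn : 1 ≤ n) {s : ℝ≥0} (hs₀ : 0 < s) (hs₁ : s < 1) {ξ : E n}
    (hξ : ‖ξ‖ = 1) : gagSymbol n s ξ < ⊤ := by
  have hs0 : (0 : ℝ) < s := by exact_mod_cast hs₀
  have hs1 : (s : ℝ) < 1 := by exact_mod_cast hs₁
  have : Nontrivial (E n) := by
    have : Nonempty (Fin n) := ⟨⟨0, hn⟩⟩
    infer_instance
  set f : ℝ → ℝ := fun y => if y < 1 then (2 * Real.pi) ^ 2 * (y ^ 2 * (y ^ ((n : ℝ) + 2 * s))⁻¹)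
    else 4 * (y ^ ((n : ℝ) + 2 * s))⁻¹ with hf
  have hn1 : ((n - 1 : ℕ) : ℝ) = (n : ℝ) - 1 := by rw [Nat.cast_sub hn, Nat.cast_one]
  have hint : Integrable (fun h : E n => f ‖h‖) volume := by
    rw [integrable_fun_norm_addHaar, finrank_euclideanSpace_fin, ← Ioo_union_Ici_eq_Ioi one_pos,
      integrableOn_union]
    constructor
    · have h1 : IntegrableOn (fun y : ℝ => (2 * Real.pi) ^ 2 * y ^ (1 - 2 * (s : ℝ))) (Ioo 0 1) :=
        Integrable.const_mul ((intervalIntegral.integrableOn_Ioo_rpow_iff one_pos).2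
          (by linarith)) _
      refine h1.congr_fun (fun y hy => ?_) measurableSet_Ioo
      simp only [hf, if_pos hy.2, smul_eq_mul]
      have e : y ^ (1 - 2 * (s : ℝ)) = y ^ (n - 1) * (y ^ 2 * (y ^ ((n : ℝ) + 2 * s))⁻¹) := by
        rw [← Real.rpow_natCast, ← Real.rpow_natCast, ← Real.rpow_neg hy.1.le,
          ← Real.rpow_add hy.1, ← Real.rpow_add hy.1, hn1]
        congr 1
        push_cast
        ring
      rw [e]
      ring
    · rw [integrableOn_Ici_iff_integrableOn_Ioi]
      have h1 : IntegrableOn (fun y : ℝ => 4 * y ^ (-1 - 2 * (s : ℝ))) (Ioi 1) :=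
        Integrable.const_mul (integrableOn_Ioi_rpow_of_lt (by linarith) one_pos) _
      refine h1.congr_fun (fun y hy => ?_) measurableSet_Ioi
      have hy0 : (0 : ℝ) < y := one_pos.trans hy
      simp only [hf, if_neg (not_lt.2 (mem_Ioi.1 hy).le), smul_eq_mul]
      have e : y ^ (-1 - 2 * (s : ℝ)) = y ^ (n - 1) * (y ^ ((n : ℝ) + 2 * s))⁻¹ := by
        rw [← Real.rpow_natCast, ← Real.rpow_neg hy0.le, ← Real.rpow_add hy0, hn1]
        congr 1
        ring
      rw [e]
      ring
  refine lt_of_le_of_lt (lintegral_mono fun h => ?_) hint.lintegral_lt_top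
  rw [enorm_gagWeight_sq, ← ofReal_norm, ← ENNReal.ofReal_pow (norm_nonneg _),
    ← ENNReal.ofReal_mul (by positivity)]
  refine ENNReal.ofReal_le_ofReal ?_
  obtain ⟨b1, b2⟩ := norm_one_sub_translationSymbol_le h ξ
  rw [hξ, mul_one] at b2
  have hw : 0 ≤ (‖h‖ ^ ((n : ℝ) + 2 * s))⁻¹ := by positivity
  simp only [hf]
  split_ifs with hlt
  · rw [← mul_assoc]
    refine mul_le_mul_of_nonneg_right ?_ hw
    rw [← mul_pow]
    exact pow_le_pow_left₀ (norm_nonneg _) b2 2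
  · refine mul_le_mul_of_nonneg_right ?_ hw
    calc ‖1 - translationSymbol h ξ‖ ^ 2 ≤ 2 ^ 2 := pow_le_pow_left₀ (norm_nonneg _) b1 2
      _ = 4 := by norm_num

theorem gagSymbol_pos (s : ℝ≥0) {ξ : E n} (hξ : ‖ξ‖ = 1) : 0 < gagSymbol n s ξ := by
  have hc : Continuous fun h : E n => translationSymbol h ξ :=
    continuous_translationSymbol.comp (f := fun h : E n => (h, ξ)) (by fun_prop)
  have h1 : Measurable fun h : E n => ‖1 - translationSymbol h ξ‖ₑ :=
    (continuous_const.sub hc).enorm.measurable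
  have h2 : Measurable fun h : E n => ‖gagWeight n s h‖ₑ := (measurable_gagWeight s).enorm
  have hm : Measurable fun h : E n => ‖1 - translationSymbol h ξ‖ₑ ^ 2 * ‖gagWeight n s h‖ₑ ^ 2 :=
    (h1.pow_const 2).mul (h2.pow_const 2)
  rw [gagSymbol, lintegral_pos_iff_support hm]
  have hU : IsOpen {h : E n | translationSymbol h ξ ≠ 1 ∧ h ≠ 0} :=
    (isOpen_ne_fun hc continuous_const).inter isOpen_ne
  have hne : ({h : E n | translationSymbol h ξ ≠ 1 ∧ h ≠ 0}).Nonempty := by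
    -- At `h = ξ/2` the phase is `e^{-πi} = -1`, so the integrand is nonzero there and, by
    -- continuity, on a nonempty open set.
    refine ⟨(1 / 2 : ℝ) • ξ, ?_, ?_⟩
    · rw [translationSymbol, Real.fourierChar_apply, inner_smul_left, real_inner_self_eq_norm_sq, hξ]
      have e : ((2 * Real.pi * -((starRingEnd ℝ) (1 / 2 : ℝ) * 1 ^ 2) : ℝ) : ℂ) * Complex.I =
          -(Real.pi * Complex.I) := by
        simp
        ring
      rw [e, Complex.exp_neg, Complex.exp_pi_mul_I]
      norm_num
    · intro h0
      have := congrArg norm h0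
      rw [norm_smul, hξ] at this
      norm_num at this
  refine (hU.measure_pos volume hne).trans_le (measure_mono fun h hh => ?_)
  simp only [Function.mem_support, ne_eq, mul_eq_zero, pow_eq_zero_iff two_ne_zero, enorm_eq_zero,
    not_or]
  refine ⟨fun h0 => hh.1 (sub_eq_zero.1 h0).symm, ?_⟩
  rw [gagWeight]
  exact inv_ne_zero (Real.rpow_pos_of_pos (norm_pos_iff.2 hh.2) _).ne'

/-- `∫ |1 - e^{-2πi h·ξ}|² |h|^{-(n+2s)} dh = κ |ξ|^{2s}`. -/
theorem exists_gagSymbol_eq (hn : 1 ≤ n) {s : ℝ≥0} (hs₀ : 0 < s) (hs₁ : s < 1) :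
    ∃ κ : ℝ, 0 < κ ∧ ∀ ξ : E n, gagSymbol n s ξ = ENNReal.ofReal (κ * ‖ξ‖ ^ (2 * (s : ℝ))) := by
  let e : E n := EuclideanSpace.single ⟨0, hn⟩ 1
  have he : ‖e‖ = 1 := by simp [e]
  have h1 := gagSymbol_lt_top hn hs₀ hs₁ he
  refine ⟨(gagSymbol n s e).toReal, ENNReal.toReal_pos (gagSymbol_pos s he).ne' h1.ne, fun ξ => ?_⟩
  have hs0 : (0 : ℝ) < s := by exact_mod_cast hs₀
  rcases eq_or_ne ξ 0 with rfl | hξ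
  · rw [norm_zero, Real.zero_rpow (by positivity), mul_zero, ENNReal.ofReal_zero, gagSymbol]
    simp [translationSymbol]
  · have hξ0 : 0 < ‖ξ‖ := norm_pos_iff.2 hξ
    rw [gagSymbol_eq_of_norm_eq s (w := ‖ξ‖ • e) (by rw [norm_smul, he, norm_norm, mul_one]),
      gagSymbol_smul s e hξ0, ENNReal.ofReal_mul ENNReal.toReal_nonneg, ENNReal.ofReal_toReal h1.ne,
      mul_comm]

end GagliardoConstant

/-! ### The Hilbert space `H^s(ℝⁿ)` and the Gagliardo embedding -/

section SobolevHilbert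

open scoped InnerProductSpace

variable {n : ℕ} {s : ℝ≥0}

/-- The real part of the `L²(ℝⁿ; ℂ)` inner product pulled back by `Hs.bessel`, so that the norm
already chosen is kept. -/
instance : InnerProductSpace ℝ (Hs n s) :=
  { (inferInstance : NormedSpace ℝ (Hs n s)) with
    inner := fun v w => (inner ℂ (Hs.bessel n s v) (Hs.bessel n s w) : ℂ).re
    norm_sq_eq_re_inner := fun v => by
      rw [Hs.norm_def]
      exact norm_sq_eq_re_inner (𝕜 := ℂ) (Hs.bessel n s v)
    conj_inner_symm := fun v w => by
      rw [conj_trivial]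
      exact inner_re_symm (𝕜 := ℂ) _ _
    add_left := fun u v w => by rw [map_add, inner_add_left, Complex.add_re]
    smul_left := fun v w r => by
      have h : r • Hs.bessel n s v = (r : ℂ) • Hs.bessel n s v := by
        refine Lp.ext ?_
        filter_upwards [Lp.coeFn_smul r (Hs.bessel n s v),
          Lp.coeFn_smul (r : ℂ) (Hs.bessel n s v)] with x a b
        rw [a, b, Pi.smul_apply, Pi.smul_apply, Complex.coe_smul]
      rw [map_smul, conj_trivial, h, inner_smul_left, Complex.conj_ofReal,
        Complex.re_ofReal_mul] }

theorem norm_fourierL2 (v : Lp ℝ 2 (volume : Measure (E n))) : ‖fourierL2 n v‖ = ‖v‖ := by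
  have h1 : ‖fourierL2 n v‖ = ‖(Complex.ofRealCLM.compLp v : Lp ℂ 2 (volume : Measure (E n)))‖ :=
    (Lp.fourierTransformₗᵢ (E n) ℂ).norm_map _
  rw [h1]
  refine le_antisymm (Lp.norm_le_norm_of_ae_le ?_) (Lp.norm_le_norm_of_ae_le ?_) <;>
  · filter_upwards [coeFn_ofReal v] with x hx
    rw [hx, Complex.norm_real]

/-- The inclusion `H^s(ℝⁿ) ⊆ L²(ℝⁿ)` as a continuous linear map. -/
def Hs.inclL (n : ℕ) (s : ℝ≥0) : Hs n s →L[ℝ] Lp ℝ 2 (volume : Measure (E n)) :=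
  (Hs.incl n s).mkContinuous 1 fun v => by
    rw [one_mul]
    exact Hs.norm_incl_le_bessel n s v

theorem Hs.coeFn_bessel (v : Hs n s) :
    Hs.bessel n s v =ᵐ[volume] fun ξ =>
      ((1 + ‖ξ‖ ^ 2) ^ ((s : ℝ) / 2) : ℝ) • fourierL2 n (Hs.incl n s v) ξ :=
  MemLp.coeFn_toLp (Hs.memLp n s v)

/-- A Cauchy sequence has an `L²` limit `v`, and its weighted transforms have an `L²` limit `g`.
Division by the weight is bounded on `L²`, which identifies `𝓕 v` with `g` over the weight; so `v`
lies in the space and is the limit. -/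
instance : CompleteSpace (Hs n s) := by
  refine Metric.complete_of_cauchySeq_tendsto fun u hu => ?_
  have hiso : Isometry (Hs.bessel n s) :=
    AddMonoidHomClass.isometry_of_norm (Hs.bessel n s) fun v => rfl
  obtain ⟨g, hg⟩ := cauchySeq_tendsto_of_complete (hiso.uniformContinuous.comp_cauchySeq hu)
  obtain ⟨v, hv⟩ := cauchySeq_tendsto_of_complete
    ((Hs.inclL n s).uniformContinuous.comp_cauchySeq hu)
  have hpos : ∀ ξ : E n, 0 < (1 + ‖ξ‖ ^ 2) ^ ((s : ℝ) / 2) := fun ξ => by positivity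
  have hmem : MemLp (fun ξ : E n => (((1 + ‖ξ‖ ^ 2) ^ ((s : ℝ) / 2))⁻¹ : ℝ)) ∞ volume := by
    refine memLp_top_of_bound (Measurable.aestronglyMeasurable (by fun_prop)) 1 (Eventually.of_forall fun ξ => ?_)
    rw [norm_inv, Real.norm_of_nonneg (hpos ξ).le]
    exact inv_le_one_of_one_le₀
      (Real.one_le_rpow (by nlinarith [sq_nonneg ‖ξ‖]) (by positivity))
  let M := (ContinuousLinearMap.lsmul ℝ ℝ : ℝ →L[ℝ] ℂ →L[ℝ] ℂ).holderL
    (volume : Measure (E n)) ∞ 2 2 (hmem.toLp _)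
  have hM : ∀ G : Lp ℂ 2 (volume : Measure (E n)),
      M G =ᵐ[volume] fun ξ => ((1 + ‖ξ‖ ^ 2) ^ ((s : ℝ) / 2))⁻¹ • G ξ := by
    intro G
    refine ((ContinuousLinearMap.lsmul ℝ ℝ : ℝ →L[ℝ] ℂ →L[ℝ] ℂ).coeFn_holder _ G).trans ?_
    filter_upwards [hmem.coeFn_toLp] with ξ hξ
    rw [hξ]
    rfl
  have hMb : ∀ w : Hs n s, M (Hs.bessel n s w) = fourierL2 n (Hs.incl n s w) := by
    intro w
    refine Lp.ext ?_
    filter_upwards [hM (Hs.bessel n s w), Hs.coeFn_bessel w] with ξ a b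
    rw [a, b, inv_smul_smul₀ (hpos ξ).ne']
  have hF : Continuous (fourierL2 n) :=
    AddMonoidHomClass.continuous_of_bound (fourierL2 n) 1 fun v => by
      rw [one_mul, norm_fourierL2]
  have hMg : M g = fourierL2 n v := by
    refine tendsto_nhds_unique ((M.continuous.tendsto g).comp hg) ?_
    exact ((hF.tendsto v).comp hv).congr fun k => (hMb (u k)).symm
  have hvg : weightedFourier n s v =ᵐ[volume] g := by
    filter_upwards [hM g] with ξ a
    rw [weightedFourier, ← hMg, a, smul_inv_smul₀ (hpos ξ).ne']
  let v' : Hs n s := ⟨v, (memLp_congr_ae hvg).2 (Lp.memLp g)⟩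
  have hv' : Hs.bessel n s v' = g := by
    refine Lp.ext ?_
    exact (Hs.coeFn_bessel v').trans hvg
  refine ⟨v', hiso.isUniformInducing.isInducing.tendsto_nhds_iff.2 ?_⟩
  rw [hv']
  exact hg

instance {Ω : Set (E n)} : CompleteSpace (Htilde s Ω) :=
  (Submodule.isClosed_topologicalClosure _).completeSpace_coe

/-- Restriction to `Ωᶜ` is continuous and annihilates test functions, hence also their closure. -/
theorem Htilde.ae_eq_zero {Ω : Set (E n)} (hΩ : MeasurableSet Ω) (v : Htilde s Ω) :
    ∀ᵐ x ∂(volume.restrict Ωᶜ), v.toFun x = 0 := by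
  let R := (LpToLpRestrictCLM (E n) ℝ ℝ (volume : Measure (E n)) 2 Ωᶜ).comp (Hs.inclL n s)
  have hR : ∀ w : Hs n s, R w =ᵐ[volume.restrict Ωᶜ] Hs.incl n s w := fun w =>
    LpToLpRestrictCLM_coeFn ℝ Ωᶜ (Hs.incl n s w)
  have hle : (testFunctions s Ω).topologicalClosure ≤ LinearMap.ker R.toLinearMap := by
    refine Submodule.topologicalClosure_minimal _ ?_ R.isClosed_ker
    rintro w ⟨g, -, -, hgΩ, hwg⟩
    rw [LinearMap.mem_ker]
    refine Lp.ext ?_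
    filter_upwards [hR w, ae_restrict_of_ae hwg, ae_restrict_mem hΩ.compl,
      Lp.coeFn_zero ℝ 2 (volume.restrict Ωᶜ)] with x a b c d
    refine a.trans ?_
    rw [b, d, Pi.zero_apply]
    exact image_eq_zero_of_notMem_tsupport fun h => c (hgΩ h)
  have h0 : R (v : Hs n s) = 0 := hle v.2
  filter_upwards [hR v, Lp.coeFn_zero ℝ 2 (volume.restrict Ωᶜ)] with x a b
  rw [h0, b] at a
  exact a.symm

/-- `(v(x) - v(y)) |x - y|^{-(n/2+s)}`. -/
def gagQuotient (s : ℝ≥0) (v : E n → ℝ) (q : E n × E n) : ℝ :=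
  (v q.1 - v q.2) * gagWeight n s (q.1 - q.2)

theorem gagQuotient_mul (v w : E n → ℝ) (q : E n × E n) :
    gagQuotient s v q * gagQuotient s w q =
      (v q.1 - v q.2) * (w q.1 - w q.2) / ‖q.1 - q.2‖ ^ ((n : ℝ) + 2 * (s : ℝ)) := by
  rw [gagQuotient, gagQuotient, div_eq_mul_inv, ← gagWeight_sq]
  ring

theorem enorm_gagQuotient_sq (v : E n → ℝ) (q : E n × E n) :
    ‖gagQuotient s v q‖ₑ ^ 2 = ‖v q.1 - v q.2‖ₑ ^ 2 * ‖gagWeight n s (q.1 - q.2)‖ₑ ^ 2 := by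
  rw [gagQuotient, enorm_mul, mul_pow]

theorem measurable_gagQuotient {v : E n → ℝ} (hv : Measurable v) :
    Measurable (gagQuotient s v) :=
  ((hv.comp measurable_fst).sub (hv.comp measurable_snd)).mul
    ((measurable_gagWeight s).comp (measurable_fst.sub measurable_snd))

theorem lintegral_gagQuotient (v : Lp ℝ 2 (volume : Measure (E n))) :
    ∫⁻ q, ‖gagQuotient s v q‖ₑ ^ 2 = ∫⁻ ξ, gagSymbol n s ξ * ‖fourierL2 n v ξ‖ₑ ^ 2 := by
  simp only [enorm_gagQuotient_sq]
  exact lintegral_gagliardo v (R := fun h => ‖gagWeight n s h‖ₑ ^ 2)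
    ((measurable_gagWeight s).enorm.pow_const 2)

theorem enorm_bessel_sq (v : Hs n s) : ‖Hs.bessel n s v‖ₑ ^ 2 =
    ∫⁻ ξ, ENNReal.ofReal ((1 + ‖ξ‖ ^ 2) ^ (s : ℝ)) * ‖fourierL2 n (Hs.incl n s v) ξ‖ₑ ^ 2 := by
  rw [enorm_sq_Lp]
  refine lintegral_congr_ae ?_
  filter_upwards [Hs.coeFn_bessel v] with ξ h
  rw [h, enorm_smul, mul_pow, Real.enorm_of_nonneg (by positivity),
    ← ENNReal.ofReal_pow (by positivity), ← Real.rpow_natCast, ← Real.rpow_mul (by positivity)]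
  norm_num

theorem lintegral_gagQuotient_le {κ : ℝ} (hκ : 0 < κ)
    (hsym : ∀ ξ : E n, gagSymbol n s ξ = ENNReal.ofReal (κ * ‖ξ‖ ^ (2 * (s : ℝ)))) (v : Hs n s) :
    ∫⁻ q, ‖gagQuotient s (Hs.incl n s v) q‖ₑ ^ 2 ≤ ENNReal.ofReal κ * ‖Hs.bessel n s v‖ₑ ^ 2 := by
  rw [lintegral_gagQuotient, enorm_bessel_sq, ← lintegral_const_mul' _ _ ENNReal.ofReal_ne_top]
  refine lintegral_mono fun ξ => ?_
  rw [hsym, ENNReal.ofReal_mul hκ.le, mul_assoc, Real.rpow_mul (norm_nonneg _), Real.rpow_two]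
  gcongr
  linarith

/-- On the Fourier side this is subadditivity of `x ↦ x^s`: `(1 + |ξ|²)^s ≤ 1 + |ξ|^{2s}`. -/
theorem enorm_bessel_sq_le (hs₁ : s < 1) {κ : ℝ} (hκ : 0 < κ)
    (hsym : ∀ ξ : E n, gagSymbol n s ξ = ENNReal.ofReal (κ * ‖ξ‖ ^ (2 * (s : ℝ)))) (v : Hs n s) :
    ‖Hs.bessel n s v‖ₑ ^ 2 ≤ ‖Hs.incl n s v‖ₑ ^ 2 +
      ENNReal.ofReal κ⁻¹ * ∫⁻ q, ‖gagQuotient s (Hs.incl n s v) q‖ₑ ^ 2 := by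
  have h1 : ‖Hs.incl n s v‖ₑ ^ 2 = ∫⁻ ξ, ‖fourierL2 n (Hs.incl n s v) ξ‖ₑ ^ 2 := by
    rw [← enorm_sq_Lp, ← ofReal_norm, ← ofReal_norm, norm_fourierL2]
  have hm : Measurable (fourierL2 n (Hs.incl n s v)) := (Lp.stronglyMeasurable _).measurable
  rw [h1, lintegral_gagQuotient, enorm_bessel_sq, ← lintegral_const_mul' _ _ ENNReal.ofReal_ne_top,
    ← lintegral_add_left (hm.enorm.pow_const 2)]
  refine lintegral_mono fun ξ => ?_
  rw [hsym, ← mul_assoc, ← ENNReal.ofReal_mul (inv_pos.2 hκ).le, inv_mul_cancel_left₀ hκ.ne',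
    ← one_add_mul, Real.rpow_mul (norm_nonneg _), Real.rpow_two, ← ENNReal.ofReal_one,
    ← ENNReal.ofReal_add zero_le_one (by positivity)]
  gcongr
  have h2 : (s : ℝ) ≤ 1 := by exact_mod_cast hs₁.le
  have h3 := Real.rpow_add_le_add_rpow (a := 1) (b := ‖ξ‖ ^ 2) zero_le_one (by positivity)
    (NNReal.coe_nonneg s) h2
  rwa [Real.one_rpow] at h3

/-- The fractional Poincaré inequality on a bounded set. -/
theorem exists_poincare (hn : 1 ≤ n) {Ω : Set (E n)} (hΩ : MeasurableSet Ω)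
    (hΩb : Bornology.IsBounded Ω) : ∃ c : ℝ, 0 < c ∧ ∀ v : Htilde s Ω,
      ‖Hs.incl n s v‖ₑ ^ 2 ≤
        ENNReal.ofReal c * ∫⁻ q, ‖gagQuotient s (Hs.incl n s v) q‖ₑ ^ 2 := by
  obtain ⟨R, hR0, hR⟩ := hΩb.exists_pos_norm_le
  -- A unit ball centred at distance `R + 1` misses the ball of radius `R` containing `Ω`, and its
  -- points are within `2R + 2` of all points of `Ω`.
  let p : E n := EuclideanSpace.single ⟨0, hn⟩ (R + 1)
  have hp : ‖p‖ = R + 1 := by simp [p, abs_of_pos (by linarith : (0 : ℝ) < R + 1)]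
  set B : Set (E n) := Metric.ball p 1 with hB
  have hBΩ : B ⊆ Ωᶜ := by
    intro y hy hyΩ
    have h1 := hR y hyΩ
    rw [hB, mem_ball_iff_norm, norm_sub_rev] at hy
    have h2 := norm_sub_norm_le p y
    linarith
  have hy : ∀ y ∈ B, ∀ x ∈ Ω, ‖x - y‖ ≤ 2 * R + 2 := by
    intro y hy x hx
    rw [hB, mem_ball_iff_norm] at hy
    have h1 : ‖x - y‖ ≤ ‖x‖ + ‖y‖ := norm_sub_le _ _
    have h2 : ‖y‖ ≤ ‖y - p‖ + ‖p‖ := by simpa using norm_add_le (y - p) p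
    linarith [hR x hx]
  have hBpos : 0 < volume B := Metric.measure_ball_pos _ _ one_pos
  have hBtop : volume B ≠ ⊤ := measure_ball_lt_top.ne
  set ρ : ℝ := ((2 * R + 2) ^ ((n : ℝ) + 2 * s))⁻¹ with hρ
  have hρ0 : 0 < ρ := by positivity
  set b : ℝ := (volume B).toReal
  have hb0 : 0 < b := ENNReal.toReal_pos hBpos.ne' hBtop
  refine ⟨(ρ * b)⁻¹, by positivity, fun v => ?_⟩
  set f : Lp ℝ 2 (volume : Measure (E n)) := Hs.incl n s v with hf
  have hfm : Measurable f := (Lp.stronglyMeasurable f).measurable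
  have hf0 : ∀ᵐ x ∂(volume.restrict Ωᶜ), f x = 0 := Htilde.ae_eq_zero hΩ v
  have hfB : ∀ᵐ y ∂(volume.restrict B), f y = 0 := ae_restrict_of_ae_restrict_of_subset hBΩ hf0
  have hfn : ‖f‖ₑ ^ 2 = ∫⁻ x in Ω, ‖f x‖ₑ ^ 2 := by
    rw [enorm_sq_Lp, ← lintegral_add_compl _ hΩ]
    have : ∫⁻ x in Ωᶜ, ‖f x‖ₑ ^ 2 = 0 := by
      rw [lintegral_congr_ae (g := fun _ => 0) (by
        filter_upwards [hf0] with x hx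
        simp [hx])]
      simp
    rw [this, add_zero]
  -- Only the pairs with `x ∈ Ω`, `y ∈ B` are kept. There `f y = 0`, so the difference is `f x`, and
  -- the squared weight is at least `ρ`.
  have key : ENNReal.ofReal (ρ * b) * ‖f‖ₑ ^ 2 ≤ ∫⁻ q, ‖gagQuotient s f q‖ₑ ^ 2 := by
    calc ENNReal.ofReal (ρ * b) * ‖f‖ₑ ^ 2
        = ∫⁻ y in B, ENNReal.ofReal ρ * ‖f‖ₑ ^ 2 := by
          rw [setLIntegral_const, ENNReal.ofReal_mul hρ0.le, ENNReal.ofReal_toReal hBtop]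
          ring
      _ ≤ ∫⁻ y in B, ∫⁻ x, ‖gagQuotient s f (x, y)‖ₑ ^ 2 := by
          refine lintegral_mono_ae ?_
          filter_upwards [hfB, ae_restrict_mem measurableSet_ball] with y hy0 hyB
          rw [hfn, ← lintegral_const_mul' _ _ ENNReal.ofReal_ne_top]
          refine le_trans ?_ (setLIntegral_le_lintegral Ω _)
          refine setLIntegral_mono' hΩ fun x hx => ?_
          rw [enorm_gagQuotient_sq, enorm_gagWeight_sq, hy0, sub_zero, mul_comm]
          gcongr ‖f x‖ₑ ^ 2 * ENNReal.ofReal ?_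
          have hxy : 0 < ‖x - y‖ := norm_pos_iff.2 (sub_ne_zero.2 fun h => hBΩ hyB (h ▸ hx))
          exact inv_anti₀ (Real.rpow_pos_of_pos hxy _)
            (Real.rpow_le_rpow hxy.le (hy y hyB x hx) (by positivity))
      _ ≤ ∫⁻ y, ∫⁻ x, ‖gagQuotient s f (x, y)‖ₑ ^ 2 := setLIntegral_le_lintegral B _
      _ = ∫⁻ q, ‖gagQuotient s f q‖ₑ ^ 2 := by
          rw [Measure.volume_eq_prod, lintegral_prod_symm _
            (((measurable_gagQuotient hfm).enorm.pow_const 2).aemeasurable)]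
  have h0 : 0 < ρ * b := by positivity
  calc ‖f‖ₑ ^ 2 = ENNReal.ofReal (ρ * b)⁻¹ * (ENNReal.ofReal (ρ * b) * ‖f‖ₑ ^ 2) := by
        rw [← mul_assoc, ← ENNReal.ofReal_mul (by positivity), inv_mul_cancel₀ h0.ne',
          ENNReal.ofReal_one, one_mul]
    _ ≤ _ := by gcongr

end SobolevHilbert

/-! ### The operator factorizing the bilinear form -/

section GagliardoOperator

open scoped InnerProductSpace

variable {n : ℕ} {s : ℝ≥0}

theorem memLp_gagQuotient {κ : ℝ} (hκ : 0 < κ)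
    (hsym : ∀ ξ : E n, gagSymbol n s ξ = ENNReal.ofReal (κ * ‖ξ‖ ^ (2 * (s : ℝ)))) (v : Hs n s) :
    MemLp (gagQuotient s (Hs.incl n s v)) 2 (volume : Measure (E n × E n)) := by
  refine ⟨(measurable_gagQuotient (Lp.stronglyMeasurable _).measurable).aestronglyMeasurable, ?_⟩
  have h := lintegral_gagQuotient_le hκ hsym v
  rw [← eLpNorm_two_sq] at h
  have h2 : eLpNorm (gagQuotient s (Hs.incl n s v)) 2 volume ^ 2 < ⊤ :=
    h.trans_lt (ENNReal.mul_lt_top ENNReal.ofReal_lt_top (ENNReal.pow_lt_top enorm_lt_top))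
  exact (ENNReal.pow_lt_top_iff.1 h2).resolve_right two_ne_zero

theorem fracConst_pos (hn : 1 ≤ n) (hs₀ : 0 < s) (hs₁ : s < 1) : 0 < fracConst n s := by
  have hs0 : (0 : ℝ) < s := by exact_mod_cast hs₀
  have hs1 : (s : ℝ) < 1 := by exact_mod_cast hs₁
  have h1 : 0 < Real.Gamma (s + n / 2) := Real.Gamma_pos_of_pos (by positivity)
  have h2 : 0 < Real.Gamma (1 - s) := Real.Gamma_pos_of_pos (by linarith)
  have := Real.pi_pos
  unfold fracConst
  positivity

/-- The bilinear form of the fractional Laplacian on `H̃^s(Ω)` is of the form `⟪G v, G w⟫` with a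
bounded operator `G` that is bounded from below. -/
theorem exists_gagliardo_operator (hn : 1 ≤ n) {Ω : Set (E n)} (hΩ : MeasurableSet Ω)
    (hΩb : Bornology.IsBounded Ω) (hs₀ : 0 < s) (hs₁ : s < 1) :
    ∃ (G : Htilde s Ω →L[ℝ] Lp ℝ 2 (volume : Measure (E n × E n))) (c : ℝ), 0 < c ∧
      (∀ v, c * ‖v‖ ≤ ‖G v‖) ∧ ∀ v w, bilin v w = ⟪G v, G w⟫_ℝ := by
  obtain ⟨κ, hκ, hsym⟩ := exists_gagSymbol_eq hn hs₀ hs₁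
  obtain ⟨cP, hcP, hP⟩ := exists_poincare (s := s) hn hΩ hΩb
  have hmem := memLp_gagQuotient hκ hsym
  have hfst : ∀ {p : E n → Prop}, (∀ᵐ x, p x) → ∀ᵐ q : E n × E n, p q.1 := fun h =>
    Measure.quasiMeasurePreserving_fst.ae h
  have hsnd : ∀ {p : E n → Prop}, (∀ᵐ x, p x) → ∀ᵐ q : E n × E n, p q.2 := fun h =>
    Measure.quasiMeasurePreserving_snd.ae h
  have hnorm : ∀ v : Hs n s, ‖(hmem v).toLp _‖ₑ ^ 2 =
      ∫⁻ q, ‖gagQuotient s (Hs.incl n s v) q‖ₑ ^ 2 := fun v => by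
    rw [Lp.enorm_toLp, eLpNorm_two_sq]
  let G₀ : Hs n s →ₗ[ℝ] Lp ℝ 2 (volume : Measure (E n × E n)) :=
    { toFun := fun v => (hmem v).toLp _
      map_add' := fun v w => by
        rw [← MemLp.toLp_add]
        refine MemLp.toLp_congr _ _ ?_
        have h := Lp.coeFn_add (Hs.incl n s v) (Hs.incl n s w)
        rw [← map_add] at h
        filter_upwards [hfst h, hsnd h] with q a b
        simp only [gagQuotient, Pi.add_apply, a, b]
        ring
      map_smul' := fun r v => by
        rw [RingHom.id_apply, ← MemLp.toLp_const_smul]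
        refine MemLp.toLp_congr _ _ ?_
        have h := Lp.coeFn_smul r (Hs.incl n s v)
        rw [← map_smul] at h
        filter_upwards [hfst h, hsnd h] with q a b
        simp only [gagQuotient, Pi.smul_apply, a, b, smul_eq_mul]
        ring }
  have hG₀ : ∀ v : Hs n s, ‖G₀ v‖ₑ ^ 2 = ∫⁻ q, ‖gagQuotient s (Hs.incl n s v) q‖ₑ ^ 2 := hnorm
  have toReal_sq : ∀ {X Y : Type} [NormedAddCommGroup X] [NormedAddCommGroup Y] (x : X) (y : Y)
      (r : ℝ), 0 ≤ r → ‖x‖ₑ ^ 2 ≤ ENNReal.ofReal r * ‖y‖ₑ ^ 2 → ‖x‖ ^ 2 ≤ r * ‖y‖ ^ 2 := by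
    intro X Y _ _ x y r hr h
    rw [← ofReal_norm, ← ofReal_norm, ← ENNReal.ofReal_pow (norm_nonneg _),
      ← ENNReal.ofReal_pow (norm_nonneg _), ← ENNReal.ofReal_mul hr] at h
    exact (ENNReal.ofReal_le_ofReal_iff (by positivity)).1 h
  have hbd : ∀ v : Hs n s, ‖G₀ v‖ ≤ √κ * ‖v‖ := by
    intro v
    have h := toReal_sq (G₀ v) (Hs.bessel n s v) κ hκ.le
      (by rw [hG₀]; exact lintegral_gagQuotient_le hκ hsym v)
    rw [← Hs.norm_def] at h
    refine (pow_le_pow_iff_left₀ (norm_nonneg _) (by positivity) two_ne_zero).1 ?_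
    rwa [mul_pow, Real.sq_sqrt hκ.le]
  -- The `L²` part of the norm is absorbed by Poincaré (`cP`), the remaining part by the Fourier
  -- symbol (`κ⁻¹`).
  have hlow : ∀ v : Htilde s Ω, ‖v‖ ^ 2 ≤ (cP + κ⁻¹) * ‖G₀ v‖ ^ 2 := by
    intro v
    have h := toReal_sq (Hs.bessel n s (v : Hs n s)) (G₀ v) (cP + κ⁻¹) (by positivity) (by
      rw [hG₀, ENNReal.ofReal_add hcP.le (by positivity), add_mul]
      exact (enorm_bessel_sq_le hs₁ hκ hsym (v : Hs n s)).trans (by gcongr; exact hP v))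
    exact h
  -- Scaling by the square root puts the prefactor of the form into `G`.
  set r : ℝ := √(fracConst n s / 2) with hr
  have hfc := fracConst_pos hn hs₀ hs₁
  have hr0 : 0 < r := Real.sqrt_pos.2 (by positivity)
  have hr2 : r * r = fracConst n s / 2 := Real.mul_self_sqrt (by positivity)
  let G : Htilde s Ω →L[ℝ] Lp ℝ 2 (volume : Measure (E n × E n)) :=
    r • ((G₀.mkContinuous √κ hbd).comp (testFunctions s Ω).topologicalClosure.subtypeL)
  have hG : ∀ v : Htilde s Ω, G v = r • G₀ v := fun v => rfl
  refine ⟨G, r / √(cP + κ⁻¹), by positivity, fun v => ?_, fun v w => ?_⟩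
  · rw [hG, norm_smul, Real.norm_of_nonneg hr0.le, div_mul_eq_mul_div, mul_div_assoc]
    refine mul_le_mul_of_nonneg_left ?_ hr0.le
    rw [div_le_iff₀ (by positivity)]
    refine (pow_le_pow_iff_left₀ (norm_nonneg _) (by positivity) two_ne_zero).1 ?_
    rw [mul_pow, Real.sq_sqrt (by positivity), mul_comm]
    exact hlow v
  · rw [hG, hG, real_inner_smul_left, real_inner_smul_right, ← mul_assoc, hr2, bilin, L2.inner_def]
    congr 1
    refine integral_congr_ae ?_
    filter_upwards [(hmem (v : Hs n s)).coeFn_toLp, (hmem (w : Hs n s)).coeFn_toLp] with q a b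
    have a' : (G₀ v) q = gagQuotient s (Hs.incl n s (v : Hs n s)) q := a
    have b' : (G₀ w) q = gagQuotient s (Hs.incl n s (w : Hs n s)) q := b
    rw [a', b', real_inner_comm]
    exact (gagQuotient_mul _ _ q).symm

end GagliardoOperator

/-! ### Weak formulations on `L²(0, T; H̃^s(Ω))` -/

section Lifting

open scoped InnerProductSpace

variable {T : ℝ} {X Y : Type} [NormedAddCommGroup X] [InnerProductSpace ℝ X]
  [NormedAddCommGroup Y] [InnerProductSpace ℝ Y]

/-- The operator on `L²(0, T; X)` given by pointwise application of an operator on `X`. -/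
def lift (T : ℝ) (A : X →L[ℝ] Y) : L2T T X →L[ℝ] L2T T Y :=
  A.compLpL 2 (volume.restrict (Ioo 0 T))

theorem coeFn_lift (A : X →L[ℝ] Y) (f : L2T T X) :
    lift T A f =ᵐ[volume.restrict (Ioo 0 T)] fun t => A (f t) :=
  A.coeFn_compLp f

theorem lift_primL [CompleteSpace X] [CompleteSpace Y] (A : X →L[ℝ] Y) (f : L2T T X) :
    lift T A (primL T X f) = primL T Y (lift T A f) :=
  compLp_primL A f

theorem lift_primR [CompleteSpace X] [CompleteSpace Y] (A : X →L[ℝ] Y) (f : L2T T X) :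
    lift T A (primR T X f) = primR T Y (lift T A f) :=
  compLp_primR A f

theorem inner_lift (A B : X →L[ℝ] Y) (f g : L2T T X) :
    ⟪lift T A f, lift T B g⟫_ℝ = ∫ t in Ioo 0 T, ⟪A (f t), B (g t)⟫_ℝ := by
  rw [L2.inner_def]
  refine integral_congr_ae ?_
  filter_upwards [coeFn_lift A f, coeFn_lift B g] with t a b
  rw [a, b]

theorem inner_lift_right (A : X →L[ℝ] Y) (f : L2T T Y) (g : L2T T X) :
    ⟪f, lift T A g⟫_ℝ = ∫ t in Ioo 0 T, ⟪f t, A (g t)⟫_ℝ := by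
  rw [L2.inner_def]
  refine integral_congr_ae ?_
  filter_upwards [coeFn_lift A g] with t b
  rw [b]

theorem inner_lift_adjoint [CompleteSpace X] [CompleteSpace Y] (A : X →L[ℝ] Y) (f : L2T T Y)
    (g : L2T T X) : ⟪lift T A.adjoint f, g⟫_ℝ = ⟪f, lift T A g⟫_ℝ := by
  rw [inner_lift_right, L2.inner_def]
  refine integral_congr_ae ?_
  filter_upwards [coeFn_lift A.adjoint f] with t b
  rw [b, ContinuousLinearMap.adjoint_inner_left]

theorem le_norm_lift (A : X →L[ℝ] Y) {c : ℝ} (hc : 0 ≤ c) (hA : ∀ x, c * ‖x‖ ≤ ‖A x‖)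
    (f : L2T T X) : c * ‖f‖ ≤ ‖lift T A f‖ := by
  have h : ‖c • f‖ ≤ ‖lift T A f‖ := by
    refine Lp.norm_le_norm_of_ae_le ?_
    filter_upwards [Lp.coeFn_smul c f, coeFn_lift A f] with t a b
    rw [a, b, Pi.smul_apply, norm_smul, Real.norm_of_nonneg hc]
    exact hA _
  rwa [norm_smul, Real.norm_of_nonneg hc] at h

/-- The duality pairing between `L²(0, T; X*)` and `L²(0, T; X)`. -/
def pairing (T : ℝ) (X : Type) [NormedAddCommGroup X] [InnerProductSpace ℝ X] :
    L2T T (X →L[ℝ] ℝ) →L[ℝ] L2T T X →L[ℝ] ℝ :=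
  (ContinuousLinearMap.id ℝ (X →L[ℝ] ℝ)).lpPairing (volume.restrict (Ioo 0 T)) 2 2

theorem pairing_apply (f : L2T T (X →L[ℝ] ℝ)) (g : L2T T X) :
    pairing T X f g = ∫ t in Ioo 0 T, f t (g t) :=
  (ContinuousLinearMap.id ℝ (X →L[ℝ] ℝ)).lpPairing_eq_integral f g

theorem norm_lpPairing_le {X' : Type} [NormedAddCommGroup X'] [NormedSpace ℝ X']
    {Z : Type} [NormedAddCommGroup Z] [NormedSpace ℝ Z]
    (B : X' →L[ℝ] Z →L[ℝ] ℝ) (f : L2T T X') (g : L2T T Z) :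
    ‖B.lpPairing (volume.restrict (Ioo 0 T)) 2 2 f g‖ ≤ ‖B‖ * ‖f‖ * ‖g‖ := by
  refine le_trans ?_ (B.norm_holder_apply_apply_le (r := 1) f g)
  have h : ∫ t in Ioo 0 T, (B.holder 1 f g) t = ∫ t in Ioo 0 T, B (f t) (g t) :=
    integral_congr_ae (B.coeFn_holder (r := 1) f g)
  rw [B.lpPairing_eq_integral, ← h, L1.norm_eq_integral_norm]
  exact norm_integral_le_integral_norm _

theorem exists_pairing_le (T : ℝ) (X : Type) [NormedAddCommGroup X] [InnerProductSpace ℝ X] :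
    ∃ M : ℝ, 0 ≤ M ∧ ∀ (f : L2T T (X →L[ℝ] ℝ)) (g : L2T T X),
      pairing T X f g ≤ M * ‖f‖ * ‖g‖ :=
  ⟨‖ContinuousLinearMap.id ℝ (X →L[ℝ] ℝ)‖, ContinuousLinearMap.opNorm_nonneg _, fun f g =>
    (le_abs_self _).trans (norm_lpPairing_le (ContinuousLinearMap.id ℝ (X →L[ℝ] ℝ)) f g)⟩

theorem integrable_pairing (f : L2T T (X →L[ℝ] ℝ)) (g : L2T T X) :
    Integrable (fun t => f t (g t)) (volume.restrict (Ioo 0 T)) :=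
  memLp_one_iff_integrable.1 ((ContinuousLinearMap.id ℝ (X →L[ℝ] ℝ)).memLp_of_bilin 1
    (Lp.memLp f) (Lp.memLp g))

theorem integrable_inner_lift (A B : X →L[ℝ] Y) (f g : L2T T X) :
    Integrable (fun t => ⟪A (f t), B (g t)⟫_ℝ) (volume.restrict (Ioo 0 T)) :=
  memLp_one_iff_integrable.1 (((innerSL ℝ : Y →L[ℝ] Y →L[ℝ] ℝ).bilinearComp A B).memLp_of_bilin 1
    (Lp.memLp f) (Lp.memLp g))

theorem integrable_inner_right (B : X →L[ℝ] Y) (f : L2T T Y) (g : L2T T X) :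
    Integrable (fun t => ⟪f t, B (g t)⟫_ℝ) (volume.restrict (Ioo 0 T)) :=
  memLp_one_iff_integrable.1 (((innerSL ℝ : Y →L[ℝ] Y →L[ℝ] ℝ).bilinearComp
    (ContinuousLinearMap.id ℝ Y) B).memLp_of_bilin 1 (Lp.memLp f) (Lp.memLp g))

end Lifting

/-! ### Integrated equations, duality estimates and maximal regularity -/

section WeakForms

open scoped InnerProductSpace

variable {T : ℝ} {V H W : Type}
  [NormedAddCommGroup V] [InnerProductSpace ℝ V] [CompleteSpace V]
  [NormedAddCommGroup H] [InnerProductSpace ℝ H]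
  [NormedAddCommGroup W] [InnerProductSpace ℝ W]

/-- The constant function in `L²(0, T; H)`. -/
def constFun (T : ℝ) (H : Type) [NormedAddCommGroup H] [InnerProductSpace ℝ H] :
    H →L[ℝ] L2T T H :=
  Lp.constL 2 (volume.restrict (Ioo 0 T)) ℝ

theorem coeFn_constFun (v : H) : constFun T H v =ᵐ[volume.restrict (Ioo 0 T)] fun _ => v :=
  Lp.coeFn_const (p := 2) (μ := volume.restrict (Ioo 0 T)) v

/-- The integrated form of an evolution equation with initial value `u₀`. -/
theorem exists_weak_form (j : V →L[ℝ] H) (G : V →L[ℝ] W) {f u' : L2T T (V →L[ℝ] ℝ)}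
    {u₀ : H} {z : L2T T H} {u : L2T T V}
    (htr : ∀ᵐ t ∂(volume.restrict (Ioo 0 T)), ∀ φ,
      ⟪j (u t), j φ⟫_ℝ = ⟪u₀, j φ⟫_ℝ + prim T u' t φ)
    (heq : ∀ᵐ t ∂(volume.restrict (Ioo 0 T)), ∀ φ,
      u' t φ + ⟪G (u t), G φ⟫_ℝ = f t φ + ⟪z t, j φ⟫_ℝ) :
    ∃ U : L2T T V →L[ℝ] ℝ,
      (∀ w, U w + ⟪lift T G u, lift T G w⟫_ℝ = pairing T V f w + ⟪z, lift T j w⟫_ℝ) ∧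
      ∀ y, U (primR T V y) = ⟪lift T j u - constFun T H u₀, lift T j y⟫_ℝ := by
  refine ⟨pairing T V u', fun w => ?_, fun y => ?_⟩
  · rw [pairing_apply, pairing_apply, inner_lift, inner_lift_right,
      ← integral_add (integrable_pairing u' w) (integrable_inner_lift G G u w),
      ← integral_add (integrable_pairing f w) (integrable_inner_right _ z w)]
    refine integral_congr_ae ?_
    filter_upwards [heq] with t ht
    exact ht _
  · rw [pairing_apply, inner_lift_right]
    -- Fubini moves the primitive from `y` to `u'`, where the trace relation turns it into `j u -
    -- u₀`.
    refine (integral_bilin_primL (ContinuousLinearMap.id ℝ (V →L[ℝ] ℝ)) u' y).symm.trans ?_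
    refine integral_congr_ae ?_
    filter_upwards [htr, coeFn_primL u', Lp.coeFn_sub (lift T j u) (constFun T H u₀),
      coeFn_lift j u, coeFn_constFun (T := T) u₀] with t a b c d e
    rw [b, c, Pi.sub_apply, d, e, inner_sub_left, a]
    simp

/-- The integrated form of a backward evolution equation with zero terminal value. -/
theorem exists_weak_form_backward (j : V →L[ℝ] H) (G : V →L[ℝ] W) {p' : L2T T (V →L[ℝ] ℝ)}
    {g : L2T T H} {p : L2T T V}
    (htr : ∀ᵐ t ∂(volume.restrict (Ioo 0 T)), ∀ φ,
      ⟪j (p t), j φ⟫_ℝ = (prim T p' t - ∫ τ in Ioo 0 T, p' τ) φ)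
    (heq : ∀ᵐ t ∂(volume.restrict (Ioo 0 T)), ∀ φ,
      -(p' t φ) + ⟪G (p t), G φ⟫_ℝ = ⟪g t, j φ⟫_ℝ) :
    ∃ P : L2T T V →L[ℝ] ℝ,
      (∀ w, P w + ⟪lift T G p, lift T G w⟫_ℝ = ⟪g, lift T j w⟫_ℝ) ∧
      ∀ y, P (primL T V y) = ⟪lift T j p, lift T j y⟫_ℝ := by
  refine ⟨-pairing T V p', fun w => ?_, fun y => ?_⟩
  · have i1 : Integrable (fun t => -(p' t (w t))) (volume.restrict (Ioo 0 T)) :=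
      (integrable_pairing p' w).neg
    rw [neg_apply, pairing_apply, inner_lift, inner_lift_right, ← integral_neg,
      ← integral_add i1 (integrable_inner_lift G G p w)]
    refine integral_congr_ae ?_
    filter_upwards [heq] with t ht
    exact ht _
  · rw [neg_apply, pairing_apply, inner_lift, neg_eq_iff_eq_neg, ← integral_neg]
    refine (integral_bilin_primL (ContinuousLinearMap.id ℝ (V →L[ℝ] ℝ)).flip y p').trans ?_
    refine integral_congr_ae ?_
    filter_upwards [htr, coeFn_primR p'] with t a b
    rw [b, a]
    simp

variable [CompleteSpace H] [CompleteSpace W]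

/-- Solvability with right-hand side in `L²(0, T; H)` and zero initial value. -/
theorem exists_strong_solution_primL (j : V →L[ℝ] H) (G : V →L[ℝ] W) {c : ℝ} (hc : 0 < c)
    (hG : ∀ v, c * ‖v‖ ≤ ‖G v‖) (g : L2T T H) :
    ∃ (v : L2T T V) (ψ : L2T T H), lift T j v = primL T H ψ ∧
      (∀ w, ⟪ψ, lift T j w⟫_ℝ + ⟪lift T G v, lift T G w⟫_ℝ = ⟪g, lift T j w⟫_ℝ) ∧
      ‖ψ‖ ≤ ‖g‖ ∧ ‖v‖ ≤ ‖lift T j‖ / c ^ 2 * ‖g‖ ∧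
      ∀ (U : L2T T V →L[ℝ] ℝ) (u : L2T T V) (u₀ : L2T T H),
        (∀ y, U (primL T V y) = ⟪lift T j u - u₀, lift T j y⟫_ℝ) →
        ⟪g, lift T j u⟫_ℝ = U v + ⟪u₀, ψ⟫_ℝ + ⟪lift T G u, lift T G v⟫_ℝ :=
  exists_strong_solution (lift T j) (lift T G) (primL T V) (primL T H) (primL T W) hc
    (le_norm_lift G hc.le hG) (lift_primL j) (lift_primL G) inner_primL_self_nonneg
    inner_primL_self_nonneg g

/-- Solvability with right-hand side in `L²(0, T; H)` and zero terminal value. -/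
theorem exists_strong_solution_primR (j : V →L[ℝ] H) (G : V →L[ℝ] W) {c : ℝ} (hc : 0 < c)
    (hG : ∀ v, c * ‖v‖ ≤ ‖G v‖) (g : L2T T H) :
    ∃ (v : L2T T V) (ψ : L2T T H), lift T j v = primR T H ψ ∧
      (∀ w, ⟪ψ, lift T j w⟫_ℝ + ⟪lift T G v, lift T G w⟫_ℝ = ⟪g, lift T j w⟫_ℝ) ∧
      ‖ψ‖ ≤ ‖g‖ ∧ ‖v‖ ≤ ‖lift T j‖ / c ^ 2 * ‖g‖ ∧
      ∀ (U : L2T T V →L[ℝ] ℝ) (u : L2T T V) (u₀ : L2T T H),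
        (∀ y, U (primR T V y) = ⟪lift T j u - u₀, lift T j y⟫_ℝ) →
        ⟪g, lift T j u⟫_ℝ = U v + ⟪u₀, ψ⟫_ℝ + ⟪lift T G u, lift T G v⟫_ℝ :=
  exists_strong_solution (lift T j) (lift T G) (primR T V) (primR T H) (primR T W) hc
    (le_norm_lift G hc.le hG) (lift_primR j) (lift_primR G) inner_primR_self_nonneg
    inner_primR_self_nonneg g

/-- An equation tested with `L²(0, T; V)` holds almost everywhere in time. -/
theorem ae_eq_of_weak (j : V →L[ℝ] H) (G : V →L[ℝ] W) {ψ d : L2T T H} {v : L2T T V}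
    (h : ∀ w, ⟪ψ, lift T j w⟫_ℝ + ⟪lift T G v, lift T G w⟫_ℝ = ⟪d, lift T j w⟫_ℝ) :
    ∀ᵐ t ∂(volume.restrict (Ioo 0 T)), ∀ φ,
      ⟪ψ t, j φ⟫_ℝ + ⟪G (v t), G φ⟫_ℝ = ⟪d t, j φ⟫_ℝ := by
  -- With adjoints the weak equation becomes one identity in `L²(0, T; V)`, so the exceptional null
  -- set does not depend on `φ`.
  have h0 : lift T j.adjoint ψ + lift T G.adjoint (lift T G v) - lift T j.adjoint d = 0 := by
    refine ext_inner_right ℝ fun w => ?_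
    rw [inner_sub_left, inner_add_left, inner_lift_adjoint, inner_lift_adjoint, inner_lift_adjoint,
      h, sub_self, inner_zero_left]
  filter_upwards [coeFn_lift j.adjoint ψ, coeFn_lift G.adjoint (lift T G v), coeFn_lift G v,
    coeFn_lift j.adjoint d, Lp.coeFn_add (lift T j.adjoint ψ) (lift T G.adjoint (lift T G v)),
    Lp.coeFn_sub (lift T j.adjoint ψ + lift T G.adjoint (lift T G v)) (lift T j.adjoint d),
    Lp.coeFn_zero V 2 (volume.restrict (Ioo 0 T))] with t e1 e2 e3 e4 e5 e6 e7 φ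
  rw [h0, e7, Pi.sub_apply, e5, Pi.add_apply, e1, e2, e3, e4, Pi.zero_apply] at e6
  have e8 := congrArg (fun x => ⟪x, φ⟫_ℝ) e6
  simp only [inner_sub_left, inner_add_left, ContinuousLinearMap.adjoint_inner_left,
    inner_zero_left] at e8
  linarith

/-- The a priori estimate of weak solutions in `L²(0, T; H)`. -/
theorem exists_norm_lift_le (T : ℝ) (j : V →L[ℝ] H) (G : V →L[ℝ] W) {c : ℝ} (hc : 0 < c)
    (hG : ∀ v, c * ‖v‖ ≤ ‖G v‖) :
    ∃ C : ℝ, 0 ≤ C ∧ ∀ (f : L2T T (V →L[ℝ] ℝ)) (u₀ : H) (z : L2T T H) (u : L2T T V)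
      (U : L2T T V →L[ℝ] ℝ),
      (∀ w, U w + ⟪lift T G u, lift T G w⟫_ℝ = pairing T V f w + ⟪z, lift T j w⟫_ℝ) →
      (∀ y, U (primR T V y) = ⟪lift T j u - constFun T H u₀, lift T j y⟫_ℝ) →
        ‖lift T j u‖ ≤ C * (‖f‖ + ‖u₀‖ + ‖z‖) := by
  set J := lift T j
  set D : ℝ := ‖J‖ / c ^ 2
  have hD0 : 0 ≤ D := by positivity
  obtain ⟨M, hM0, hM⟩ := exists_pairing_le T V
  set a₁ : ℝ := M * D with ha₁
  set a₂ : ℝ := ‖constFun T H‖ with ha₂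
  set a₃ : ℝ := ‖J‖ * D with ha₃
  have h1 : 0 ≤ a₁ := by positivity
  have h2 : 0 ≤ a₂ := by positivity
  have h3 : 0 ≤ a₃ := by positivity
  refine ⟨a₁ + a₂ + a₃, by positivity, fun f u₀ z u U hU hUR => ?_⟩
  -- The backward problem is solved with right-hand side `J u`. Duality then expresses `‖J u‖²` as
  -- the pairing of the data with `v` and `ψ`, both bounded by multiples of `‖J u‖`.
  obtain ⟨v, ψ, -, -, hψ, hv, hdual⟩ := exists_strong_solution_primR j G hc hG (J u)
  have e := hdual U u (constFun T H u₀) hUR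
  have e2 := hU v
  rw [real_inner_self_eq_norm_sq] at e
  have b1 : pairing T V f v ≤ a₁ * ‖f‖ * ‖J u‖ := by
    calc pairing T V f v ≤ M * ‖f‖ * ‖v‖ := hM f v
      _ ≤ M * ‖f‖ * (D * ‖J u‖) := by gcongr
      _ = a₁ * ‖f‖ * ‖J u‖ := by rw [ha₁]; ring
  have b2 : ⟪constFun T H u₀, ψ⟫_ℝ ≤ a₂ * ‖u₀‖ * ‖J u‖ :=
    (real_inner_le_norm _ _).trans
      (mul_le_mul ((constFun T H).le_opNorm u₀) hψ (norm_nonneg _) (by positivity))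
  have b3 : ⟪z, J v⟫_ℝ ≤ a₃ * ‖z‖ * ‖J u‖ := by
    calc ⟪z, J v⟫_ℝ ≤ ‖z‖ * ‖J v‖ := real_inner_le_norm _ _
      _ ≤ ‖z‖ * (‖J‖ * (D * ‖J u‖)) := by
        gcongr
        exact (J.le_opNorm v).trans (by gcongr)
      _ = a₃ * ‖z‖ * ‖J u‖ := by rw [ha₃]; ring
  have key : ‖J u‖ * ‖J u‖ ≤ (a₁ + a₂ + a₃) * (‖f‖ + ‖u₀‖ + ‖z‖) * ‖J u‖ := by
    have hf := norm_nonneg f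
    have hu0 := norm_nonneg u₀
    have hz := norm_nonneg z
    have : a₁ * ‖f‖ + a₂ * ‖u₀‖ + a₃ * ‖z‖ ≤ (a₁ + a₂ + a₃) * (‖f‖ + ‖u₀‖ + ‖z‖) := by
      nlinarith [mul_nonneg h1 hu0, mul_nonneg h1 hz, mul_nonneg h2 hf, mul_nonneg h2 hz,
        mul_nonneg h3 hf, mul_nonneg h3 hu0]
    calc ‖J u‖ * ‖J u‖ ≤ (a₁ * ‖f‖ + a₂ * ‖u₀‖ + a₃ * ‖z‖) * ‖J u‖ := by linarith
      _ ≤ _ := mul_le_mul_of_nonneg_right this (norm_nonneg _)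
  rcases (norm_nonneg (J u)).eq_or_lt with h0 | h0
  · rw [← h0]
    positivity
  · exact le_of_mul_le_mul_right key h0

/-- Maximal regularity of weak solutions with zero terminal value. -/
theorem exists_eq_primR (j : V →L[ℝ] H) (G : V →L[ℝ] W) {c : ℝ} (hc : 0 < c)
    (hG : ∀ v, c * ‖v‖ ≤ ‖G v‖) {g : L2T T H} {p : L2T T V} {P : L2T T V →L[ℝ] ℝ}
    (hP : ∀ w, P w + ⟪lift T G p, lift T G w⟫_ℝ = ⟪g, lift T j w⟫_ℝ)
    (hPL : ∀ y, P (primL T V y) = ⟪lift T j p, lift T j y⟫_ℝ) :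
    ∃ ψ : L2T T H, lift T j p = primR T H ψ ∧ ‖ψ‖ ≤ ‖g‖ := by
  obtain ⟨q, ψ, hq, hqe, hψ, -, -⟩ := exists_strong_solution_primR j G hc hG g
  -- Uniqueness: `p - q` solves the backward problem weakly with zero data. Pairing it with the
  -- forward solution for the right-hand side `j (p - q)` gives `‖j (p - q)‖² = 0`. The weak time
  -- derivative of `p - q` is represented by `P - ⟪ψ, j ·⟫`.
  obtain ⟨v, χ, -, -, -, -, hdual⟩ := exists_strong_solution_primL j G hc hG (lift T j (p - q))
  have e := hdual (P - (innerSL ℝ ψ).comp (lift T j)) (p - q) 0 fun y => by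
    have h1 : ⟪ψ, primL T H (lift T j y)⟫_ℝ = ⟪lift T j q, lift T j y⟫_ℝ := by
      rw [real_inner_comm, inner_primL, ← hq, real_inner_comm]
    rw [sub_apply, ContinuousLinearMap.comp_apply, innerSL_apply_apply, hPL, lift_primL, h1,
      sub_zero, map_sub, inner_sub_left]
  have e0 : ⟪lift T j (p - q), lift T j (p - q)⟫_ℝ = 0 := by
    rw [e, sub_apply, ContinuousLinearMap.comp_apply, innerSL_apply_apply, inner_zero_left,
      map_sub (lift T G), inner_sub_left]
    linarith [hP v, hqe v]
  rw [inner_self_eq_zero, map_sub, sub_eq_zero] at e0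
  exact ⟨ψ, e0.trans hq, hψ⟩

end WeakForms

/-! ### Traces of functions in the solution space -/

section FractionalHeat

open scoped InnerProductSpace

variable {n : ℕ} {s : ℝ≥0} {Ω : Set (E n)} {T : ℝ}

/-- Functions in `𝕍` are primitives of their time derivatives in `H^{-s}(Ω)`. -/
theorem MemV.ae_eq_prim (hT : 0 < T) {v : L2T T (Htilde s Ω)} {v' : L2T T (Hneg s Ω)}
    (hv : MemV v v') {t₀ : ℝ} (ht₀ : t₀ ∈ Icc 0 T) {v₀ : L2 Ω} (h : HasTraceAt v t₀ v₀) :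
    ∀ᵐ t ∂(volume.restrict (Ioo 0 T)),
      toHneg s Ω (restr s Ω (v t)) = toHneg s Ω v₀ + (prim T v' t - prim T v' t₀) := by
  obtain ⟨c, hc⟩ := hv.2.exists_eq_prim hT
  obtain ⟨V, hV, hVv, hV0⟩ := h
  have hc' : ∀ᵐ t ∂(volume.restrict (Ioo 0 T)),
      toHneg s Ω (restr s Ω (v t)) = c + prim T v' t := by
    filter_upwards [hc, ContinuousLinearMap.coeFn_compLp (𝕜 := ℝ) (𝕜' := ℝ)
      (E := L2 Ω) (F := Hneg s Ω) (toHneg s Ω) ((restr s Ω).compLp v),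
      (restr s Ω).coeFn_compLp v] with t h1 h2 h3
    rw [← h1, h2, h3]
  -- Both sides are continuous and agree almost everywhere, hence on all of `[0, T]`; evaluation at
  -- `t₀` then determines `c`.
  have heq : EqOn (fun t => toHneg s Ω (V t)) (fun t => c + prim T v' t) (Icc 0 T) := by
    refine Measure.eqOn_Icc_of_ae_eq volume hT.ne ?_
      ((toHneg s Ω).continuous.comp_continuousOn hV)
      (continuous_const.add (continuous_prim (L2T.integrable v'))).continuousOn
    rw [← Measure.restrict_congr_set (μ := volume) Ioo_ae_eq_Icc]
    filter_upwards [hc', hVv] with t h1 h2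
    rw [h2, h1]
  have h0 := heq ht₀
  simp only [hV0] at h0
  filter_upwards [hc'] with t h1
  rw [h1, h0]
  abel

end FractionalHeat

/-! ### The linearized state and its pairing with the adjoint state -/

section Linearization

open scoped InnerProductSpace

variable {T : ℝ} {V H W : Type}
  [NormedAddCommGroup V] [InnerProductSpace ℝ V] [CompleteSpace V]
  [NormedAddCommGroup H] [InnerProductSpace ℝ H] [CompleteSpace H]
  [NormedAddCommGroup W] [InnerProductSpace ℝ W] [CompleteSpace W]

/-- The linearized state in a direction `d`, and its duality with the adjoint state `p`. -/
theorem exists_linearized_state (j : V →L[ℝ] H) (G : V →L[ℝ] W) {c : ℝ} (hc : 0 < c)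
    (hG : ∀ v, c * ‖v‖ ≤ ‖G v‖) {g : L2T T H} {p : L2T T V} {P : L2T T V →L[ℝ] ℝ}
    (hP : ∀ w, P w + ⟪lift T G p, lift T G w⟫_ℝ = ⟪g, lift T j w⟫_ℝ)
    (hPL : ∀ y, P (primL T V y) = ⟪lift T j p, lift T j y⟫_ℝ) (d : L2T T H) :
    ∃ (y : L2T T V) (χ : L2T T H), lift T j y = primL T H χ ∧
      (∀ᵐ t ∂(volume.restrict (Ioo 0 T)), ∀ φ,
        ⟪χ t, j φ⟫_ℝ + ⟪G (y t), G φ⟫_ℝ = ⟪d t, j φ⟫_ℝ) ∧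
      ⟪g, lift T j y⟫_ℝ = ⟪d, lift T j p⟫_ℝ := by
  obtain ⟨y, χ, h1, h2, -, -, h3⟩ := exists_strong_solution_primL j G hc hG d
  refine ⟨y, χ, h1, ae_eq_of_weak j G h2, ?_⟩
  -- Duality with `u = p` and `u₀ = 0` gives `⟪d, j p⟫ = P y + ⟪G p, G y⟫`, which is the adjoint
  -- equation tested with `y`.
  rw [h3 P p 0 fun w => by rw [sub_zero, hPL], inner_zero_left, add_zero, hP]

theorem nonneg_of_forall_quadratic {α β : ℝ} (h : ∀ θ, 0 < θ → θ ≤ 1 → 0 ≤ θ * α + θ ^ 2 * β) :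
    0 ≤ α := by
  by_contra! hα
  have hβ : 0 < |β| + 1 - α := by linarith [abs_nonneg β]
  -- For `α < 0` this `θ` is at most `1` and satisfies `θ |β| < -α`, so `α + θ β < 0`.
  have hθ : 0 < -α / (|β| + 1 - α) := div_pos (by linarith) hβ
  have h1 := h _ hθ ((div_le_one hβ).2 (by linarith [abs_nonneg β]))
  rw [pow_two, mul_assoc, ← mul_add] at h1
  have h2 := nonneg_of_mul_nonneg_right h1 hθ
  have h3 : -α / (|β| + 1 - α) * β ≤ -α / (|β| + 1 - α) * |β| :=
    mul_le_mul_of_nonneg_left (le_abs_self β) hθ.le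
  have h4 : -α / (|β| + 1 - α) * (|β| + 1 - α) = -α := div_mul_cancel₀ _ hβ.ne'
  nlinarith

end Linearization

/-! ### Perturbing a weak derivative by a primitive -/

section TimeDerivative

variable {T : ℝ} {X : Type} [NormedAddCommGroup X] [NormedSpace ℝ X]

theorem prim_add (f g : L2T T X) (t : ℝ) : prim T (f + g : L2T T X) t = prim T f t + prim T g t := by
  rw [prim_congr (Lp.coeFn_add f g)]
  exact intervalIntegral.integral_add (intervalIntegrable_of_integrable (L2T.integrable f) _ _)
    (intervalIntegrable_of_integrable (L2T.integrable g) _ _)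

theorem HasWeakTimeDeriv.exists_add_prim [CompleteSpace X] {Y Z : Type} [NormedAddCommGroup Y]
    [NormedSpace ℝ Y] [CompleteSpace Y] [NormedAddCommGroup Z] [NormedSpace ℝ Z]
    (hT : 0 < T) (A : X →L[ℝ] Y) (B : Y →L[ℝ] Z →L[ℝ] ℝ) {u y : L2T T X} {χ : L2T T Y}
    {u' : L2T T (Z →L[ℝ] ℝ)} (hu : HasWeakTimeDeriv (B.compLp (A.compLp u)) u')
    (hy : ∀ᵐ t ∂(volume.restrict (Ioo 0 T)), A (y t) = prim T χ t) :
    ∃ v' : L2T T (Z →L[ℝ] ℝ), HasWeakTimeDeriv (B.compLp (A.compLp (u + y))) v' ∧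
      ∀ᵐ t ∂(volume.restrict (Ioo 0 T)), ∀ φ, v' t φ = u' t φ + B (χ t) φ := by
  refine ⟨u' + B.compLp χ, ?_, ?_⟩
  · obtain ⟨c, hc⟩ := hu.exists_eq_prim hT
    refine hasWeakTimeDeriv_of_prim c ?_
    filter_upwards [hc, hy, Lp.coeFn_add u y, B.coeFn_compLp (A.compLp u), A.coeFn_compLp u,
      B.coeFn_compLp (A.compLp (u + y)), A.coeFn_compLp (u + y)] with t h1 h2 h3 h4 h5 h6 h7
    rw [h6, h7, h3, Pi.add_apply, map_add, map_add, ← h5, ← h4, h1, h2, prim_add, prim_compLp,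
      add_assoc]
  · filter_upwards [Lp.coeFn_add u' (B.compLp χ), B.coeFn_compLp χ] with t h1 h2 φ
    rw [h1, Pi.add_apply, h2, add_apply]

end TimeDerivative

/-! ### The control problem and its first-order condition -/

section FractionalHeat

open scoped InnerProductSpace

variable {n : ℕ} {s : ℝ≥0} {Ω : Set (E n)} {T : ℝ}

theorem IsState.ae_inner {W : Type} [NormedAddCommGroup W] [InnerProductSpace ℝ W]
    {G : Htilde s Ω →L[ℝ] W} (hG : ∀ v w, bilin v w = ⟪G v, G w⟫_ℝ) (hT : 0 < T)
    {f : L2T T (Hneg s Ω)} {u₀ : L2 Ω} {z : L2T T (L2 Ω)} {u : L2T T (Htilde s Ω)}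
    (h : IsState f u₀ z u) :
    ∃ u' : L2T T (Hneg s Ω),
      (∀ᵐ t ∂(volume.restrict (Ioo 0 T)), ∀ φ,
        ⟪restr s Ω (u t), restr s Ω φ⟫_ℝ = ⟪u₀, restr s Ω φ⟫_ℝ + prim T u' t φ) ∧
      ∀ᵐ t ∂(volume.restrict (Ioo 0 T)), ∀ φ,
        u' t φ + ⟪G (u t), G φ⟫_ℝ = f t φ + ⟪z t, restr s Ω φ⟫_ℝ := by
  obtain ⟨u', hu, h0, he⟩ := h
  refine ⟨u', ?_, ?_⟩
  · filter_upwards [hu.ae_eq_prim hT (left_mem_Icc.2 hT.le) h0] with t ht φ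
    have := congrArg (fun A : Hneg s Ω => A φ) ht
    simpa [prim_zero, toHneg_apply] using this
  · filter_upwards [he] with t ht φ
    rw [← hG, ht, toHneg_apply]

theorem IsAdjointState.ae_inner {W : Type} [NormedAddCommGroup W] [InnerProductSpace ℝ W]
    {G : Htilde s Ω →L[ℝ] W} (hG : ∀ v w, bilin v w = ⟪G v, G w⟫_ℝ) (hT : 0 < T)
    {ud : L2T T (L2 Ω)} {u p : L2T T (Htilde s Ω)} (h : IsAdjointState ud u p) :
    ∃ p' : L2T T (Hneg s Ω),
      (∀ᵐ t ∂(volume.restrict (Ioo 0 T)), ∀ φ,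
        ⟪restr s Ω (p t), restr s Ω φ⟫_ℝ = (prim T p' t - ∫ τ in Ioo 0 T, p' τ) φ) ∧
      ∀ᵐ t ∂(volume.restrict (Ioo 0 T)), ∀ φ,
        -(p' t φ) + ⟪G (p t), G φ⟫_ℝ = ⟪(lift T (restr s Ω) u - ud) t, restr s Ω φ⟫_ℝ := by
  obtain ⟨p', hp, h0, he⟩ := h
  refine ⟨p', ?_, ?_⟩
  · filter_upwards [hp.ae_eq_prim hT (right_mem_Icc.2 hT.le) h0] with t ht φ
    rw [map_zero, zero_add, prim_end hT.le] at ht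
    exact congrArg (fun A : Hneg s Ω => A φ) ht
  · filter_upwards [he, Lp.coeFn_sub (lift T (restr s Ω) u) ud, coeFn_lift (restr s Ω) u]
      with t ht h1 h2 φ
    rw [← hG, ht, toHneg_apply, h1, Pi.sub_apply, h2]

/-- The state equation is affine. -/
theorem IsState.add {W : Type} [NormedAddCommGroup W] [InnerProductSpace ℝ W]
    {G : Htilde s Ω →L[ℝ] W} (hG : ∀ v w, bilin v w = ⟪G v, G w⟫_ℝ) (hT : 0 < T)
    {f : L2T T (Hneg s Ω)} {u₀ : L2 Ω} {z : L2T T (L2 Ω)} {u : L2T T (Htilde s Ω)}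
    (h : IsState f u₀ z u) {d χ : L2T T (L2 Ω)} {y : L2T T (Htilde s Ω)}
    (hy : lift T (restr s Ω) y = primL T (L2 Ω) χ)
    (hyd : ∀ᵐ t ∂(volume.restrict (Ioo 0 T)), ∀ φ,
      ⟪χ t, restr s Ω φ⟫_ℝ + ⟪G (y t), G φ⟫_ℝ = ⟪d t, restr s Ω φ⟫_ℝ) :
    IsState f u₀ (z + d) (u + y) := by
  obtain ⟨u', ⟨hu, hu'⟩, ⟨U, hU, hUu, hU0⟩, he⟩ := h
  have hy' : ∀ᵐ t ∂(volume.restrict (Ioo 0 T)), restr s Ω (y t) = prim T χ t := by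
    filter_upwards [coeFn_lift (restr s Ω) y, coeFn_primL χ] with t h1 h2
    rw [← h1, hy, h2]
  have hr : ∀ᵐ t ∂(volume.restrict (Ioo 0 T)),
      restr s Ω ((u + y : L2T T (Htilde s Ω)) t) = restr s Ω (u t) + prim T χ t := by
    filter_upwards [hy', Lp.coeFn_add u y] with t h1 h2
    rw [h2, Pi.add_apply, map_add, h1]
  obtain ⟨v', hv', hv⟩ := HasWeakTimeDeriv.exists_add_prim (X := Htilde s Ω) (Y := L2 Ω)
    (Z := Htilde s Ω) hT (restr s Ω) (toHneg s Ω) hu' hy'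
  refine ⟨v', ⟨(memLp_congr_ae hr).2 (hu.add (memLp_prim χ)), hv'⟩,
    ⟨fun t => U t + prim T χ t, ?_, ?_, ?_⟩, ?_⟩
  · exact hU.add (continuous_prim (L2T.integrable χ)).continuousOn
  · filter_upwards [hUu, hr] with t h1 h2
    rw [h2, h1]
  · simp only [hU0, prim_zero, add_zero]
  · filter_upwards [he, hyd, hv, Lp.coeFn_add z d, Lp.coeFn_add u y] with t h1 h2 h3 h5 h6 φ
    have e1 := h1 φ
    have e2 := h2 φ
    have e3 := h3 φ
    rw [toHneg_apply] at e3
    have e4 : bilin ((u + y : L2T T (Htilde s Ω)) t) φ = bilin (u t) φ + ⟪G (y t), G φ⟫_ℝ := by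
      rw [h6, Pi.add_apply, hG, hG, map_add, inner_add_left]
    have e5 : toHneg s Ω ((z + d : L2T T (L2 Ω)) t) φ =
        toHneg s Ω (z t) φ + ⟪d t, restr s Ω φ⟫_ℝ := by
      rw [h5, Pi.add_apply, toHneg_apply, inner_add_left, toHneg_apply]
    rw [e3, e4, e5]
    linarith

theorem cost_eq (μ : ℝ) (ud z : L2T T (L2 Ω)) (u : L2T T (Htilde s Ω)) :
    cost μ ud u z = 1 / 2 * (‖lift T (restr s Ω) u - ud‖ ^ 2 + μ * ‖z‖ ^ 2) := by
  have i : ∀ f : L2T T (L2 Ω), Integrable (fun t => ‖f t‖ ^ 2) (volume.restrict (Ioo 0 T)) :=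
    fun f => (memLp_two_iff_integrable_sq_norm (Lp.aestronglyMeasurable f)).1 (Lp.memLp f)
  have e : ∀ f : L2T T (L2 Ω), ‖f‖ ^ 2 = ∫ t in Ioo 0 T, ‖f t‖ ^ 2 := fun f => by
    rw [← real_inner_self_eq_norm_sq, L2.inner_def]
    simp only [real_inner_self_eq_norm_sq]
  rw [cost, e, e, ← integral_const_mul μ, ← integral_add (i _) ((i _).const_mul μ)]
  congr 1
  refine integral_congr_ae ?_
  filter_upwards [Lp.coeFn_sub (lift T (restr s Ω) u) ud, coeFn_lift (restr s Ω) u] with t h1 h2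
  rw [h1, Pi.sub_apply, h2]

theorem L2.smul_le_smul {f g : L2 Ω} (h : f ≤ g) {c : ℝ} (hc : 0 ≤ c) : c • f ≤ c • g := by
  rw [← Lp.coeFn_le] at h ⊢
  filter_upwards [h, Lp.coeFn_smul c f, Lp.coeFn_smul c g] with x h h1 h2
  rw [h1, h2]
  exact mul_le_mul_of_nonneg_left h hc

theorem add_smul_mem_admissible {a b z w : L2T T (L2 Ω)} (hz : z ∈ admissible a b)
    (hw : w ∈ admissible a b) {θ : ℝ} (h0 : 0 < θ) (h1 : θ ≤ 1) :
    z + θ • (w - z) ∈ admissible a b := by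
  have e : z + θ • (w - z) = (1 - θ) • z + θ • w := by
    rw [smul_sub, sub_smul, one_smul]
    abel
  rw [e]
  filter_upwards [hz, hw, Lp.coeFn_add ((1 - θ) • z) (θ • w), Lp.coeFn_smul (1 - θ) z,
    Lp.coeFn_smul θ w] with t hz hw e1 e2 e3
  rw [e1, Pi.add_apply, e2, e3, Pi.smul_apply, Pi.smul_apply]
  have hm : ∀ x : L2 Ω, x = (1 - θ) • x + θ • x := fun x => by
    rw [← add_smul, sub_add_cancel, one_smul]
  have h2 : 0 ≤ 1 - θ := by linarith
  constructor
  · rw [hm (a t)]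
    exact add_le_add (L2.smul_le_smul hz.1 h2)
      (L2.smul_le_smul hw.1 h0.le)
  · rw [hm (b t)]
    exact add_le_add (L2.smul_le_smul hz.2 h2)
      (L2.smul_le_smul hw.2 h0.le)

/-- The first-order optimality condition. -/
theorem IsOptimalPair.variational_inequality {W : Type} [NormedAddCommGroup W]
    [InnerProductSpace ℝ W] [CompleteSpace W]
    {G : Htilde s Ω →L[ℝ] W} {c : ℝ} (hc : 0 < c) (hGc : ∀ v, c * ‖v‖ ≤ ‖G v‖)
    (hG : ∀ v w, bilin v w = ⟪G v, G w⟫_ℝ) (hT : 0 < T) {μ : ℝ}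
    {f : L2T T (Hneg s Ω)} {u₀ : L2 Ω} {ud a b z : L2T T (L2 Ω)} {u p : L2T T (Htilde s Ω)}
    (h : IsOptimalPair μ f u₀ ud a b u z) (hp : IsAdjointState ud u p) {w : L2T T (L2 Ω)}
    (hw : w ∈ admissible a b) :
    0 ≤ ⟪w - z, lift T (restr s Ω) p + μ • z⟫_ℝ := by
  obtain ⟨hz, hu, hmin⟩ := h
  obtain ⟨p', h1, h2⟩ := hp.ae_inner hG hT
  obtain ⟨P, hP, hPL⟩ := exists_weak_form_backward (restr s Ω) G h1 h2
  obtain ⟨y, χ, hy, hyd, hdual⟩ := exists_linearized_state (restr s Ω) G hc hGc hP hPL (w - z)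
  -- Along the segment from `z` to `w` the cost increment is exactly `θ α + θ² β`. The adjoint
  -- duality `hdual` rewrites its linear part `α` in terms of `p`.
  refine nonneg_of_forall_quadratic (β := 1 / 2 * (‖lift T (restr s Ω) y‖ ^ 2 + μ * ‖w - z‖ ^ 2))
    fun θ h0 h1 => ?_
  have hs : IsState f u₀ (z + θ • (w - z)) (u + θ • y) := by
    refine hu.add hG hT (χ := θ • χ) ?_ ?_
    · rw [map_smul, hy, map_smul]
    · filter_upwards [hyd, Lp.coeFn_smul θ χ, Lp.coeFn_smul θ y, Lp.coeFn_smul θ (w - z)]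
        with t e1 e2 e3 e4 φ
      rw [e2, e3, e4, Pi.smul_apply, Pi.smul_apply, Pi.smul_apply, map_smul,
        real_inner_smul_left, real_inner_smul_left, real_inner_smul_left, ← e1, mul_add]
  have hle := hmin _ _ (add_smul_mem_admissible hz hw h0 h1) hs
  have e : lift T (restr s Ω) (u + θ • y) - ud =
      (lift T (restr s Ω) u - ud) + θ • lift T (restr s Ω) y := by
    rw [map_add, map_smul]
    abel
  rw [cost_eq, cost_eq, e, norm_add_sq_real, norm_add_sq_real, real_inner_smul_right,
    real_inner_smul_right, hdual, norm_smul, norm_smul, mul_pow, mul_pow, Real.norm_eq_abs,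
    sq_abs] at hle
  rw [inner_add_right, real_inner_smul_right, real_inner_comm z]
  linarith

end FractionalHeat

/-! ### Projection onto order intervals -/

section Projection

open scoped InnerProductSpace

/-- The obtuse-angle property of the projection of `q` onto `[a, b]`. The point `z` also guarantees
that the interval is nonempty. -/
theorem mul_sub_projection_nonpos {a b z q : ℝ} (h1 : a ≤ z) (h2 : z ≤ b) :
    (z - (a ⊔ q) ⊓ b) * (q - (a ⊔ q) ⊓ b) ≤ 0 := by
  rcases le_total a q with h | h
  · rw [sup_eq_right.2 h]
    rcases le_total q b with h' | h'
    · rw [inf_eq_left.2 h']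
      simp
    · rw [inf_eq_right.2 h']
      exact mul_nonpos_of_nonpos_of_nonneg (by linarith) (by linarith)
  · rw [sup_eq_left.2 h, inf_eq_left.2 (h1.trans h2)]
    exact mul_nonpos_of_nonneg_of_nonpos (by linarith) (by linarith)

theorem L2.inner_sub_projection_nonpos {n : ℕ} {Ω : Set (E n)} {a b z q : L2 Ω} (h1 : a ≤ z)
    (h2 : z ≤ b) : ⟪q - (a ⊔ q) ⊓ b, z - (a ⊔ q) ⊓ b⟫_ℝ ≤ 0 := by
  rw [L2.inner_def]
  refine integral_nonpos_of_ae ?_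
  rw [← Lp.coeFn_le] at h1 h2
  filter_upwards [h1, h2, Lp.coeFn_inf (a ⊔ q) b, Lp.coeFn_sup a q,
    Lp.coeFn_sub q ((a ⊔ q) ⊓ b), Lp.coeFn_sub z ((a ⊔ q) ⊓ b)] with x h1 h2 e1 e2 e3 e4
  rw [e3, e4, Pi.sub_apply, Pi.sub_apply, e1, Pi.inf_apply, e2, Pi.sup_apply]
  exact mul_sub_projection_nonpos h1 h2

variable {L : Type} [NormedAddCommGroup L] [Lattice L] [HasSolidNorm L] [IsOrderedAddMonoid L]

theorem norm_le_add_norm_of_le_of_le {a b z : L} (h1 : a ≤ z) (h2 : z ≤ b) :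
    ‖z‖ ≤ ‖a‖ + ‖b‖ := by
  have h : |z| ≤ |(|a| + |b|)| := by
    refine le_trans (abs_le'.2 ⟨?_, ?_⟩) (le_abs_self _)
    · exact (h2.trans (le_abs_self b)).trans (le_add_of_nonneg_left (abs_nonneg a))
    · exact ((neg_le_neg h1).trans (neg_le_abs a)).trans (le_add_of_nonneg_right (abs_nonneg b))
  calc ‖z‖ ≤ ‖(|a| + |b|)‖ := norm_le_norm_of_abs_le_abs h
    _ ≤ ‖(|a|)‖ + ‖(|b|)‖ := norm_add_le _ _
    _ = ‖a‖ + ‖b‖ := by rw [norm_abs_eq_norm, norm_abs_eq_norm]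

/-- Increments of suprema and infima are bounded by the sum of the increments of their arguments.
This lets regularity pass through the projection without a chain rule. -/
theorem norm_projection_sub_le (a q b a₁ q₁ b₁ : L) :
    ‖(a ⊔ q) ⊓ b - (a₁ ⊔ q₁) ⊓ b₁‖ ≤ ‖a - a₁‖ + ‖q - q₁‖ + ‖b - b₁‖ :=
  (norm_inf_sub_inf_le_add_norm _ _ _ _).trans
    (add_le_add_left (norm_sup_sub_sup_le_add_norm _ _ _ _) _)

end Projection

/-! ### Time regularity of projected curves -/

section Primitives

variable {T : ℝ} {X : Type} [NormedAddCommGroup X]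

theorem prim_neg [NormedSpace ℝ X] (f : L2T T X) (t : ℝ) : prim T (-f : L2T T X) t = -prim T f t := by
  rw [prim_congr (Lp.coeFn_neg f)]
  exact intervalIntegral.integral_neg

/-- The pointwise norm of a function in `L²(0, T; X)`. -/
def normFun (f : L2T T X) : L2T T ℝ := (Lp.memLp f).norm.toLp _

theorem norm_normFun (f : L2T T X) : ‖normFun f‖ = ‖f‖ := by
  rw [normFun, Lp.norm_toLp, eLpNorm_norm, Lp.norm_def]

theorem norm_prim_sub_prim_le [NormedSpace ℝ X] (f : L2T T X) {t₁ t₂ : ℝ} (h : t₁ ≤ t₂) :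
    ‖prim T f t₂ - prim T f t₁‖ ≤ prim T (normFun f) t₂ - prim T (normFun f) t₁ := by
  have e : ∀ t, prim T (normFun f) t = prim T (fun t => ‖f t‖) t :=
    prim_congr (Lp.memLp f).norm.coeFn_toLp
  rw [prim_sub_prim (L2T.integrable f), e, e, prim_sub_prim (L2T.integrable f).norm]
  exact intervalIntegral.norm_integral_le_integral_norm h

/-- The projection of a curve onto a moving order interval inherits weak differentiability. -/
theorem exists_weakTimeDeriv_projection {H : Type} [NormedAddCommGroup H] [InnerProductSpace ℝ H]
    [CompleteSpace H] [Lattice H] [HasSolidNorm H] [IsOrderedAddMonoid H]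
    {a b q z a' b' κ : L2T T H} {ca cb cq : H}
    (ha : ∀ᵐ t ∂(volume.restrict (Ioo 0 T)), a t = ca + prim T a' t)
    (hb : ∀ᵐ t ∂(volume.restrict (Ioo 0 T)), b t = cb + prim T b' t)
    (hq : ∀ᵐ t ∂(volume.restrict (Ioo 0 T)), q t = cq + prim T κ t)
    (hz : ∀ᵐ t ∂(volume.restrict (Ioo 0 T)), z t = (a t ⊔ q t) ⊓ b t) :
    ∃ z' : L2T T H, HasWeakTimeDeriv z z' ∧ ‖z'‖ ≤ ‖a'‖ + ‖κ‖ + ‖b'‖ := by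
  have hc : ∀ (c : H) (f : L2T T H), Continuous fun t => c + prim T f t := fun c f =>
    continuous_const.add (continuous_prim (L2T.integrable f))
  obtain ⟨z', h1, h2⟩ := exists_weakTimeDeriv_of_norm_sub_le
    (Z := fun t => ((ca + prim T a' t) ⊔ (cq + prim T κ t)) ⊓ (cb + prim T b' t))
    (((hc ca a').sup (hc cq κ)).inf (hc cb b')) (z := z)
    -- The three terms of the projection estimate are each bounded by the integral of the norm of
    -- the respective derivative.
    (m := normFun a' + normFun κ + normFun b')
    (by
      filter_upwards [ha, hb, hq, hz] with t h1 h2 h3 h4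
      rw [h4, h1, h2, h3]) (fun t₁ t₂ ht => by
      rw [← prim_sub_prim (L2T.integrable _), prim_add, prim_add, prim_add, prim_add]
      refine (norm_projection_sub_le _ _ _ _ _ _).trans ?_
      simp only [add_sub_add_left_eq_sub]
      linarith [norm_prim_sub_prim_le a' ht, norm_prim_sub_prim_le κ ht,
        norm_prim_sub_prim_le b' ht])
  refine ⟨z', h1, h2.trans ((norm_add_le _ _).trans ?_)⟩
  rw [norm_normFun]
  refine add_le_add_left ((norm_add_le _ _).trans ?_) _
  rw [norm_normFun, norm_normFun]

end Primitives

/-! ### The projection formula and the final estimate -/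

section Optimality

open scoped InnerProductSpace

variable {n : ℕ} {Ω : Set (E n)} {T : ℝ}

/-- The projection formula for a control satisfying the first-order optimality condition. -/
theorem eq_projection_of_variational_inequality {μ : ℝ} (hμ : 0 < μ) {a b z q : L2T T (L2 Ω)}
    (hab : ∀ᵐ t ∂(volume.restrict (Ioo 0 T)), a t ≤ b t) (hz : z ∈ admissible a b)
    (h : ∀ w ∈ admissible a b, 0 ≤ ⟪w - z, μ • (z - q)⟫_ℝ) :
    ∀ᵐ t ∂(volume.restrict (Ioo 0 T)), z t = (a t ⊔ q t) ⊓ b t := by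
  have hw : ∀ᵐ t ∂(volume.restrict (Ioo 0 T)),
      ((a ⊔ q) ⊓ b : L2T T (L2 Ω)) t = (a t ⊔ q t) ⊓ b t := by
    filter_upwards [Lp.coeFn_inf (a ⊔ q) b, Lp.coeFn_sup a q] with t e1 e2
    rw [e1, Pi.inf_apply, e2, Pi.sup_apply]
  set w : L2T T (L2 Ω) := (a ⊔ q) ⊓ b
  have h1 := h w (by
    filter_upwards [hw, hab] with t e h
    rw [e]
    exact ⟨le_inf le_sup_left h, inf_le_right⟩)
  rw [real_inner_smul_right] at h1
  have h2 := nonneg_of_mul_nonneg_right h1 hμ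
  have h3 : ⟪q - w, z - w⟫_ℝ ≤ 0 := by
    rw [L2.inner_def]
    refine integral_nonpos_of_ae ?_
    filter_upwards [hz, hw, Lp.coeFn_sub q w, Lp.coeFn_sub z w] with t hz e1 e2 e3
    rw [e2, e3, Pi.sub_apply, Pi.sub_apply, e1]
    exact L2.inner_sub_projection_nonpos hz.1 hz.2
  -- Adding the variational inequality tested with the projection `w` to the obtuse-angle inequality
  -- tested with `z` forces `z = w`.
  have h4 : ⟪z - w, z - w⟫_ℝ ≤ 0 := by
    have e1 : ⟪w - z, z - q⟫_ℝ = -⟪z - q, z - w⟫_ℝ := by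
      rw [← neg_sub z w, inner_neg_left, real_inner_comm]
    have e2 : ⟪z - w, z - w⟫_ℝ = ⟪z - q, z - w⟫_ℝ + ⟪q - w, z - w⟫_ℝ := by
      rw [← inner_add_left, sub_add_sub_cancel]
    linarith
  have h5 : z = w := sub_eq_zero.1 ((inner_self_eq_zero (𝕜 := ℝ)).1 (h4.antisymm real_inner_self_nonneg))
  rw [h5]
  exact hw

theorem norm_le_of_mem_admissible {a b z : L2T T (L2 Ω)} (hz : z ∈ admissible a b) :
    ‖z‖ ≤ ‖a‖ + ‖b‖ := by
  refine norm_le_add_norm_of_le_of_le ((Lp.coeFn_le _ _).1 ?_) ((Lp.coeFn_le _ _).1 ?_)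
  · filter_upwards [hz] with t h using h.1
  · filter_upwards [hz] with t h using h.2

theorem norm_le_h1Norm {X : Type} [NormedAddCommGroup X] (v v' : L2T T X) :
    ‖v‖ ≤ h1Norm v v' ∧ ‖v'‖ ≤ h1Norm v v' :=
  ⟨Real.le_sqrt_of_sq_le (by nlinarith [sq_nonneg ‖v'‖]),
    Real.le_sqrt_of_sq_le (by nlinarith [sq_nonneg ‖v‖])⟩

theorem norm_le_Sig {s : ℝ≥0} (v : L2 Ω) (g : L2T T (Hneg s Ω)) :
    ‖v‖ ≤ Sig v g ∧ ‖g‖ ≤ Sig v g :=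
  ⟨Real.le_sqrt_of_sq_le (by nlinarith [sq_nonneg ‖g‖]),
    Real.le_sqrt_of_sq_le (by nlinarith [sq_nonneg ‖v‖])⟩

end Optimality

/-- Time regularity of the optimal control and of its adjoint state. -/
theorem exists_time_regularity_bound (n : ℕ) (hn : 1 ≤ n) (Ω : Set (E n)) (hΩ : IsOpen Ω)
    (hΩb : Bornology.IsBounded Ω) (T : ℝ) (hT : 0 < T) (s : ℝ≥0) (hs₀ : 0 < s) (hs₁ : s < 1)
    (μ : ℝ) (hμ : 0 < μ) :
    ∃ C : ℝ, 0 < C ∧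
      ∀ (f : L2T T (Hneg s Ω)) (u₀ : L2 Ω)
        (ud a b a' b' : L2T T (L2 Ω)),
        (∀ᵐ t ∂(volume.restrict (Ioo 0 T)), a t ≤ b t) →
        HasWeakTimeDeriv a a' →
        HasWeakTimeDeriv b b' →
        ∀ (u p : L2T T (Htilde s Ω)) (z : L2T T (L2 Ω)),
          IsOptimalPair μ f u₀ ud a b u z →
          IsAdjointState ud u p →
          ∃ z' p' : L2T T (L2 Ω),
            HasWeakTimeDeriv z z' ∧
            HasWeakTimeDeriv ((restr s Ω).compLp p) p' ∧
            ‖z'‖ + ‖p'‖ ≤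
              C * (Sig u₀ f + ‖ud‖ + h1Norm a a' + h1Norm b b') := by
  obtain ⟨G, c, hc, hGc, hG⟩ := exists_gagliardo_operator hn hΩ.measurableSet hΩb hs₀ hs₁
  obtain ⟨C₁, hC₁, hle⟩ := exists_norm_lift_le (V := Htilde s Ω) T (restr s Ω) G hc hGc
  -- With `S` the data sum, `‖f‖ + ‖u₀‖ + ‖z‖ ≤ 2 S`, so `‖ψ‖ ≤ (2 C₁ + 1) S`. The derivatives of
  -- `z` and `p` cost `μ⁻¹ ‖ψ‖` and `‖ψ‖`, and the leading `1` pays for `‖a'‖ + ‖b'‖`.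
  refine ⟨1 + (μ⁻¹ + 1) * (2 * C₁ + 1), by positivity, ?_⟩
  intro f u₀ ud a b a' b' hab ha hb u p z hopt hp
  obtain ⟨u', hu1, hu2⟩ := hopt.2.1.ae_inner hG hT
  obtain ⟨U, hU, hUR⟩ := exists_weak_form (restr s Ω) G hu1 hu2
  have hJu := hle f u₀ z u U hU hUR
  obtain ⟨π, hp1, hp2⟩ := hp.ae_inner hG hT
  obtain ⟨P, hP, hPL⟩ := exists_weak_form_backward (restr s Ω) G hp1 hp2
  obtain ⟨ψ, hψ, hψn⟩ := exists_eq_primR (restr s Ω) G hc hGc hP hPL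
  have hz : ‖z‖ ≤ ‖a‖ + ‖b‖ := norm_le_of_mem_admissible hopt.1
  have hR : ∀ κ : L2T T (L2 Ω), ∀ᵐ t ∂(volume.restrict (Ioo 0 T)),
      primR T (L2 Ω) κ t = (∫ τ in Ioo 0 T, κ τ) + prim T (-κ : L2T T (L2 Ω)) t := fun κ => by
    filter_upwards [coeFn_primR κ] with t h
    rw [h, prim_neg, sub_eq_add_neg]
  obtain ⟨ca, hca⟩ := ha.exists_eq_prim hT
  obtain ⟨cb, hcb⟩ := hb.exists_eq_prim hT
  -- Since `p` restricted to `Ω` is `∫_t^T ψ`, this `q` is `-p/μ`, already written as a primitive so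
  -- that its derivative is explicit.
  have hproj := eq_projection_of_variational_inequality hμ (q := primR T (L2 Ω) (-(μ⁻¹ • ψ))) hab
    hopt.1 fun w hw => by
      have h := hopt.variational_inequality hc hGc hG hT hp hw
      have e : μ • (z - primR T (L2 Ω) (-(μ⁻¹ • ψ))) = lift T (restr s Ω) p + μ • z := by
        rw [map_neg, map_smul, sub_neg_eq_add, smul_add, smul_inv_smul₀ hμ.ne', ← hψ, add_comm]
      rwa [e]
  obtain ⟨z', hz', hzn⟩ := exists_weakTimeDeriv_projection hca hcb (hR _) hproj
  refine ⟨z', -ψ, hz', hasWeakTimeDeriv_of_prim (∫ τ in Ioo 0 T, ψ τ) ?_, ?_⟩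
  · have e : (restr s Ω).compLp p = primR T (L2 Ω) ψ := hψ
    rw [e]
    exact hR ψ
  · rw [neg_neg, norm_smul, Real.norm_of_nonneg (inv_nonneg.2 hμ.le)] at hzn
    rw [norm_neg]
    obtain ⟨ha1, ha2⟩ := norm_le_h1Norm a a'
    obtain ⟨hb1, hb2⟩ := norm_le_h1Norm b b'
    obtain ⟨hs1, hs2⟩ := norm_le_Sig u₀ f
    have hud := norm_nonneg ud
    have ha0 := norm_nonneg a
    have hb0 := norm_nonneg b
    have hu0 := norm_nonneg u₀
    set S := Sig u₀ f + ‖ud‖ + h1Norm a a' + h1Norm b b' with hS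
    have h1 : C₁ * (‖f‖ + ‖u₀‖ + ‖z‖) ≤ C₁ * (2 * S) :=
      mul_le_mul_of_nonneg_left (by linarith) hC₁
    have h2 : ‖ψ‖ ≤ (2 * C₁ + 1) * S := by
      have h3 := hψn.trans (norm_sub_le _ _)
      linarith
    have h3 : (μ⁻¹ + 1) * ‖ψ‖ ≤ (μ⁻¹ + 1) * ((2 * C₁ + 1) * S) :=
      mul_le_mul_of_nonneg_left h2 (by positivity)
    linarith

end FracHeat

end

theorem theorem4p3 (n : ℕ) (hn : 1 ≤ n) (Ω : Set (FracHeat.E n)) (hΩ : IsOpen Ω)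
    (hΩb : Bornology.IsBounded Ω) (T : ℝ) (hT : 0 < T) (s : ℝ≥0) (hs₀ : 0 < s) (hs₁ : s < 1)
    (μ : ℝ) (hμ : 0 < μ) :
    ∃ C : ℝ, 0 < C ∧
      ∀ (f : FracHeat.L2T T (FracHeat.Hneg s Ω)) (u₀ : FracHeat.L2 Ω)
        (ud a b a' b' : FracHeat.L2T T (FracHeat.L2 Ω)),
        (∀ᵐ t ∂(volume.restrict (Ioo 0 T)), a t ≤ b t) →
        FracHeat.HasWeakTimeDeriv a a' →
        FracHeat.HasWeakTimeDeriv b b' →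
        ∀ (u p : FracHeat.L2T T (FracHeat.Htilde s Ω)) (z : FracHeat.L2T T (FracHeat.L2 Ω)),
          FracHeat.IsOptimalPair μ f u₀ ud a b u z →
          FracHeat.IsAdjointState ud u p →
          ∃ z' p' : FracHeat.L2T T (FracHeat.L2 Ω),
            FracHeat.HasWeakTimeDeriv z z' ∧
            FracHeat.HasWeakTimeDeriv ((FracHeat.restr s Ω).compLp p) p' ∧
            ‖z'‖ + ‖p'‖ ≤
              C * (FracHeat.Sig u₀ f + ‖ud‖ + FracHeat.h1Norm a a' + FracHeat.h1Norm b b') :=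
  FracHeat.exists_time_regularity_bound n hn Ω hΩ hΩb T hT s hs₀ hs₁ μ hμ
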